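/- Let $q$ be a nonconstant rational function on $\mathbb{C}$. Definitions. (a) $q$ is a Halphen potential if it is bounded near infinity and if, for each $E\in\mathbb{C}$, the equation $y''+qy=Ey$ has a fundamental system of solutions that are meromorphic on $\mathbb{C}$. (b) For $g\in\mathbb{N}_0$, $q$ solves the $g$-th stationary (nonhomogeneous) KdV equation if there are rational functions $f_0,\dots,f_{g+1}$ with $f_0=1$, $f_{j+1}'=\tfrac14 f_j'''+q f_j'+\tfrac12 q' f_j$ for $0\le j\le g$ (so the integration constants are arbitrary), and $2f_{g+1}'=0$; $q$ is a rational KdV potential if it does so for some $g$. (c) With $F_g(E,z)=\sum_{j=0}^g f_{g-j}(z)E^j$, the expression $-\tfrac12 F_g''F_g+\tfrac14 (F_g')^2+(E-q)F_g^2$ is then a polynomial $R_{2g+1}(E)$ independent of $z$. If $g$ is minimal (that is, $q$ solves no $g'$-th stationary KdV equation with $g'<g$), $q$ is said to be associated with the curve $y^2=R_{2g+1}(E)$. (d) We say that $q$ has locus data $(M,(s_\ell),q_\infty,(\zeta_\ell))$ if $M\ge 1$ and $s_1,\dots,s_M\geq 1$ are integers, $q_\infty\in\mathbb{C}$, the points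 $\zeta_1,\dots,\zeta_M\in\mathbb{C}$ are pairwise distinct, $$q(z)=q_\infty-\sum_{\ell=1}^M s_\ell(s_\ell+1)(z-\zeta_\ell)^{-2},$$ and $$\sum_{\substack{\ell'=1\\ \ell'\ne\ell}}^M\frac{s_{\ell'}(s_{\ell'}+1)}{(\zeta_\ell-\zeta_{\ell'})^{2k+1}}=0\qquad\text{for } k=1,\dots,s_\ell \text{ and } \ell=1,\dots,M.$$ Then: 1. $q$ is a Halphen potential if and only if it has locus data. 2. $q$ is a rational KdV potential if and only if it has locus data. 3. For every $g\in\mathbb{N}_0$ and $q_\infty\in\mathbb{C}$, $q$ is associated with the curve $y^2=(E-q_\infty)^{2g+1}$ if and only if it has locus data with this $q_\infty$ and with $\sum_{\ell=1}^M s_\ell(s_\ell+1)=g(g+1)$. Moreover, whenever $q$ has locus data, $\sum_{\ell=1}^M s_\ell(s_\ell+1)=g(g+1)$ for some integer $g\ge1$. -/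

import Mathlib

open scoped Polynomial

noncomputable section

namespace HalphenKdV

/-- The value of the rational function `q` at `z` (with value `0` at the finitely many poles). -/
def val (q : RatFunc ℂ) (z : ℂ) : ℂ :=
  RatFunc.eval (RingHom.id ℂ) z q

/-- `q` is bounded near infinity. -/
def BoundedNearInfinity (q : RatFunc ℂ) : Prop :=
  ∃ R B : ℝ, ∀ z : ℂ, R ≤ ‖z‖ → ‖val q z‖ ≤ B

/-- `y` is a meromorphic function on `ℂ` satisfying `y'' + q y = E y` as an identity of meromorphic
functions, i.e. off a closed discrete set (which contains the poles of `q` and of `y`). -/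
def IsMeromorphicSolution (q : RatFunc ℂ) (E : ℂ) (y : ℂ → ℂ) : Prop :=
  Meromorphic y ∧
    ∀ᶠ z in Filter.codiscrete ℂ, deriv (deriv y) z + val q z * y z = E * y z

/-- `y'' + q y = E y` has a meromorphic fundamental system: two meromorphic solutions that are
linearly independent as meromorphic functions (functions that agree off a closed discrete set are
identified). -/
def HasMeromorphicFundamentalSystem (q : RatFunc ℂ) (E : ℂ) : Prop :=
  ∃ y₁ y₂ : ℂ → ℂ, IsMeromorphicSolution q E y₁ ∧ IsMeromorphicSolution q E y₂ ∧
    ∀ a b : ℂ, (∀ᶠ z in Filter.codiscrete ℂ, a * y₁ z + b * y₂ z = 0) → a = 0 ∧ b = 0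

/-- Halphen potentials. -/
def IsHalphenPotential (q : RatFunc ℂ) : Prop :=
  BoundedNearInfinity q ∧ ∀ E : ℂ, HasMeromorphicFundamentalSystem q E

/-- The derivative `d/dz` of a rational function, by the quotient rule. -/
def ratDeriv (f : RatFunc ℂ) : RatFunc ℂ :=
  algebraMap ℂ[X] (RatFunc ℂ)
      (Polynomial.derivative f.num * f.denom - f.num * Polynomial.derivative f.denom) /
    algebraMap ℂ[X] (RatFunc ℂ) (f.denom ^ 2)

/-- `f 0, …, f (g + 1)` solve the recursion
`f₀ = 1`, `f_{j+1}' = (1/4) f_j''' + q f_j' + (1/2) q' f_j`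
(integration constants are arbitrary), and `q` solves the corresponding `g`-th stationary
(nonhomogeneous) KdV equation `2 f_{g+1}' = 0`. -/
structure IsKdVSequence (q : RatFunc ℂ) (g : ℕ) (f : ℕ → RatFunc ℂ) : Prop where
  zero : f 0 = 1
  succ : ∀ j ≤ g, ratDeriv (f (j + 1)) =
    RatFunc.C (1 / 4) * ratDeriv (ratDeriv (ratDeriv (f j))) + q * ratDeriv (f j) +
      RatFunc.C (1 / 2) * ratDeriv q * f j
  kdv : 2 * ratDeriv (f (g + 1)) = 0

/-- `q` solves the `g`-th stationary KdV equation for some choice of the integration constants. -/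
def SolvesStationaryKdV (q : RatFunc ℂ) (g : ℕ) : Prop :=
  ∃ f : ℕ → RatFunc ℂ, IsKdVSequence q g f

/-- Rational (algebro-geometric) KdV potentials: solutions of one of the stationary KdV
equations. -/
def IsKdVPotential (q : RatFunc ℂ) : Prop :=
  ∃ g : ℕ, SolvesStationaryKdV q g

/-- The polynomial `F_g(E, ·) = ∑_{j ≤ g} f_{g-j} E^j` in the spectral parameter `E`. -/
def polyF (f : ℕ → RatFunc ℂ) (g : ℕ) : (RatFunc ℂ)[X] :=
  ∑ j ∈ Finset.range (g + 1), Polynomial.C (f (g - j)) * Polynomial.X ^ j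

/-- The polynomial `-(1/2) F_g'' F_g + (1/4) (F_g')² + (E - q) F_g²` in `E`, where `'` is `d/dz`,
taken coefficientwise. -/
def polyR (q : RatFunc ℂ) (f : ℕ → RatFunc ℂ) (g : ℕ) : (RatFunc ℂ)[X] :=
  -(Polynomial.C (RatFunc.C (1 / 2)) * polyF (fun j => ratDeriv (ratDeriv (f j))) g * polyF f g) +
    Polynomial.C (RatFunc.C (1 / 4)) * polyF (fun j => ratDeriv (f j)) g ^ 2 +
    (Polynomial.X - Polynomial.C q) * polyF f g ^ 2

/-- `q` is a KdV potential with spectral curve `y² = R(E)` of arithmetic genus `g`: `q` solves the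
`g`-th stationary KdV equation, the curve attached to that equation is `y² = R(E)`, and `g` is
minimal, that is, `q` solves no lower stationary KdV equation. Without minimality
no curve is attached to `q`: multiplying `F_g(E, ·)` by `E - c` gives a solution sequence
for `g + 1` and replaces `R(E)` by `(E - c)² R(E)`, for every constant `c`. -/
def HasSpectralCurve (q : RatFunc ℂ) (g : ℕ) (R : ℂ[X]) : Prop :=
  (∃ f : ℕ → RatFunc ℂ, IsKdVSequence q g f ∧ polyR q f g = R.map RatFunc.C) ∧
    ∀ g' < g, ¬ SolvesStationaryKdV q g'

/-- `q` is given by the data `q∞`, `s_ℓ ∈ {1, 2, …}` and pairwise distinct `ζ_ℓ`, and these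
satisfy the locus constraints. -/
structure IsLocusData (q : RatFunc ℂ) (qInf : ℂ) {M : ℕ} (s : Fin M → ℕ) (ζ : Fin M → ℂ) :
    Prop where
  pos : 1 ≤ M
  s_pos : ∀ l, 1 ≤ s l
  distinct : Function.Injective ζ
  eq : q = RatFunc.C qInf -
    ∑ l, RatFunc.C ((s l : ℂ) * (s l + 1)) / (RatFunc.X - RatFunc.C (ζ l)) ^ 2
  constraint : ∀ l, ∀ k ∈ Finset.Icc 1 (s l),
    ∑ l' ∈ Finset.univ.erase l, ((s l' : ℂ) * (s l' + 1)) / (ζ l - ζ l') ^ (2 * k + 1) = 0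

end HalphenKdV

end

open scoped Polynomial LaurentSeries

noncomputable section

namespace HalphenKdV

/-! ### Calculus of formal Laurent series -/

/-! Everything passes through one local condition, `LocalCond`, on the Laurent expansion of `q` at a
point: it starts with `-s (s + 1) t⁻²`, and its coefficients of index `-1, 1, …, 2 s - 1` vanish.
Expanding the remaining double poles at `ζ_ℓ` turns these vanishings into the locus equations, and
subtracting all double poles from a `q` bounded at infinity leaves a constant
(`exists_isLocusData_of_localCond`). It remains to see that the condition is necessary for both
classes of potentials, and sufficient.

Necessity is a no-cancellation argument, run twice. For KdV (`localCond_of_kdv`), the leading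
coefficients of the `f_j` force the coefficient `-s (s + 1)`. If some odd coefficient of `q` of
index at most `2 s - 1` were nonzero, the lowest odd coefficients of the `f_j` would obey an
inhomogeneous recursion in which all contributions have the same sign, and `f_{g+1}` could not be
constant. For Halphen potentials (`localCond_of_formalSol`), a solution with exponent `-s` has to
pass the resonance at step `2 s + 1` for every `E`. As `E → ∞` the obstruction there is, again by
signs, asymptotic to a nonzero multiple of a power of `E` times the first odd coefficient.

Sufficiency rests on spaces of Laurent series that the operators preserve. The KdV recursion
preserves pole order at most `2 s` without odd negative exponents (`LocalCond.evenPole`). Hence,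
when `q` vanishes at infinity, the homogeneous KdV sequence has uniformly bounded poles while its
order of vanishing at infinity grows, so it terminates. Its leading coefficients at infinity get
multiplied by `n (n + 1) - ∑ s (s + 1)`, up to nonzero factors, so termination forces the sum to be
`g (g + 1)` (`IsLocusData.exists_genus`). The quadratic identity that defines the sequence becomes
the curve `y² = E ^ (2 g + 1)`, a translation of `E` restores `q∞`, and uniqueness of the monic
solution of minimal degree makes the curve an invariant of `q`.

For meromorphic solutions one seeks `exp (k z) p / ∏ (z - ζ_ℓ) ^ s_ℓ` with `k² = E - q∞`.
Quasi-invariance at the poles cuts out a space of numerators of finite codimension, which the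
differential operator preserves (`LocalCond.quasiInv`) while lowering degrees by one, and by two if
`k = 0`. Counting dimensions (`exists_ker_of_degree_lowering`) yields one solution for each of `k`
and `-k`, or two rational ones if `k = 0`. -/

theorem coeff_derivative (f : ℂ⸨X⸩) (n : ℤ) :
    (LaurentSeries.derivative ℂ f).coeff n = ((n : ℂ) + 1) * f.coeff (n + 1) := by
  simp

theorem coeff_mul_eq_sum {f g : ℂ⸨X⸩} {s t : Set ℤ} (hs : s.IsPWO) (ht : t.IsPWO)
    (hfs : f.support ⊆ s) (hgt : g.support ⊆ t) (n : ℤ) :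
    (f * g).coeff n = ∑ ij ∈ Finset.antidiagonal hs ht n, f.coeff ij.1 * g.coeff ij.2 := by
  rw [HahnSeries.coeff_mul]
  refine Finset.sum_subset ?_ ?_
  · intro x hx
    rw [Finset.mem_antidiagonal] at hx ⊢
    exact ⟨hfs hx.1, hgt hx.2.1, hx.2.2⟩
  · intro x hx hx'
    rw [Finset.mem_antidiagonal] at hx hx'
    by_contra h
    exact hx' ⟨left_ne_zero_of_mul h, right_ne_zero_of_mul h, hx.2.2⟩

/-- The Euler operator `t d/dt` is a derivation, coefficientwise form. -/
theorem intCast_mul_coeff_mul (f g : ℂ⸨X⸩) (n : ℤ) :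
    (n : ℂ) * (f * g).coeff n =
      ∑ ij ∈ Finset.antidiagonal f.isPWO_support g.isPWO_support n,
        (((ij.1 : ℂ) * f.coeff ij.1) * g.coeff ij.2 + f.coeff ij.1 * ((ij.2 : ℂ) * g.coeff ij.2)) := by
  rw [HahnSeries.coeff_mul, Finset.mul_sum]
  refine Finset.sum_congr rfl fun x hx => ?_
  rw [Finset.mem_antidiagonal] at hx
  rw [← hx.2.2]
  push_cast
  ring

theorem coeff_single_one_mul_derivative (f : ℂ⸨X⸩) (n : ℤ) :
    (HahnSeries.single 1 1 * LaurentSeries.derivative ℂ f).coeff n = (n : ℂ) * f.coeff n := by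
  have := HahnSeries.coeff_single_mul_add (r := (1 : ℂ)) (x := LaurentSeries.derivative ℂ f)
    (a := n - 1) (b := (1 : ℤ))
  rw [sub_add_cancel] at this
  rw [this, coeff_derivative]
  simp

/-- After multiplication by `t` the derivative becomes the Euler operator, which multiplies the
coefficient of index `n` by `n` and enlarges no support. The product rule is then `n = i + j` on a
common antidiagonal. -/
theorem derivative_mul (f g : ℂ⸨X⸩) :
    LaurentSeries.derivative ℂ (f * g) =
      f * LaurentSeries.derivative ℂ g + g * LaurentSeries.derivative ℂ f := by
  have hX : (HahnSeries.single 1 1 : ℂ⸨X⸩) ≠ 0 := HahnSeries.single_ne_zero one_ne_zero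
  apply mul_left_cancel₀ hX
  have key : ∀ h : ℂ⸨X⸩, (HahnSeries.single 1 1 * LaurentSeries.derivative ℂ h).support ⊆
      h.support := by
    intro h i hi
    rw [HahnSeries.mem_support, coeff_single_one_mul_derivative] at hi
    exact right_ne_zero_of_mul hi
  have e : HahnSeries.single 1 1 * (f * LaurentSeries.derivative ℂ g +
      g * LaurentSeries.derivative ℂ f) =
      (HahnSeries.single 1 1 * LaurentSeries.derivative ℂ f) * g +
        f * (HahnSeries.single 1 1 * LaurentSeries.derivative ℂ g) := by ring
  rw [e]
  ext n
  rw [coeff_single_one_mul_derivative, intCast_mul_coeff_mul, HahnSeries.coeff_add,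
    coeff_mul_eq_sum f.isPWO_support g.isPWO_support (key f) subset_rfl,
    coeff_mul_eq_sum f.isPWO_support g.isPWO_support subset_rfl (key g),
    ← Finset.sum_add_distrib]
  simp only [coeff_single_one_mul_derivative]

/-- The derivation `d/dt` of `ℂ((t))`. -/
def lderiv : ℂ⸨X⸩ →ₗ[ℂ] ℂ⸨X⸩ := LaurentSeries.derivative ℂ

theorem lderiv_mul (f g : ℂ⸨X⸩) : lderiv (f * g) = lderiv f * g + f * lderiv g := by
  rw [lderiv, derivative_mul]; ring

theorem coeff_lderiv (f : ℂ⸨X⸩) (n : ℤ) :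
    (lderiv f).coeff n = ((n : ℂ) + 1) * f.coeff (n + 1) :=
  coeff_derivative f n

theorem lderiv_C (c : ℂ) : lderiv (HahnSeries.C c : ℂ⸨X⸩) = 0 := by
  ext n
  rw [coeff_lderiv, HahnSeries.coeff_zero]
  by_cases h : n + 1 = 0
  · have : (n : ℂ) + 1 = 0 := by exact_mod_cast h
    simp [this]
  · rw [HahnSeries.C_apply, HahnSeries.coeff_single_of_ne h, mul_zero]

theorem lderiv_C_mul (c : ℂ) (f : ℂ⸨X⸩) :
    lderiv (HahnSeries.C c * f) = HahnSeries.C c * lderiv f := by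
  rw [lderiv_mul, lderiv_C, zero_mul, zero_add]

theorem coeff_C_mul' (c : ℂ) (f : ℂ⸨X⸩) (n : ℤ) :
    (HahnSeries.C c * f).coeff n = c * f.coeff n := by
  rw [HahnSeries.C_mul_eq_smul]; simp

/-! ### Order and parity of the exponents of a Laurent series -/

/-- The coefficients of `f` of index below `n` vanish. -/
def OrdGE (n : ℤ) (f : ℂ⸨X⸩) : Prop := ∀ i < n, f.coeff i = 0

/-- The exponents occurring in `f` are among `n, n + 2, n + 4, …`. -/
def Par (n : ℤ) (f : ℂ⸨X⸩) : Prop := ∀ i, f.coeff i ≠ 0 → ∃ k : ℕ, i = n + 2 * k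

theorem exists_of_coeff_mul_ne_zero {f g : ℂ⸨X⸩} {n : ℤ} (h : (f * g).coeff n ≠ 0) :
    ∃ i j, f.coeff i ≠ 0 ∧ g.coeff j ≠ 0 ∧ i + j = n := by
  rw [HahnSeries.coeff_mul] at h
  obtain ⟨x, hx, hx'⟩ := Finset.exists_ne_zero_of_sum_ne_zero h
  rw [Finset.mem_antidiagonal] at hx
  exact ⟨x.1, x.2, hx.1, hx.2.1, hx.2.2⟩

namespace OrdGE

theorem mono {m n : ℤ} {f : ℂ⸨X⸩} (hf : OrdGE n f) (h : m ≤ n) : OrdGE m f :=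
  fun i hi => hf i (hi.trans_le h)

theorem zero (n : ℤ) : OrdGE n 0 := fun _ _ => rfl

theorem add {n : ℤ} {f g : ℂ⸨X⸩} (hf : OrdGE n f) (hg : OrdGE n g) : OrdGE n (f + g) :=
  fun i hi => by rw [HahnSeries.coeff_add, hf i hi, hg i hi, add_zero]

theorem neg {n : ℤ} {f : ℂ⸨X⸩} (hf : OrdGE n f) : OrdGE n (-f) :=
  fun i hi => by rw [HahnSeries.coeff_neg, hf i hi, neg_zero]

theorem sub {n : ℤ} {f g : ℂ⸨X⸩} (hf : OrdGE n f) (hg : OrdGE n g) : OrdGE n (f - g) :=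
  fun i hi => by rw [HahnSeries.coeff_sub, hf i hi, hg i hi, sub_zero]

theorem sum {ι : Type*} {n : ℤ} (S : Finset ι) {f : ι → ℂ⸨X⸩} (h : ∀ i ∈ S, OrdGE n (f i)) :
    OrdGE n (∑ i ∈ S, f i) := by
  classical
  induction S using Finset.induction_on with
  | empty => simpa using zero n
  | insert a S ha ih =>
    rw [Finset.sum_insert ha]
    exact (h a (Finset.mem_insert_self a S)).add
      (ih fun i hi => h i (Finset.mem_insert_of_mem hi))

theorem mul {m n : ℤ} {f g : ℂ⸨X⸩} (hf : OrdGE m f) (hg : OrdGE n g) : OrdGE (m + n) (f * g) := by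
  intro i hi
  by_contra h
  obtain ⟨a, b, ha, hb, rfl⟩ := exists_of_coeff_mul_ne_zero h
  have h1 : m ≤ a := not_lt.1 fun h => ha (hf a h)
  have h2 : n ≤ b := not_lt.1 fun h => hb (hg b h)
  omega

theorem C (c : ℂ) : OrdGE 0 (HahnSeries.C c) := fun i hi => by
  rw [HahnSeries.C_apply, HahnSeries.coeff_single_of_ne hi.ne]

theorem one : OrdGE 0 1 := C 1

theorem C_mul (c : ℂ) {n : ℤ} {f : ℂ⸨X⸩} (hf : OrdGE n f) : OrdGE n (HahnSeries.C c * f) :=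
  fun i hi => by rw [coeff_C_mul', hf i hi, mul_zero]

theorem lderiv {n : ℤ} {f : ℂ⸨X⸩} (hf : OrdGE n f) : OrdGE (n - 1) (lderiv f) :=
  fun i hi => by rw [coeff_lderiv, hf (i + 1) (by omega), mul_zero]

theorem succ {n : ℤ} {f : ℂ⸨X⸩} (hf : OrdGE n f) (h : f.coeff n = 0) : OrdGE (n + 1) f :=
  fun i hi => by
    rcases (Int.lt_add_one_iff.1 hi).lt_or_eq with h' | rfl
    exacts [hf i h', h]

theorem coeff_mul {m n : ℤ} {f g : ℂ⸨X⸩} (hf : OrdGE m f) (hg : OrdGE n g) :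
    (f * g).coeff (m + n) = f.coeff m * g.coeff n := by
  have hs : f.support ⊆ Set.Ici m := fun i hi => not_lt.1 fun h => hi (hf i h)
  have ht : g.support ⊆ Set.Ici n := fun i hi => not_lt.1 fun h => hi (hg i h)
  have pwo : ∀ k : ℤ, (Set.Ici k).IsPWO := fun k =>
    (BddBelow.isWF ⟨k, fun _ h => h⟩).isPWO
  rw [coeff_mul_eq_sum (pwo m) (pwo n) hs ht, Finset.sum_eq_single (m, n)]
  · rintro ⟨a, b⟩ h hne
    rw [Finset.mem_antidiagonal] at h
    obtain ⟨h1, h2, h3⟩ := h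
    simp only [Set.mem_Ici] at h1 h2 h3
    exact (hne (by ext <;> simp <;> omega)).elim
  · intro h
    exact (h (by simp [Finset.mem_antidiagonal])).elim

/-- Product coefficients as finite sums over an interval. -/
theorem coeff_mul_eq_sum_range {m n : ℤ} {f g : ℂ⸨X⸩} (hf : OrdGE m f) (hg : OrdGE n g) (p : ℕ) :
    (f * g).coeff (m + n + p) =
      ∑ i ∈ Finset.range (p + 1), f.coeff (m + i) * g.coeff (n + (p - i : ℕ)) := by
  have hs : f.support ⊆ Set.Ici m := fun i hi => not_lt.1 fun h => hi (hf i h)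
  have ht : g.support ⊆ Set.Ici n := fun i hi => not_lt.1 fun h => hi (hg i h)
  have pwo : ∀ k : ℤ, (Set.Ici k).IsPWO := fun k =>
    (BddBelow.isWF ⟨k, fun _ h => h⟩).isPWO
  rw [coeff_mul_eq_sum (pwo m) (pwo n) hs ht]
  refine (Finset.sum_bij (fun (i : ℕ) _ => (m + (i : ℤ), n + ((p - i : ℕ) : ℤ))) ?_ ?_ ?_ ?_).symm
  · intro i hi
    rw [Finset.mem_range] at hi
    simp only [Finset.mem_antidiagonal, Set.mem_Ici]
    omega
  · intro i _ j _ h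
    simp only [Prod.mk.injEq] at h
    omega
  · rintro ⟨a, b⟩ h
    simp only [Finset.mem_antidiagonal, Set.mem_Ici] at h
    refine ⟨(a - m).toNat, ?_, ?_⟩
    · rw [Finset.mem_range]; omega
    · ext <;> simp <;> omega
  · intro _ _; rfl

end OrdGE

namespace Par

theorem ordGE {n : ℤ} {f : ℂ⸨X⸩} (hf : Par n f) : OrdGE n f := fun i hi => by
  by_contra h
  obtain ⟨k, hk⟩ := hf i h
  omega

theorem coeff_eq_zero {n : ℤ} {f : ℂ⸨X⸩} (hf : Par n f) {i : ℤ} (h : (i - n) % 2 ≠ 0) :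
    f.coeff i = 0 := by
  by_contra h'
  obtain ⟨k, hk⟩ := hf i h'
  omega

theorem add {n : ℤ} {f g : ℂ⸨X⸩} (hf : Par n f) (hg : Par n g) : Par n (f + g) := by
  intro i hi
  by_cases h : f.coeff i = 0
  · exact hg i (by simpa [h] using hi)
  · exact hf i h

theorem C_mul (c : ℂ) {n : ℤ} {f : ℂ⸨X⸩} (hf : Par n f) : Par n (HahnSeries.C c * f) :=
  fun i hi => hf i (by rw [coeff_C_mul'] at hi; exact right_ne_zero_of_mul hi)

theorem mul {m n : ℤ} {f g : ℂ⸨X⸩} (hf : Par m f) (hg : Par n g) : Par (m + n) (f * g) := by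
  intro i hi
  obtain ⟨a, b, ha, hb, rfl⟩ := exists_of_coeff_mul_ne_zero hi
  obtain ⟨k, rfl⟩ := hf a ha
  obtain ⟨l, rfl⟩ := hg b hb
  exact ⟨k + l, by push_cast; ring⟩

theorem lderiv {n : ℤ} {f : ℂ⸨X⸩} (hf : Par n f) : Par (n - 1) (lderiv f) := by
  intro i hi
  rw [coeff_lderiv] at hi
  obtain ⟨k, hk⟩ := hf _ (right_ne_zero_of_mul hi)
  exact ⟨k, by omega⟩

theorem mono {m n : ℤ} {f : ℂ⸨X⸩} (hf : Par n f) (h : m ≤ n) (h' : (n - m) % 2 = 0) : Par m f := by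
  intro i hi
  obtain ⟨k, hk⟩ := hf i hi
  exact ⟨((i - m) / 2).toNat, by omega⟩

theorem succ {n : ℤ} {f : ℂ⸨X⸩} (hf : Par n f) (h : f.coeff n = 0) : Par (n + 2) f := by
  intro i hi
  obtain ⟨k, hk⟩ := hf i hi
  rcases k with _ | k
  · simp at hk; exact (hi (hk ▸ h)).elim
  · exact ⟨k, by push_cast at hk; omega⟩

end Par

/-- The part of `f` with exponents congruent to `r` modulo `2`. -/
def parityPart (r : ℤ) (f : ℂ⸨X⸩) : ℂ⸨X⸩ where
  coeff i := if (i - r) % 2 = 0 then f.coeff i else 0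
  isPWO_support' := f.isPWO_support.mono fun i hi => by
    simp only [Function.mem_support, ne_eq, ite_eq_right_iff, Classical.not_imp] at hi
    exact hi.2

theorem coeff_parityPart (r : ℤ) (f : ℂ⸨X⸩) (i : ℤ) :
    (parityPart r f).coeff i = if (i - r) % 2 = 0 then f.coeff i else 0 := rfl

/-- A series splits into two parts of opposite parities. -/
theorem exists_par_add_par {a b : ℤ} (hab : (a - b) % 2 ≠ 0) {f : ℂ⸨X⸩}
    (ha : ∀ i < a, (i - a) % 2 = 0 → f.coeff i = 0)
    (hb : ∀ i < b, (i - b) % 2 = 0 → f.coeff i = 0) :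
    ∃ e u, f = e + u ∧ Par a e ∧ Par b u ∧ e.coeff a = f.coeff a ∧ u.coeff b = f.coeff b := by
  refine ⟨parityPart a f, parityPart b f, ?_, ?_, ?_, ?_, ?_⟩
  · ext i
    rw [HahnSeries.coeff_add, coeff_parityPart, coeff_parityPart]
    by_cases h : (i - a) % 2 = 0
    · rw [if_pos h, if_neg (by omega), add_zero]
    · rw [if_neg h, if_pos (by omega), zero_add]
  · intro i hi
    rw [coeff_parityPart] at hi
    by_cases h : (i - a) % 2 = 0
    · rw [if_pos h] at hi
      have : a ≤ i := not_lt.1 fun h' => hi (ha i h' h)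
      exact ⟨((i - a) / 2).toNat, by omega⟩
    · rw [if_neg h] at hi; exact (hi rfl).elim
  · intro i hi
    rw [coeff_parityPart] at hi
    by_cases h : (i - b) % 2 = 0
    · rw [if_pos h] at hi
      have : b ≤ i := not_lt.1 fun h' => hi (hb i h' h)
      exact ⟨((i - b) / 2).toNat, by omega⟩
    · rw [if_neg h] at hi; exact (hi rfl).elim
  · simp [coeff_parityPart]
  · simp [coeff_parityPart]

theorem coeff_lderiv_sub_one (f : ℂ⸨X⸩) (n : ℤ) :
    (lderiv f).coeff (n - 1) = n * f.coeff n := by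
  rw [coeff_lderiv, sub_add_cancel]; push_cast; ring

theorem coeff_eq_zero_of_lderiv_eq_zero {f : ℂ⸨X⸩} (h : lderiv f = 0) {n : ℤ} (hn : n ≠ 0) :
    f.coeff n = 0 := by
  have := coeff_lderiv_sub_one f n
  rw [h, HahnSeries.coeff_zero] at this
  exact (mul_eq_zero.1 this.symm).resolve_left (by exact_mod_cast hn)

theorem coeff_eq_zero_of_coeff_lderiv {f : ℂ⸨X⸩} {n : ℤ} (hn : n ≠ 0)
    (h : (lderiv f).coeff (n - 1) = 0) : f.coeff n = 0 := by
  rw [coeff_lderiv_sub_one] at h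
  exact (mul_eq_zero.1 h).resolve_left (by exact_mod_cast hn)

/-- Integration raises the order by one as long as index `0`, where the coefficient is lost, is not
reached; hence the bound on `n`. -/
theorem OrdGE.of_lderiv {f : ℂ⸨X⸩} {n : ℤ} (h : OrdGE n (HalphenKdV.lderiv f)) (hn : n + 1 ≤ 0) :
    OrdGE (n + 1) f := fun i hi =>
  coeff_eq_zero_of_coeff_lderiv (by omega) (h _ (by omega))

/-! ### The KdV operator on Laurent series and its indicial polynomial -/

/-- The bilinear expression `q f' + q' f / 2`. -/
def crossOp (q f : ℂ⸨X⸩) : ℂ⸨X⸩ := q * lderiv f + HahnSeries.C (1 / 2) * lderiv q * f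

/-- The third order operator `f ↦ f''' / 4 + q f' + q' f / 2` of the KdV recursion. -/
def kdvOp (q f : ℂ⸨X⸩) : ℂ⸨X⸩ :=
  HahnSeries.C (1 / 4) * lderiv (lderiv (lderiv f)) + q * lderiv f +
    HahnSeries.C (1 / 2) * lderiv q * f

theorem kdvOp_eq (q f : ℂ⸨X⸩) :
    kdvOp q f = HahnSeries.C (1 / 4) * lderiv (lderiv (lderiv f)) + crossOp q f := by
  rw [kdvOp, crossOp]; ring

theorem crossOp_add_left (p q f : ℂ⸨X⸩) : crossOp (p + q) f = crossOp p f + crossOp q f := by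
  simp only [crossOp, map_add]; ring

theorem kdvOp_add_right (q f g : ℂ⸨X⸩) : kdvOp q (f + g) = kdvOp q f + kdvOp q g := by
  simp only [kdvOp, map_add]; ring

theorem kdvOp_add_left (p q f : ℂ⸨X⸩) : kdvOp (p + q) f = kdvOp p f + crossOp q f := by
  rw [kdvOp_eq, kdvOp_eq, crossOp_add_left]; ring

theorem OrdGE.crossOp {m n : ℤ} {q f : ℂ⸨X⸩} (hq : OrdGE m q) (hf : OrdGE n f) :
    OrdGE (m + n - 1) (crossOp q f) := by
  have h1 := hq.mul hf.lderiv
  have h2 := (hq.lderiv.C_mul (1 / 2)).mul hf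
  exact OrdGE.add (h1.mono (by omega)) (h2.mono (by omega))

theorem Par.crossOp {m n : ℤ} {q f : ℂ⸨X⸩} (hq : Par m q) (hf : Par n f) :
    Par (m + n - 1) (crossOp q f) := by
  have h1 := hq.mul hf.lderiv
  have h2 := (hq.lderiv.C_mul (1 / 2)).mul hf
  exact Par.add (h1.mono (by omega) (by omega)) (h2.mono (by omega) (by omega))

theorem OrdGE.coeff_crossOp {m n : ℤ} {q f : ℂ⸨X⸩} (hq : OrdGE m q) (hf : OrdGE n f) :
    (HalphenKdV.crossOp q f).coeff (m + n - 1) = (n + m / 2) * (q.coeff m * f.coeff n) := by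
  have h1 := hq.coeff_mul hf.lderiv
  have h2 := (hq.lderiv.C_mul (1 / 2)).coeff_mul hf
  rw [coeff_lderiv_sub_one] at h1
  rw [coeff_C_mul', coeff_lderiv_sub_one] at h2
  rw [HalphenKdV.crossOp, HahnSeries.coeff_add, show m + n - 1 = m + (n - 1) by ring, h1,
    show m + (n - 1) = m - 1 + n by ring, h2]
  ring

theorem OrdGE.kdvOp {n : ℤ} {q f : ℂ⸨X⸩} (hq : OrdGE (-2) q) (hf : OrdGE n f) :
    OrdGE (n - 3) (kdvOp q f) := by
  rw [kdvOp_eq]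
  exact ((hf.lderiv.lderiv.lderiv.C_mul _).mono (by omega)).add ((hq.crossOp hf).mono (by omega))

theorem Par.kdvOp {n : ℤ} {q f : ℂ⸨X⸩} (hq : Par (-2) q) (hf : Par n f) :
    Par (n - 3) (kdvOp q f) := by
  rw [kdvOp_eq]
  exact ((hf.lderiv.lderiv.lderiv.C_mul _).mono (by omega) (by omega)).add
    ((hq.crossOp hf).mono (by omega) (by omega))

/-- This is the indicial polynomial. When `q` starts with `-s (s + 1) t⁻²` its roots are `-2 s`, `1`
and `2 s + 2`, the sums of two exponents taken from the pair `-s`, `s + 1` of the Schrödinger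
equation. -/
theorem OrdGE.coeff_kdvOp {n : ℤ} {q f : ℂ⸨X⸩} (hq : OrdGE (-2) q) (hf : OrdGE n f) :
    (HalphenKdV.kdvOp q f).coeff (n - 3) =
      ((n - 1) * (n * (n - 2) / 4 + q.coeff (-2))) * f.coeff n := by
  have h := hq.coeff_crossOp hf
  rw [kdvOp_eq, HahnSeries.coeff_add, coeff_C_mul', show n - 3 = (n - 1 - 1) - 1 by ring,
    coeff_lderiv_sub_one, coeff_lderiv_sub_one, coeff_lderiv_sub_one,
    show n - 1 - 1 - 1 = -2 + n - 1 by ring, h]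
  push_cast
  ring

/-! ### The local locus condition and the spaces it keeps invariant -/

/-- The local form of the locus conditions: the series starts with `-s (s + 1) t⁻²` and its
coefficients of index `-1, 1, …, 2 s - 1` vanish. -/
structure LocalCond (q : ℂ⸨X⸩) (s : ℕ) : Prop where
  ordGE : OrdGE (-2) q
  lead : q.coeff (-2) = -((s : ℂ) * (s + 1))
  odd : ∀ k : ℕ, k ≤ s → q.coeff (2 * k - 1) = 0

theorem LocalCond.exists_parts {q : ℂ⸨X⸩} {s : ℕ} (h : LocalCond q s) :
    ∃ e u, q = e + u ∧ Par (-2) e ∧ Par (2 * s + 1) u ∧ e.coeff (-2) = -((s : ℂ) * (s + 1)) := by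
  obtain ⟨e, u, h1, h2, h3, h4, -⟩ := exists_par_add_par (f := q) (a := -2) (b := 2 * s + 1)
    (by omega) (fun i hi _ => h.ordGE i hi) (by
      intro i hi hi'
      by_cases h' : i < -2
      · exact h.ordGE i h'
      · obtain ⟨k, rfl⟩ : ∃ k : ℕ, i = 2 * k - 1 := ⟨((i + 1) / 2).toNat, by omega⟩
        exact h.odd k (by omega))
  exact ⟨e, u, h1, h2, h3, h4.trans h.lead⟩

/-- Series of order at least `-s` such that `t ^ s * Y` is even up to order `2 s`. -/
def QuasiInv (s : ℕ) (Y : ℂ⸨X⸩) : Prop :=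
  OrdGE (-s) Y ∧ ∀ i : ℕ, i < s → Y.coeff (-s + 1 + 2 * i) = 0

theorem quasiInv_iff {s : ℕ} {Y : ℂ⸨X⸩} :
    QuasiInv s Y ↔ ∃ e u, Y = e + u ∧ Par (-s) e ∧ Par (s + 1) u := by
  constructor
  · rintro ⟨h1, h2⟩
    obtain ⟨e, u, h3, h4, h5, -, -⟩ := exists_par_add_par (f := Y) (a := -s) (b := s + 1)
      (by omega) (fun i hi _ => h1 i hi) (by
        intro i hi hi'
        by_cases h' : i < -s
        · exact h1 i h'
        · obtain ⟨k, rfl⟩ : ∃ k : ℕ, i = -s + 1 + 2 * k := ⟨((i + s - 1) / 2).toNat, by omega⟩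
          exact h2 k (by omega))
    exact ⟨e, u, h3, h4, h5⟩
  · rintro ⟨e, u, rfl, he, hu⟩
    refine ⟨he.ordGE.add (hu.ordGE.mono (by omega)), fun i hi => ?_⟩
    rw [HahnSeries.coeff_add, he.coeff_eq_zero (by omega), hu.ordGE _ (by omega), add_zero]

/-- The operator `Y ↦ Y'' + q Y` preserves quasi-invariance. -/
theorem LocalCond.quasiInv {q : ℂ⸨X⸩} {s : ℕ} (h : LocalCond q s) {Y : ℂ⸨X⸩} (hY : QuasiInv s Y) :
    QuasiInv s (lderiv (lderiv Y) + q * Y) := by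
  obtain ⟨qe, qu, rfl, hqe, hqu, hlead⟩ := h.exists_parts
  obtain ⟨e, u, rfl, he, hu⟩ := quasiInv_iff.1 hY
  -- Both `-s` and `s + 1` solve the indicial equation, so the term of exponent `n - 2` cancels. The
  -- odd part `qu`, starting at `2 s + 1`, carries one parity class into the other.
  have key : ∀ (n : ℤ) (f : ℂ⸨X⸩), Par n f → (n : ℂ) * (n - 1) = s * (s + 1) →
      Par n (lderiv (lderiv f) + qe * f) := by
    intro n f hf hn
    have h1 : Par (n - 2) (lderiv (lderiv f) + qe * f) :=
      (hf.lderiv.lderiv.mono (by omega) (by omega)).add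
        ((hqe.mul hf).mono (by omega) (by omega))
    have h2 := h1.succ (by
      have := hqe.ordGE.coeff_mul hf.ordGE
      rw [HahnSeries.coeff_add, show n - 2 = n - 1 - 1 by ring, coeff_lderiv_sub_one,
        coeff_lderiv_sub_one, show n - 1 - 1 = -2 + n by ring, this, hlead, ← hn]
      push_cast; ring)
    rwa [sub_add_cancel] at h2
  refine quasiInv_iff.2 ⟨(lderiv (lderiv e) + qe * e) + qu * u,
    (lderiv (lderiv u) + qe * u) + qu * e, ?_, ?_, ?_⟩
  · simp only [map_add]; ring
  · exact (key _ _ he (by push_cast; ring)).add ((hqu.mul hu).mono (by omega) (by omega))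
  · exact (key _ _ hu (by push_cast; ring)).add ((hqu.mul he).mono (by omega) (by omega))

/-- Series of order at least `-2 s` whose coefficients of odd negative index vanish. -/
def EvenPole (s : ℕ) (f : ℂ⸨X⸩) : Prop :=
  OrdGE (-(2 * s)) f ∧ ∀ i : ℤ, i < 0 → i % 2 = 1 → f.coeff i = 0

/-- Split `f` into an even part starting at `-2 s` and an odd part starting at `1`. Both exponents
are indicial roots, so `kdvOp` with the even part of `q` sends them to series starting at `-2 s - 1`
and `0`; the odd part of `q` starts high enough to respect these bounds. Hence `g'` has no negative
even exponents, and integration keeps the form. -/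
theorem LocalCond.evenPole {q : ℂ⸨X⸩} {s : ℕ} (h : LocalCond q s) {f g : ℂ⸨X⸩}
    (hf : EvenPole s f) (hg : lderiv g = kdvOp q f) : EvenPole s g := by
  obtain ⟨qe, qu, rfl, hqe, hqu, hlead⟩ := h.exists_parts
  obtain ⟨e, u, rfl, he, hu, -, -⟩ := exists_par_add_par (f := f) (a := -(2 * s)) (b := 1)
    (by omega) (fun i hi _ => hf.1 i hi) (fun i hi hi' => hf.2 i (by omega) (by omega))
  have h1 : Par (-(2 * s) - 1) (kdvOp qe e) := by
    have := (Par.kdvOp hqe he).succ (by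
      rw [hqe.ordGE.coeff_kdvOp he.ordGE, hlead]; push_cast; ring)
    exact this.mono (by omega) (by omega)
  have h2 : Par 0 (kdvOp qe u) := by
    have := (Par.kdvOp hqe hu).succ (by
      rw [hqe.ordGE.coeff_kdvOp hu.ordGE, hlead]; push_cast; ring)
    exact this.mono (by omega) (by omega)
  have h3 : Par 0 (crossOp qu e) := (hqu.crossOp he).mono (by omega) (by omega)
  have h4 : Par (-(2 * s) - 1) (crossOp qu u) := (hqu.crossOp hu).mono (by omega) (by omega)
  have hg' : lderiv g = (kdvOp qe e + crossOp qu u) + (kdvOp qe u + crossOp qu e) := by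
    rw [hg, kdvOp_add_right, kdvOp_add_left, kdvOp_add_left]; ring
  have hE := h1.add h4
  have hU := h2.add h3
  constructor
  · intro i hi
    refine coeff_eq_zero_of_coeff_lderiv (by omega) ?_
    rw [hg', HahnSeries.coeff_add, hE.ordGE _ (by omega), hU.ordGE _ (by omega), add_zero]
  · intro i hi hi'
    refine coeff_eq_zero_of_coeff_lderiv (by omega) ?_
    rw [hg', HahnSeries.coeff_add, hE.coeff_eq_zero (by omega), hU.ordGE _ (by omega), add_zero]

/-! ### Local consequences of a stationary KdV equation -/

section KdVLocal

variable {q : ℂ⸨X⸩} {g : ℕ} {f : ℕ → ℂ⸨X⸩}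

/-- For a pole of order `p ≥ 3` the third derivative is of higher order than the terms containing
`q`. Then `f_j` has a pole of order exactly `p j`, which contradicts `f_{g+1}' = 0`. -/
theorem ordGE_neg_two_of_kdv (h0 : f 0 = 1)
    (hs : ∀ j ≤ g, lderiv (f (j + 1)) = kdvOp q (f j)) (hk : lderiv (f (g + 1)) = 0) :
    OrdGE (-2) q := by
  by_contra hcon
  have hq0 : q ≠ 0 := by
    rintro rfl
    exact hcon (OrdGE.zero _)
  obtain ⟨p, hp⟩ : ∃ p : ℤ, q.order = -p := ⟨-q.order, by ring⟩
  have hqo : OrdGE (-p) q := fun i hi => HahnSeries.coeff_eq_zero_of_lt_order (by omega)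
  have hqc : q.coeff (-p) ≠ 0 := by
    rw [← hp]
    exact mt HahnSeries.coeff_order_eq_zero.1 hq0
  have hp3 : 3 ≤ p := by
    by_contra h
    exact hcon (hqo.mono (by omega))
  have key : ∀ j : ℕ, j ≤ g + 1 → OrdGE (-p * j) (f j) ∧ (f j).coeff (-p * j) ≠ 0 := by
    intro j
    induction j with
    | zero =>
      intro _
      simp only [Nat.cast_zero, mul_zero, h0]
      exact ⟨OrdGE.one, by simp⟩
    | succ j ih =>
      intro hj
      obtain ⟨h1, h2⟩ := ih (by omega)
      have e := hs j (by omega)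
      rw [kdvOp_eq] at e
      have h3 := (h1.lderiv.lderiv.lderiv.C_mul (1 / 4))
      have h4 := hqo.crossOp h1
      have e1 : -p * ((j + 1 : ℕ) : ℤ) = -p + -p * j := by push_cast; ring
      have h5 : OrdGE (-p + -p * j - 1) (lderiv (f (j + 1))) := by
        rw [e]
        exact (h3.mono (by omega)).add h4
      have hneg : -p * (j : ℤ) ≤ 0 := by
        have : 0 ≤ p * (j : ℤ) := by positivity
        linarith [neg_mul p (j : ℤ)]
      have h6 := h5.of_lderiv (by omega)
      rw [sub_add_cancel] at h6
      rw [e1]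
      refine ⟨h6, fun h7 => ?_⟩
      have h8 := coeff_lderiv_sub_one (f (j + 1)) (-p + -p * j)
      rw [h7, mul_zero, e, HahnSeries.coeff_add, h3 _ (by omega), hqo.coeff_crossOp h1,
        zero_add] at h8
      -- The factor `n + m / 2` of `OrdGE.coeff_crossOp` is here `-p (2 j + 1) / 2`, which is
      -- negative.
      have h9 : ((-p * (j : ℤ) : ℤ) : ℂ) + ((-p : ℤ) : ℂ) / 2 ≠ 0 := by
        intro h
        have h' : ((2 * (-p * (j : ℤ)) + -p : ℤ) : ℂ) = 0 := by
          push_cast at h ⊢; linear_combination 2 * h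
        have h'' : 2 * (-p * (j : ℤ)) + -p = 0 := by exact_mod_cast h'
        omega
      exact mul_ne_zero h9 (mul_ne_zero hqc h2) h8
  obtain ⟨-, h⟩ := key (g + 1) le_rfl
  refine h (coeff_eq_zero_of_lderiv_eq_zero hk ?_)
  have : (0 : ℤ) < p * ((g + 1 : ℕ) : ℤ) := by positivity
  rw [neg_mul]
  omega

/-- The indicial polynomial at exponent `-2 j` gives the right side, and differentiating `t ^ (-2 (j
+ 1))` the left. The leading coefficients can die out only if `q.coeff (-2) = -j (j + 1)` for some
`j`. -/
theorem lead_recursion_of_kdv (h0 : f 0 = 1)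
    (hs : ∀ j ≤ g, lderiv (f (j + 1)) = kdvOp q (f j)) (hq : OrdGE (-2) q) :
    (∀ j : ℕ, j ≤ g + 1 → OrdGE (-(2 * j)) (f j)) ∧
    ∀ j : ℕ, j ≤ g → 2 * ((j : ℂ) + 1) * (f (j + 1)).coeff (-(2 * ((j + 1 : ℕ) : ℤ))) =
      (2 * j + 1) * (j * (j + 1) + q.coeff (-2)) * (f j).coeff (-(2 * j)) := by
  have h1 : ∀ j : ℕ, j ≤ g + 1 → OrdGE (-(2 * j)) (f j) := by
    intro j
    induction j with
    | zero => intro _; simpa [h0] using OrdGE.one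
    | succ j ih =>
      intro hj
      have h2 : OrdGE (-(2 * (j : ℤ)) - 3) (lderiv (f (j + 1))) := by
        rw [hs j (by omega)]
        exact OrdGE.kdvOp hq (ih (by omega))
      exact (h2.of_lderiv (by omega)).mono (by push_cast; omega)
  refine ⟨h1, fun j hj => ?_⟩
  have h2 := hq.coeff_kdvOp (h1 j (by omega))
  rw [← hs j hj, show (-(2 * (j : ℤ)) - 3) = -(2 * ((j + 1 : ℕ) : ℤ)) - 1 by push_cast; ring,
    coeff_lderiv_sub_one] at h2
  push_cast at h2 ⊢
  linear_combination -h2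

/-- If the odd part of `q` starts no lower than `2 m - 1`, the odd part of `f_j` starts no lower
than `2 m + 1 - 2 j`. Its lowest coefficient is driven by itself through the indicial polynomial,
and by the leading even coefficient of `f_j` through `crossOp` with the odd part of `q`. -/
theorem odd_recursion_of_kdv (h0 : f 0 = 1)
    (hs : ∀ j ≤ g, lderiv (f (j + 1)) = kdvOp q (f j)) (hq : OrdGE (-2) q) {m : ℕ}
    (hm : ∀ k < m, q.coeff (2 * (k : ℤ) - 1) = 0) :
    ∀ j : ℕ, j ≤ g → (2 * ((m : ℂ) - j) - 1) *
        (f (j + 1)).coeff (2 * (m : ℤ) + 1 - 2 * ((j + 1 : ℕ) : ℤ)) =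
      2 * (m - j) * ((m - j) ^ 2 - 1 / 4 + q.coeff (-2)) *
        (f j).coeff (2 * (m : ℤ) + 1 - 2 * j) +
      q.coeff (2 * (m : ℤ) - 1) * (f j).coeff (-(2 * j)) * (m - 1 / 2 - 2 * j) := by
  obtain ⟨hord, -⟩ := lead_recursion_of_kdv h0 hs hq
  obtain ⟨qe, qu, hqeq, hqe, hqu, hqe', hqu'⟩ := exists_par_add_par (f := q) (a := -2)
    (b := 2 * m - 1) (by omega) (fun i hi _ => hq i hi) (by
      intro i hi hi'
      by_cases h' : i < -2
      · exact hq i h'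
      · obtain ⟨k, rfl⟩ : ∃ k : ℕ, i = 2 * k - 1 := ⟨((i + 1) / 2).toNat, by omega⟩
        exact hm k (by omega))
  have step : ∀ j : ℕ, j ≤ g →
      (∀ i : ℤ, i < 2 * m + 1 - 2 * j → i % 2 = 1 → (f j).coeff i = 0) →
      ∃ E U, lderiv (f (j + 1)) = E + U ∧ Par (-(2 * j) - 3) E ∧ Par (2 * m - 2 * j - 2) U ∧
        U.coeff (2 * m - 2 * j - 2) =
          2 * ((m : ℂ) - j) * ((m - j) ^ 2 - 1 / 4 + q.coeff (-2)) *
            (f j).coeff (2 * m + 1 - 2 * j) +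
          q.coeff (2 * m - 1) * (f j).coeff (-(2 * j)) * (m - 1 / 2 - 2 * j) := by
    intro j hj hodd
    obtain ⟨e, u, hf, he, hu, he', hu'⟩ := exists_par_add_par (f := f j) (a := -(2 * j))
      (b := 2 * m + 1 - 2 * j) (by omega) (fun i hi _ => hord j (by omega) i hi)
      (fun i hi hi' => hodd i hi (by omega))
    have c1 := hqe.ordGE.coeff_kdvOp hu.ordGE
    have c2 := hqu.ordGE.coeff_crossOp he.ordGE
    refine ⟨kdvOp qe e + crossOp qu u, kdvOp qe u + crossOp qu e, ?_, ?_, ?_, ?_⟩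
    · rw [hs j hj, hqeq, hf, kdvOp_add_right, kdvOp_add_left, kdvOp_add_left]; ring
    · exact (Par.kdvOp hqe he).add ((hqu.crossOp hu).mono (by omega) (by omega))
    · exact ((Par.kdvOp hqe hu).mono (by omega) (by omega)).add
        ((hqu.crossOp he).mono (by omega) (by omega))
    · rw [HahnSeries.coeff_add,
        show 2 * (m : ℤ) - 2 * j - 2 = 2 * m + 1 - 2 * j - 3 by ring, c1,
        show 2 * (m : ℤ) + 1 - 2 * j - 3 = 2 * m - 1 + -(2 * j) - 1 by ring, c2,
        he', hu', hqe', hqu']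
      push_cast
      ring
  have hodd : ∀ j : ℕ, j ≤ g + 1 → ∀ i : ℤ, i < 2 * m + 1 - 2 * j → i % 2 = 1 →
      (f j).coeff i = 0 := by
    intro j
    induction j with
    | zero =>
      intro _ i _ hi
      rw [h0, ← HahnSeries.single_zero_one, HahnSeries.coeff_single_of_ne (by omega)]
    | succ j ih =>
      intro hj i hi hi'
      obtain ⟨E, U, h1, hE, hU, -⟩ := step j (by omega) (ih (by omega))
      refine coeff_eq_zero_of_coeff_lderiv (by omega) ?_
      rw [h1, HahnSeries.coeff_add, hE.coeff_eq_zero (by omega),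
        hU.ordGE _ (by push_cast at hi; omega), add_zero]
  intro j hj
  obtain ⟨E, U, h1, hE, hU, hc⟩ := step j hj (hodd j (by omega))
  have h2 := coeff_lderiv_sub_one (f (j + 1)) (2 * m + 1 - 2 * ((j + 1 : ℕ) : ℤ))
  rw [h1, HahnSeries.coeff_add, hE.coeff_eq_zero (by push_cast; omega),
    show 2 * (m : ℤ) + 1 - 2 * ((j + 1 : ℕ) : ℤ) - 1 = 2 * m - 2 * j - 2 by push_cast; ring,
    hc, zero_add] at h2
  rw [h2]
  push_cast
  ring

/-- A formal solution of a stationary KdV equation satisfies the local locus conditions. -/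
theorem localCond_of_kdv (h0 : f 0 = 1)
    (hs : ∀ j ≤ g, lderiv (f (j + 1)) = kdvOp q (f j)) (hk : lderiv (f (g + 1)) = 0) :
    ∃ s, LocalCond q s := by
  have hq := ordGE_neg_two_of_kdv h0 hs hk
  obtain ⟨-, hα⟩ := lead_recursion_of_kdv h0 hs hq
  -- Otherwise no factor of the leading recursion vanishes, and `f_{g+1}` has a genuine pole.
  obtain ⟨s, hsg, hlead⟩ : ∃ s : ℕ, s ≤ g ∧ q.coeff (-2) = -((s : ℂ) * (s + 1)) := by
    by_contra! hcon
    have : ∀ j : ℕ, j ≤ g + 1 → (f j).coeff (-(2 * j)) ≠ 0 := by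
      intro j
      induction j with
      | zero => intro _; simp [h0]
      | succ j ih =>
        intro hj h
        have h1 := hα j (by omega)
        rw [h, mul_zero] at h1
        refine mul_ne_zero (mul_ne_zero ?_ ?_) (ih (by omega)) h1.symm
        · exact_mod_cast (by omega : 2 * j + 1 ≠ 0)
        · intro h2
          exact hcon j (by omega) (by linear_combination h2)
    exact this (g + 1) le_rfl (coeff_eq_zero_of_lderiv_eq_zero hk (by omega))
  refine ⟨s, hq, hlead, ?_⟩
  by_contra! hcon
  obtain ⟨hms, hγ⟩ := Nat.find_spec hcon
  set m := Nat.find hcon with hm_def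
  have hmin : ∀ k < m, q.coeff (2 * (k : ℤ) - 1) = 0 := by
    intro k hk
    have := Nat.find_min hcon hk
    push Not at this
    exact this (by omega)
  have hb := odd_recursion_of_kdv h0 hs hq hmin
  set γ := q.coeff (2 * (m : ℤ) - 1) with hγ_def
  set α : ℕ → ℂ := fun j => (f j).coeff (-(2 * j)) with hα_def
  set b : ℕ → ℂ := fun j => (f j).coeff (2 * (m : ℤ) + 1 - 2 * j) with hb_def
  have hα' : ∀ j ≤ g, 2 * ((j : ℂ) + 1) * α (j + 1) =
      (2 * j + 1) * (j * (j + 1) - s * (s + 1)) * α j := by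
    intro j hj
    have := hα j hj
    rw [hlead] at this
    exact this
  have hb' : ∀ j ≤ g, (2 * ((m : ℂ) - j) - 1) * b (j + 1) =
      2 * (m - j) * ((m - j) ^ 2 - (s + 1 / 2) ^ 2) * b j + γ * α j * (m - 1 / 2 - 2 * j) := by
    intro j hj
    have := hb j hj
    rw [hlead] at this
    refine this.trans ?_
    simp only [hα_def, hb_def]
    ring
  -- Leading coefficients alternate in sign up to `s`, since `j (j + 1) < s (s + 1)` for `j < s`.
  have hA : ∀ j ≤ s, ∃ A : ℝ, 0 < A ∧ α j = (-1) ^ j * A := by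
    intro j
    induction j with
    | zero => intro _; exact ⟨1, one_pos, by simp [hα_def, h0]⟩
    | succ j ih =>
      intro hj
      obtain ⟨A, hA, e⟩ := ih (by omega)
      have h1 := hα' j (by omega)
      have hjs : (j : ℝ) + 1 ≤ s := by exact_mod_cast hj
      have hj0 : (0 : ℝ) ≤ j := by positivity
      refine ⟨(2 * j + 1) * (s * (s + 1) - j * (j + 1)) * A / (2 * (j + 1)), ?_, ?_⟩
      · have : (0 : ℝ) < s * (s + 1) - j * (j + 1) := by nlinarith
        positivity
      · have h2 : (j : ℂ) + 1 ≠ 0 := by exact_mod_cast (by omega : j + 1 ≠ 0)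
        apply mul_left_cancel₀ (mul_ne_zero two_ne_zero h2)
        rw [h1, e]
        push_cast
        field_simp
        ring
  have hα0 : ∀ j, s + 1 ≤ j → j ≤ g + 1 → α j = 0 := by
    intro j hj
    induction j, hj using Nat.le_induction with
    | base =>
      intro h
      have h1 := hα' s (by omega)
      rw [sub_self, mul_zero, zero_mul] at h1
      refine (mul_eq_zero.1 h1).resolve_left (mul_ne_zero two_ne_zero ?_)
      exact_mod_cast (by omega : s + 1 ≠ 0)
    | succ j hj ih =>
      intro h
      have h1 := hα' j (by omega)
      rw [ih (by omega), mul_zero] at h1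
      refine (mul_eq_zero.1 h1).resolve_left (mul_ne_zero two_ne_zero ?_)
      exact_mod_cast (by omega : j + 1 ≠ 0)
  -- At `j = m` the factor `m - j` vanishes, so the recursion forgets `b m` and the source alone
  -- determines `b (m + 1)`. For `m < j ≤ s` one has `(m - j) ^ 2 < (s + 1 / 2) ^ 2`, and the
  -- homogeneous term and the source have the same sign.
  have hB : ∀ j, m ≤ j → j ≤ s → ∃ B : ℝ, 0 < B ∧ b (j + 1) = (-1) ^ j * γ * B := by
    intro j hj
    induction j, hj using Nat.le_induction with
    | base =>
      intro _
      obtain ⟨A, hA, e⟩ := hA m hms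
      have h1 := hb' m (by omega)
      refine ⟨A * (m + 1 / 2), by positivity, ?_⟩
      rw [e] at h1
      push_cast
      linear_combination -h1
    | succ j hj ih =>
      intro hjs
      obtain ⟨B, hB, e⟩ := ih (by omega)
      obtain ⟨A, hA, e'⟩ := hA (j + 1) hjs
      have h1 := hb' (j + 1) (by omega)
      rw [e, e'] at h1
      have hmj : (m : ℝ) ≤ j := by exact_mod_cast hj
      have hjs' : (j : ℝ) + 1 ≤ s := by exact_mod_cast hjs
      have hm0 : (0 : ℝ) ≤ m := by positivity
      refine ⟨(2 * (j + 1 - m) * ((s + 1 / 2) ^ 2 - (j + 1 - m) ^ 2) * B +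
        A * (2 * (j + 1) + 1 / 2 - m)) / (2 * (j + 1 - m) + 1), ?_, ?_⟩
      · have h2 : (0 : ℝ) < j + 1 - m := by linarith
        have h3 : (0 : ℝ) < (s + 1 / 2) ^ 2 - (j + 1 - m) ^ 2 := by nlinarith
        have h4 : (0 : ℝ) < 2 * (j + 1) + 1 / 2 - m := by linarith
        positivity
      · have h2 : (2 * ((j : ℂ) + 1 - m) + 1) ≠ 0 := by
          have : (2 * ((j : ℤ) + 1 - m) + 1) ≠ 0 := by omega
          exact_mod_cast this
        apply mul_left_cancel₀ h2
        push_cast at h1 ⊢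
        rw [pow_succ] at h1 ⊢
        have h3 : ∀ x y : ℂ, y ≠ 0 → y * ((-1) ^ j * -1 * γ * (x / y)) = (-1) ^ j * -1 * γ * x := by
          intro x y hy
          field_simp
        rw [h3 _ _ h2]
        linear_combination -h1
  -- Beyond `s` the source is zero, and the homogeneous factor is nonzero because an integer is
  -- never `±(s + 1 / 2)`.
  have hb0 : ∀ j, s ≤ j → j ≤ g → b (j + 1) ≠ 0 := by
    intro j hj
    induction j, hj using Nat.le_induction with
    | base =>
      intro _
      obtain ⟨B, hB, e⟩ := hB s hms le_rfl
      rw [e]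
      have : (B : ℂ) ≠ 0 := by exact_mod_cast hB.ne'
      exact mul_ne_zero (mul_ne_zero (pow_ne_zero _ (by norm_num)) hγ) this
    | succ j hj ih =>
      intro hjg h
      have h1 := hb' (j + 1) hjg
      rw [h, hα0 (j + 1) (by omega) (by omega)] at h1
      have h2 : 2 * ((m : ℂ) - (j + 1 : ℕ)) ≠ 0 := by
        have : 2 * ((m : ℤ) - (j + 1 : ℕ)) ≠ 0 := by omega
        exact_mod_cast this
      have h3 : ((m : ℂ) - (j + 1 : ℕ)) ^ 2 - (s + 1 / 2) ^ 2 ≠ 0 := by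
        intro h4
        have h5 : ((2 * ((m : ℤ) - (j + 1 : ℕ)) - (2 * s + 1) : ℤ) : ℂ) *
            ((2 * ((m : ℤ) - (j + 1 : ℕ)) + (2 * s + 1) : ℤ) : ℂ) = 0 := by
          push_cast at h4 ⊢
          linear_combination 4 * h4
        have h6 : (2 * ((m : ℤ) - (j + 1 : ℕ)) - (2 * s + 1)) *
            (2 * ((m : ℤ) - (j + 1 : ℕ)) + (2 * s + 1)) = 0 := by exact_mod_cast h5
        rcases mul_eq_zero.1 h6 with h7 | h7 <;> omega
      have h4 := mul_ne_zero (mul_ne_zero h2 h3) (ih (by omega))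
      apply h4
      linear_combination -h1
  -- The exponent `2 m + 1 - 2 (g + 1)` is odd, hence not `0`, so the constancy of `f_{g+1}` kills
  -- this coefficient.
  exact hb0 g hsg le_rfl (coeff_eq_zero_of_lderiv_eq_zero hk (by omega))

end KdVLocal

/-! ### Frobenius coefficients for large spectral parameter -/

section Asymptotics

open Filter Topology

variable {s m : ℕ} {γ : ℕ → ℂ} {a : ℕ → ℕ → ℂ} {E ε : ℕ → ℂ}

/-- Leading asymptotics, for large spectral parameter, of the `p`-th Frobenius coefficient. Here
`γ (2 m + 1)` is the first nonvanishing coefficient of the potential of odd index. -/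
def FrobeniusAsymptotics (m : ℕ) (γ : ℕ → ℂ) (a : ℕ → ℕ → ℂ) (ε : ℕ → ℂ) (p : ℕ) : Prop :=
  (∀ i, p = 2 * i → ∃ u : ℝ, 0 < u ∧
      Tendsto (fun x => a x p * ε x ^ i) atTop (𝓝 ((-1) ^ i * u))) ∧
    ∀ i, p = 2 * i + 1 → (i < m → ∀ x, a x p = 0) ∧
      ∀ d, i = m + d → ∃ v : ℝ, 0 < v ∧
        Tendsto (fun x => a x p * ε x ^ d) atTop (𝓝 ((-1) ^ d * γ (2 * m + 1) * v))

theorem tendsto_mul_pow_zero {b : ℕ → ℂ} {L : ℂ} {i e : ℕ} (hε : Tendsto ε atTop (𝓝 0))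
    (h : Tendsto (fun x => b x * ε x ^ i) atTop (𝓝 L)) (hie : i < e) :
    Tendsto (fun x => b x * ε x ^ e) atTop (𝓝 0) := by
  have h1 : Tendsto (fun x => ε x ^ (e - i)) atTop (𝓝 0) := by
    have := hε.pow (e - i)
    rwa [zero_pow (by omega)] at this
  have h2 := h.mul h1
  rw [mul_zero] at h2
  refine h2.congr fun x => ?_
  rw [mul_assoc, ← pow_add, Nat.add_sub_cancel' hie.le]

theorem FrobeniusAsymptotics.even_zero {i e : ℕ} (h : FrobeniusAsymptotics m γ a ε (2 * i))
    (hε : Tendsto ε atTop (𝓝 0)) (hie : i < e) :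
    Tendsto (fun x => a x (2 * i) * ε x ^ e) atTop (𝓝 0) := by
  obtain ⟨u, -, hu⟩ := h.1 i rfl
  exact tendsto_mul_pow_zero hε hu hie

theorem FrobeniusAsymptotics.odd_zero {i e : ℕ} (h : FrobeniusAsymptotics m γ a ε (2 * i + 1))
    (hε : Tendsto ε atTop (𝓝 0)) (hie : i < m + e) :
    Tendsto (fun x => a x (2 * i + 1) * ε x ^ e) atTop (𝓝 0) := by
  obtain ⟨h1, h2⟩ := h.2 i rfl
  by_cases him : i < m
  · simp [h1 him]
  · obtain ⟨d, rfl⟩ := Nat.exists_eq_add_of_le (not_lt.1 him)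
    obtain ⟨v, -, hv⟩ := h2 d rfl
    exact tendsto_mul_pow_zero hε hv (by omega)

/-- The inhomogeneous part of the Frobenius recursion at odd index. -/
theorem frobenius_odd_limit (hE : ∀ x, E x * ε x = 1) (hε : Tendsto ε atTop (𝓝 0))
    (hm : ∀ k < m, γ (2 * k + 1) = 0) (d : ℕ)
    (ih : ∀ r < 2 * (m + d) + 1, FrobeniusAsymptotics m γ a ε r) :
    ∃ w : ℝ, 0 < w ∧ Tendsto (fun x => ((if 2 ≤ 2 * (m + d) + 1 then
        E x * a x (2 * (m + d) + 1 - 2) else 0) - ∑ l ∈ Finset.range (2 * (m + d) + 1),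
          γ (l + 1) * a x (2 * (m + d) + 1 - 1 - l)) * ε x ^ d) atTop
      (𝓝 ((-1) ^ (d + 1) * γ (2 * m + 1) * w)) := by
  obtain ⟨u, hu, hu'⟩ := (ih (2 * d) (by omega)).1 d rfl
  -- Only the term `l = 2 m`, pairing `γ (2 m + 1)` with `a (2 d)`, reaches the order `E ^ d`; all
  -- others are zero or of lower order.
  have h1 : Tendsto (fun x => ∑ l ∈ Finset.range (2 * (m + d) + 1),
      γ (l + 1) * (a x (2 * (m + d) + 1 - 1 - l) * ε x ^ d)) atTop
      (𝓝 (γ (2 * m + 1) * ((-1) ^ d * u))) := by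
    have : γ (2 * m + 1) * ((-1) ^ d * u) = ∑ l ∈ Finset.range (2 * (m + d) + 1),
        if l = 2 * m then γ (2 * m + 1) * ((-1) ^ d * (u : ℂ)) else 0 := by
      rw [Finset.sum_ite_eq' (Finset.range (2 * (m + d) + 1)) (2 * m)]
      rw [if_pos (Finset.mem_range.2 (by omega))]
    rw [this]
    refine tendsto_finsetSum _ fun l hl => ?_
    rw [Finset.mem_range] at hl
    split_ifs with hlm
    · subst hlm
      have e : 2 * (m + d) + 1 - 1 - 2 * m = 2 * d := by omega
      rw [e]
      exact hu'.const_mul _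
    · rcases Nat.even_or_odd' l with ⟨k, rfl | rfl⟩
      · by_cases hk : k < m
        · simp [hm k hk]
        · have e : 2 * (m + d) + 1 - 1 - 2 * k = 2 * (m + d - k) := by omega
          rw [e]
          have := (ih (2 * (m + d - k)) (by omega)).even_zero hε (e := d) (by omega)
          simpa using this.const_mul (γ (2 * k + 1))
      · have e : 2 * (m + d) + 1 - 1 - (2 * k + 1) = 2 * (m + d - k - 1) + 1 := by omega
        rw [e]
        have := (ih (2 * (m + d - k - 1) + 1) (by omega)).odd_zero hε (e := d) (by omega)
        simpa using this.const_mul (γ (2 * k + 1 + 1))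
  obtain ⟨v, hv, h2⟩ : ∃ v : ℝ, 0 ≤ v ∧ Tendsto (fun x => (if 2 ≤ 2 * (m + d) + 1 then
        E x * a x (2 * (m + d) + 1 - 2) else 0) * ε x ^ d) atTop
      (𝓝 ((-1) ^ (d + 1) * γ (2 * m + 1) * v)) := by
    by_cases h2 : 2 ≤ 2 * (m + d) + 1
    · simp only [if_pos h2]
      have e : 2 * (m + d) + 1 - 2 = 2 * (m + d - 1) + 1 := by omega
      rw [e]
      obtain ⟨h3, h4⟩ := (ih (2 * (m + d - 1) + 1) (by omega)).2 _ rfl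
      rcases d with _ | d
      · refine ⟨0, le_rfl, ?_⟩
        simp only [h3 (show m + 0 - 1 < m by omega), mul_zero, zero_mul, Complex.ofReal_zero]
        exact tendsto_const_nhds
      · obtain ⟨v, hv, hv'⟩ := h4 d (by omega)
        refine ⟨v, hv.le, ?_⟩
        have e2 : ((-1 : ℂ)) ^ (d + 1 + 1) = (-1) ^ d := by ring
        rw [e2]
        refine hv'.congr fun x => ?_
        rw [pow_succ]
        linear_combination (-(a x (2 * (m + (d + 1) - 1) + 1) * ε x ^ d)) * hE x
    · refine ⟨0, le_rfl, ?_⟩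
      simp only [if_neg h2, mul_zero, zero_mul, Complex.ofReal_zero]
      exact tendsto_const_nhds
  -- Both contributions carry the sign `(-1) ^ (d + 1)`, so they add up; `v = 0` is allowed because
  -- `u` is positive.
  refine ⟨v + u, by positivity, ?_⟩
  have h3 := h2.sub h1
  have e3 : (-1) ^ (d + 1) * γ (2 * m + 1) * (v : ℂ) - γ (2 * m + 1) * ((-1) ^ d * u) =
      (-1) ^ (d + 1) * γ (2 * m + 1) * ((v + u : ℝ) : ℂ) := by
    push_cast; ring
  rw [e3] at h3
  refine h3.congr fun x => ?_
  rw [sub_mul, Finset.sum_mul]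
  simp only [mul_assoc]

/-- For `0 < p ≤ 2 s` the factor `p (p - 2 s - 1)` is negative, so solving for `a x p` flips the
sign once per step. The contributions of highest order therefore agree in sign, and the positive
constants survive the induction. -/
theorem frobenius_asymptotics (hE : ∀ x, E x * ε x = 1) (hε : Tendsto ε atTop (𝓝 0))
    (hm : ∀ k < m, γ (2 * k + 1) = 0) (h0 : ∀ x, a x 0 = 1)
    (hrec : ∀ (x p : ℕ), (p : ℂ) * (p - 2 * s - 1) * a x p +
      ∑ l ∈ Finset.range p, γ (l + 1) * a x (p - 1 - l) =
        if 2 ≤ p then E x * a x (p - 2) else 0) :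
    ∀ p ≤ 2 * s, FrobeniusAsymptotics m γ a ε p := by
  intro p
  induction p using Nat.strong_induction_on with
  | _ p ih =>
    intro hp
    have hneg : ∀ q : ℕ, 0 < q → q ≤ 2 * s → (q : ℝ) * (q - 2 * s - 1) < 0 := by
      intro q h1 h2
      have h3 : (0 : ℝ) < q := by exact_mod_cast h1
      have h4 : (q : ℝ) ≤ 2 * s := by exact_mod_cast h2
      nlinarith
    have hsolve : 0 < p → ∀ x, a x p = ((if 2 ≤ p then E x * a x (p - 2) else 0) -
        ∑ l ∈ Finset.range p, γ (l + 1) * a x (p - 1 - l)) *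
          (((p : ℝ) * (p - 2 * s - 1) : ℝ) : ℂ)⁻¹ := by
      intro hp0 x
      have h1 : (((p : ℝ) * (p - 2 * s - 1) : ℝ) : ℂ) ≠ 0 := by
        exact_mod_cast (hneg p hp0 hp).ne
      rw [eq_mul_inv_iff_mul_eq₀ h1, ← hrec x p]
      push_cast
      ring
    constructor
    · rintro i rfl
      rcases i with _ | i
      · exact ⟨1, one_pos, by simp [h0]⟩
      obtain ⟨u, hu, hu'⟩ := (ih (2 * i) (by omega) (by omega)).1 i rfl
      have hn := hneg (2 * (i + 1)) (by omega) hp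
      refine ⟨-u * (((2 * (i + 1) : ℕ) : ℝ) * ((2 * (i + 1) : ℕ) - 2 * s - 1))⁻¹, ?_, ?_⟩
      · exact mul_pos_of_neg_of_neg (by linarith) (inv_lt_zero.2 hn)
      have h1 : Tendsto (fun x => ∑ l ∈ Finset.range (2 * (i + 1)),
          γ (l + 1) * (a x (2 * (i + 1) - 1 - l) * ε x ^ (i + 1))) atTop (𝓝 0) := by
        rw [show (0 : ℂ) = ∑ l ∈ Finset.range (2 * (i + 1)), 0 by simp]
        refine tendsto_finsetSum _ fun l hl => ?_
        rw [Finset.mem_range] at hl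
        rcases Nat.even_or_odd' l with ⟨k, rfl | rfl⟩
        · have e : 2 * (i + 1) - 1 - 2 * k = 2 * (i - k) + 1 := by omega
          rw [e]
          have := (ih (2 * (i - k) + 1) (by omega) (by omega)).odd_zero hε (e := i + 1) (by omega)
          simpa using this.const_mul (γ (2 * k + 1))
        · have e : 2 * (i + 1) - 1 - (2 * k + 1) = 2 * (i - k) := by omega
          rw [e]
          have := (ih (2 * (i - k)) (by omega) (by omega)).even_zero hε (e := i + 1) (by omega)
          simpa using this.const_mul (γ (2 * k + 1 + 1))
      have h2 := (hu'.sub h1).mul_const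
        ((((2 * (i + 1) : ℕ) : ℝ) * ((2 * (i + 1) : ℕ) - 2 * s - 1) : ℝ) : ℂ)⁻¹
      have e : ((-1) ^ i * (u : ℂ) - 0) *
          ((((2 * (i + 1) : ℕ) : ℝ) * ((2 * (i + 1) : ℕ) - 2 * s - 1) : ℝ) : ℂ)⁻¹ =
          (-1) ^ (i + 1) *
            ((-u * (((2 * (i + 1) : ℕ) : ℝ) * ((2 * (i + 1) : ℕ) - 2 * s - 1))⁻¹ : ℝ) : ℂ) := by
        push_cast; ring
      rw [e] at h2
      refine h2.congr fun x => ?_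
      rw [hsolve (by omega) x, if_pos (by omega), show 2 * (i + 1) - 2 = 2 * i by omega]
      simp only [← mul_assoc, ← Finset.sum_mul]
      rw [pow_succ]
      linear_combination (-(a x (2 * i) * ε x ^ i *
        ((((2 * (i + 1) : ℕ) : ℝ) * ((2 * (i + 1) : ℕ) - 2 * s - 1) : ℝ) : ℂ)⁻¹)) * hE x
    · rintro i rfl
      constructor
      · intro him x
        rw [hsolve (by omega) x]
        have h1 : (if 2 ≤ 2 * i + 1 then E x * a x (2 * i + 1 - 2) else 0) = 0 := by
          split_ifs with h
          · rw [show 2 * i + 1 - 2 = 2 * (i - 1) + 1 by omega,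
              ((ih (2 * (i - 1) + 1) (by omega) (by omega)).2 _ rfl).1 (by omega), mul_zero]
          · rfl
        rw [h1, Finset.sum_eq_zero, sub_zero, zero_mul]
        intro l hl
        rw [Finset.mem_range] at hl
        rcases Nat.even_or_odd' l with ⟨k, rfl | rfl⟩
        · rw [hm k (by omega), zero_mul]
        · rw [show 2 * i + 1 - 1 - (2 * k + 1) = 2 * (i - k - 1) + 1 by omega,
            ((ih (2 * (i - k - 1) + 1) (by omega) (by omega)).2 _ rfl).1 (by omega), mul_zero]
      · rintro d rfl
        obtain ⟨w, hw, h1⟩ := frobenius_odd_limit hE hε hm d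
          (fun r hr => ih r hr (by omega))
        have hn := hneg (2 * (m + d) + 1) (by omega) hp
        refine ⟨-w * (((2 * (m + d) + 1 : ℕ) : ℝ) * ((2 * (m + d) + 1 : ℕ) - 2 * s - 1))⁻¹, ?_, ?_⟩
        · exact mul_pos_of_neg_of_neg (by linarith) (inv_lt_zero.2 hn)
        have h2 := h1.mul_const
          ((((2 * (m + d) + 1 : ℕ) : ℝ) * ((2 * (m + d) + 1 : ℕ) - 2 * s - 1) : ℝ) : ℂ)⁻¹
        have e : (-1) ^ (d + 1) * γ (2 * m + 1) * (w : ℂ) *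
            ((((2 * (m + d) + 1 : ℕ) : ℝ) * ((2 * (m + d) + 1 : ℕ) - 2 * s - 1) : ℝ) : ℂ)⁻¹ =
            (-1) ^ d * γ (2 * m + 1) *
              ((-w * (((2 * (m + d) + 1 : ℕ) : ℝ) *
                ((2 * (m + d) + 1 : ℕ) - 2 * s - 1))⁻¹ : ℝ) : ℂ) := by
          push_cast; ring
        rw [e] at h2
        refine h2.congr fun x => ?_
        rw [hsolve (by omega) x]
        ring

/-- If the Frobenius recursion is solvable at the resonance for arbitrarily large values of the
spectral parameter, then the potential has no odd coefficients up to the resonance. -/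
theorem odd_coeff_eq_zero_of_frobenius (hE : ∀ x, E x * ε x = 1) (hε : Tendsto ε atTop (𝓝 0))
    (h0 : ∀ x, a x 0 = 1)
    (hrec : ∀ (x p : ℕ), (p : ℂ) * (p - 2 * s - 1) * a x p +
      ∑ l ∈ Finset.range p, γ (l + 1) * a x (p - 1 - l) =
        if 2 ≤ p then E x * a x (p - 2) else 0) :
    ∀ k ≤ s, γ (2 * k + 1) = 0 := by
  by_contra! hcon
  obtain ⟨hms, hγ⟩ := Nat.find_spec hcon
  set m := Nat.find hcon with hm_def
  have hm : ∀ k < m, γ (2 * k + 1) = 0 := by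
    intro k hk
    have := Nat.find_min hcon hk
    push Not at this
    exact this (by omega)
  obtain ⟨d, hd⟩ := Nat.exists_eq_add_of_le hms
  have hS := frobenius_asymptotics hE hε hm h0 hrec
  obtain ⟨w, hw, h1⟩ := frobenius_odd_limit hE hε hm d (fun r hr => hS r (by omega))
  -- Here `2 (m + d) + 1 = 2 s + 1` is the resonance: the coefficient of `a x p` is zero, so the
  -- inhomogeneous part vanishes identically, although its rescaled limit is nonzero.
  have h2 : ∀ x, ((if 2 ≤ 2 * (m + d) + 1 then
        E x * a x (2 * (m + d) + 1 - 2) else 0) - ∑ l ∈ Finset.range (2 * (m + d) + 1),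
          γ (l + 1) * a x (2 * (m + d) + 1 - 1 - l)) * ε x ^ d = 0 := by
    intro x
    have := hrec x (2 * (m + d) + 1)
    rw [← this, hd]
    push_cast
    ring
  simp only [h2] at h1
  have h3 := tendsto_nhds_unique h1 tendsto_const_nhds
  have h4 : (w : ℂ) ≠ 0 := by exact_mod_cast hw.ne'
  exact mul_ne_zero (mul_ne_zero (pow_ne_zero _ (by norm_num)) hγ) h4 h3

end Asymptotics

/-! ### Formal solutions of the Schrödinger equation -/

/-- `Y` is a formal solution of `Y'' + q Y = E Y`. -/
def FormalSol (q : ℂ⸨X⸩) (E : ℂ) (Y : ℂ⸨X⸩) : Prop :=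
  lderiv (lderiv Y) + q * Y = HahnSeries.C E * Y

theorem exists_ordGE {Y : ℂ⸨X⸩} (hY : Y ≠ 0) : ∃ n, OrdGE n Y ∧ Y.coeff n ≠ 0 :=
  ⟨Y.order, fun _ hi => HahnSeries.coeff_eq_zero_of_lt_order hi,
    mt HahnSeries.coeff_order_eq_zero.1 hY⟩

theorem OrdGE.lderiv_of_zero {f : ℂ⸨X⸩} (hf : OrdGE 0 f) : OrdGE 0 (HalphenKdV.lderiv f) := by
  intro i hi
  rw [coeff_lderiv]
  rcases (show i + 1 < 0 ∨ i = -1 by omega) with h1 | rfl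
  · rw [hf _ h1, mul_zero]
  · push_cast; ring

theorem OrdGE.of_mul {m n : ℤ} {f g : ℂ⸨X⸩} (hf : OrdGE m f) (hf0 : f.coeff m ≠ 0)
    (h : OrdGE (m + n) (f * g)) : OrdGE n g := by
  by_cases h0 : g = 0
  · rw [h0]; exact OrdGE.zero n
  obtain ⟨a, ha, ha0⟩ := exists_ordGE h0
  refine ha.mono ?_
  by_contra! hlt
  have h1 := hf.coeff_mul ha
  rw [h _ (by omega)] at h1
  exact mul_ne_zero hf0 ha0 h1.symm

/-- With a pole of order above two, the lowest term of `q Y` has nothing to cancel against. -/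
theorem FormalSol.ordGE_neg_two {q : ℂ⸨X⸩} {E : ℂ} {Y : ℂ⸨X⸩} (h : FormalSol q E Y)
    (hY : Y ≠ 0) : OrdGE (-2) q := by
  by_contra hcon
  have hq0 : q ≠ 0 := by
    rintro rfl
    exact hcon (OrdGE.zero _)
  obtain ⟨n, hn, hn'⟩ := exists_ordGE hY
  obtain ⟨p, hp, hp'⟩ := exists_ordGE hq0
  have hp3 : p < -2 := by
    by_contra h
    exact hcon (hp.mono (by omega))
  have h1 := congrArg (fun f : ℂ⸨X⸩ => f.coeff (p + n)) h
  simp only [HahnSeries.coeff_add] at h1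
  rw [hp.coeff_mul hn, hn.lderiv.lderiv (p + n) (by omega), coeff_C_mul',
    hn (p + n) (by omega), mul_zero, zero_add] at h1
  exact mul_ne_zero hp' hn' h1

theorem FormalSol.indicial {q : ℂ⸨X⸩} {E : ℂ} {Y : ℂ⸨X⸩} (h : FormalSol q E Y)
    (hq : OrdGE (-2) q) {n : ℤ} (hn : OrdGE n Y) (hn' : Y.coeff n ≠ 0) :
    q.coeff (-2) = -((n : ℂ) * (n - 1)) := by
  have h1 := congrArg (fun f : ℂ⸨X⸩ => f.coeff (-2 + n)) h
  simp only [HahnSeries.coeff_add] at h1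
  rw [hq.coeff_mul hn, coeff_C_mul', hn (-2 + n) (by omega), mul_zero,
    show -2 + n = n - 1 - 1 by ring, coeff_lderiv_sub_one, coeff_lderiv_sub_one] at h1
  push_cast at h1
  have h2 : (q.coeff (-2) + (n : ℂ) * (n - 1)) * Y.coeff n = 0 := by linear_combination h1
  have := (mul_eq_zero.1 h2).resolve_right hn'
  linear_combination this

theorem FormalSol.smul_sub_smul {q : ℂ⸨X⸩} {E : ℂ} {Y Z : ℂ⸨X⸩} (hY : FormalSol q E Y)
    (hZ : FormalSol q E Z) (a b : ℂ) :
    FormalSol q E (HahnSeries.C a * Y + HahnSeries.C b * Z) := by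
  unfold FormalSol at *
  simp only [map_add, lderiv_C_mul]
  linear_combination HahnSeries.C a * hY + HahnSeries.C b * hZ

/-- Eliminating leading terms between two independent solutions produces two distinct leading
exponents. Both are roots of the same indicial equation and add up to `1`, so one of them is at most
`0`; it is named `-s`. -/
theorem exists_normalized_formalSol {q : ℂ⸨X⸩} {E : ℂ} {Y Z : ℂ⸨X⸩} (hY : FormalSol q E Y)
    (hZ : FormalSol q E Z)
    (hind : ∀ a b : ℂ, HahnSeries.C a * Y + HahnSeries.C b * Z = 0 → a = 0 ∧ b = 0) :
    ∃ (s : ℕ) (W : ℂ⸨X⸩), FormalSol q E W ∧ OrdGE (-s) W ∧ W.coeff (-s) = 1 ∧ OrdGE (-2) q ∧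
      q.coeff (-2) = -((s : ℂ) * (s + 1)) := by
  have hY0 : Y ≠ 0 := by
    rintro rfl
    exact one_ne_zero (hind 1 0 (by simp)).1
  have hZ0 : Z ≠ 0 := by
    rintro rfl
    exact one_ne_zero (hind 0 1 (by simp)).2
  have hq := hY.ordGE_neg_two hY0
  obtain ⟨n, hn, hn'⟩ := exists_ordGE hY0
  obtain ⟨k, hk, hk'⟩ := exists_ordGE hZ0
  obtain ⟨m, W, hW, hm, hm', hne⟩ : ∃ (m : ℤ) (W : ℂ⸨X⸩), FormalSol q E W ∧ OrdGE m W ∧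
      W.coeff m ≠ 0 ∧ m ≠ n := by
    by_cases hkn : k = n
    · subst hkn
      have h1 : HahnSeries.C (Z.coeff k) * Y + HahnSeries.C (-Y.coeff k) * Z ≠ 0 := fun h =>
        hk' (hind _ _ h).1
      obtain ⟨m, hm, hm'⟩ := exists_ordGE h1
      refine ⟨m, _, hY.smul_sub_smul hZ _ _, hm, hm', ?_⟩
      rintro rfl
      apply hm'
      rw [HahnSeries.coeff_add, coeff_C_mul', coeff_C_mul']
      ring
    · exact ⟨k, Z, hZ, hk, hk', hkn⟩
  have i1 := hY.indicial hq hn hn'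
  have i2 := hW.indicial hq hm hm'
  have hsum : m + n = 1 := by
    have h1 : ((m : ℂ) - n) * (m + n - 1) = 0 := by linear_combination i2 - i1
    have h2 : (m - n) * (m + n - 1) = 0 := by exact_mod_cast h1
    rcases mul_eq_zero.1 h2 with h3 | h3 <;> omega
  have fin : ∀ (r : ℤ) (V : ℂ⸨X⸩), FormalSol q E V → OrdGE r V → V.coeff r ≠ 0 → r ≤ 0 →
      ∃ (s : ℕ) (W : ℂ⸨X⸩), FormalSol q E W ∧ OrdGE (-s) W ∧ W.coeff (-s) = 1 ∧
        OrdGE (-2) q ∧ q.coeff (-2) = -((s : ℂ) * (s + 1)) := by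
    intro r V hV hr hr' hr0
    obtain ⟨s, rfl⟩ : ∃ s : ℕ, r = -s := ⟨(-r).toNat, by omega⟩
    refine ⟨s, HahnSeries.C (V.coeff (-s))⁻¹ * V, ?_, hr.C_mul _, ?_, hq, ?_⟩
    · simpa using hV.smul_sub_smul hV (V.coeff (-s))⁻¹ 0
    · rw [coeff_C_mul', inv_mul_cancel₀ hr']
    · rw [hV.indicial hq hr hr']; push_cast; ring
  rcases le_or_gt n 0 with h | h
  · exact fin n Y hY hn hn' h
  · exact fin m W hW hm hm' (by omega)

/-- The diagonal factor is `(p - s) (p - s - 1) - s (s + 1)`; it vanishes at the resonance `p = 2 s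
+ 1`, the gap between the two exponents. -/
theorem FormalSol.recursion {q : ℂ⸨X⸩} {E : ℂ} {Y : ℂ⸨X⸩} {s : ℕ} (h : FormalSol q E Y)
    (hq : OrdGE (-2) q) (hlead : q.coeff (-2) = -((s : ℂ) * (s + 1))) (hY : OrdGE (-s) Y) (p : ℕ) :
    (p : ℂ) * (p - 2 * s - 1) * Y.coeff (-s + p) +
      ∑ l ∈ Finset.range p, q.coeff (-2 + (l + 1 : ℕ)) * Y.coeff (-s + (p - 1 - l : ℕ)) =
        if 2 ≤ p then E * Y.coeff (-s + (p - 2 : ℕ)) else 0 := by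
  have h1 := congrArg (fun f : ℂ⸨X⸩ => f.coeff (-2 + -s + p)) h
  simp only [HahnSeries.coeff_add] at h1
  rw [hq.coeff_mul_eq_sum_range hY, coeff_C_mul', Finset.sum_range_succ'] at h1
  have e1 : (lderiv (lderiv Y)).coeff (-2 + -s + p) =
      ((p : ℂ) - s) * (p - s - 1) * Y.coeff (-s + p) := by
    rw [show -2 + -(s : ℤ) + p = (-s + p) - 1 - 1 by ring, coeff_lderiv_sub_one,
      coeff_lderiv_sub_one]
    push_cast; ring
  have e2 : E * Y.coeff (-2 + -s + p) = if 2 ≤ p then E * Y.coeff (-s + (p - 2 : ℕ)) else 0 := by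
    split_ifs with h2
    · congr 2; omega
    · rw [hY _ (by omega), mul_zero]
  rw [e1, e2] at h1
  rw [← h1]
  have e3 : ∀ l ∈ Finset.range p, q.coeff (-2 + (l + 1 : ℕ)) * Y.coeff (-s + (p - 1 - l : ℕ)) =
      q.coeff (-2 + (l + 1 : ℕ)) * Y.coeff (-s + (p - (l + 1) : ℕ)) := by
    intro l _
    rw [show p - 1 - l = p - (l + 1) by omega]
  rw [Finset.sum_congr rfl e3]
  simp only [Nat.cast_zero, add_zero, Nat.sub_zero, hlead]
  ring

/-- If `Y'' + q Y = E Y` has two independent formal solutions for every `E`, then `q` satisfies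
the local locus conditions. -/
theorem localCond_of_formalSol {q : ℂ⸨X⸩}
    (h : ∀ E : ℂ, ∃ Y Z : ℂ⸨X⸩, FormalSol q E Y ∧ FormalSol q E Z ∧
      ∀ a b : ℂ, HahnSeries.C a * Y + HahnSeries.C b * Z = 0 → a = 0 ∧ b = 0) :
    ∃ s, LocalCond q s := by
  have h' : ∀ E : ℂ, ∃ (s : ℕ) (W : ℂ⸨X⸩), FormalSol q E W ∧ OrdGE (-s) W ∧ W.coeff (-s) = 1 ∧
      OrdGE (-2) q ∧ q.coeff (-2) = -((s : ℂ) * (s + 1)) := by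
    intro E
    obtain ⟨Y, Z, hY, hZ, hind⟩ := h E
    exact exists_normalized_formalSol hY hZ hind
  obtain ⟨s, -, -, -, -, hq, hlead⟩ := h' 0
  have h'' : ∀ E : ℂ, ∃ W : ℂ⸨X⸩, FormalSol q E W ∧ OrdGE (-s) W ∧ W.coeff (-s) = 1 := by
    intro E
    obtain ⟨r, W, h1, h2, h3, -, h4⟩ := h' E
    -- The exponent does not depend on `E`, since `q.coeff (-2)` already determines it.
    have : r = s := by
      have h5 : (r : ℂ) * (r + 1) = s * (s + 1) := by linear_combination h4 - hlead
      have h6 : r * (r + 1) = s * (s + 1) := by exact_mod_cast h5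
      rcases lt_trichotomy r s with h7 | h7 | h7
      · nlinarith
      · exact h7
      · nlinarith
    exact ⟨W, h1, this ▸ h2, this ▸ h3⟩
  choose W hW hord hone using h''
  refine ⟨s, hq, hlead, fun k hk => ?_⟩
  have key := odd_coeff_eq_zero_of_frobenius (s := s) (γ := fun i => q.coeff (-2 + (i : ℕ)))
    (a := fun x p => (W ((x : ℂ) + 1)).coeff (-s + p)) (E := fun x => (x : ℂ) + 1)
    (ε := fun x => 1 / ((x : ℂ) + 1))
    (fun x => mul_one_div_cancel (by exact_mod_cast (by omega : x + 1 ≠ 0)))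
    (tendsto_one_div_add_atTop_nhds_zero_nat)
    (fun x => by simpa using hone _)
    (fun x p => (hW _).recursion hq hlead (hord _) p) k hk
  have e : -2 + ((2 * k + 1 : ℕ) : ℤ) = 2 * k - 1 := by push_cast; ring
  simpa only [e] using key

/-! ### Laurent expansions of rational functions at the points of the Riemann sphere -/

/-- The exponent `e` is kept general because `e = 1` serves the finite points and `e = -1` the point
at infinity. -/
theorem eval₂_single_coeff {e : ℤ} (he : e ≠ 0) (p : ℂ[X]) (i : ℕ) :
    (p.eval₂ (HahnSeries.C : ℂ →+* ℂ⸨X⸩) (HahnSeries.single e 1)).coeff (e * i) = p.coeff i := by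
  induction p using Polynomial.induction_on' with
  | add p q hp hq => rw [Polynomial.eval₂_add, HahnSeries.coeff_add, hp, hq, Polynomial.coeff_add]
  | monomial n a =>
    rw [Polynomial.eval₂_monomial, HahnSeries.single_pow, coeff_C_mul', one_pow,
      Polynomial.coeff_monomial, nsmul_eq_mul]
    by_cases h : n = i
    · subst h; rw [mul_comm (n : ℤ) e]; simp
    · rw [if_neg h, HahnSeries.coeff_single_of_ne, mul_zero]
      rw [mul_comm (n : ℤ) e]
      intro h'
      exact h (by exact_mod_cast (mul_left_cancel₀ he h').symm)

theorem eval₂_single_coeff_of_ne {e : ℤ} (p : ℂ[X]) {n : ℤ} (hn : ∀ i : ℕ, n ≠ e * i) :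
    (p.eval₂ (HahnSeries.C : ℂ →+* ℂ⸨X⸩) (HahnSeries.single e 1)).coeff n = 0 := by
  induction p using Polynomial.induction_on' with
  | add p q hp hq => rw [Polynomial.eval₂_add, HahnSeries.coeff_add, hp, hq, add_zero]
  | monomial i a =>
    rw [Polynomial.eval₂_monomial, HahnSeries.single_pow, coeff_C_mul', one_pow, nsmul_eq_mul,
      HahnSeries.coeff_single_of_ne, mul_zero]
    rw [mul_comm]
    exact hn i

theorem eval₂_add_C (p : ℂ[X]) (α : ℂ) (x : ℂ⸨X⸩) :
    p.eval₂ (HahnSeries.C : ℂ →+* ℂ⸨X⸩) (x + HahnSeries.C α) =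
      (Polynomial.taylor α p).eval₂ HahnSeries.C x := by
  rw [Polynomial.taylor_apply, Polynomial.eval₂_comp]
  simp

theorem eval₂_single_injective {e : ℤ} (he : e ≠ 0) {p : ℂ[X]}
    (h : p.eval₂ (HahnSeries.C : ℂ →+* ℂ⸨X⸩) (HahnSeries.single e 1) = 0) : p = 0 := by
  ext i
  rw [← eval₂_single_coeff he, h]
  simp

/-- The Laurent expansion of a rational function at `α`, in powers of `z - α`. -/
def expAt (α : ℂ) : RatFunc ℂ →+* ℂ⸨X⸩ :=
  RatFunc.liftRingHom
    (Polynomial.eval₂RingHom HahnSeries.C (HahnSeries.single 1 1 + HahnSeries.C α)) <| by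
      intro p hp
      rw [Submonoid.mem_comap]
      refine mem_nonZeroDivisors_of_ne_zero fun h => nonZeroDivisors.ne_zero hp ?_
      rw [Polynomial.coe_eval₂RingHom, eval₂_add_C] at h
      exact (Polynomial.taylor_injective α) (by
        rw [eval₂_single_injective one_ne_zero h, map_zero])

/-- The Laurent expansion of a rational function at infinity, in powers of `1 / z`. -/
def expInf : RatFunc ℂ →+* ℂ⸨X⸩ :=
  RatFunc.liftRingHom
    (Polynomial.eval₂RingHom HahnSeries.C (HahnSeries.single (-1) 1)) <| by
      intro p hp
      rw [Submonoid.mem_comap]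
      refine mem_nonZeroDivisors_of_ne_zero fun h => nonZeroDivisors.ne_zero hp ?_
      exact eval₂_single_injective (by norm_num) h

theorem expAt_algebraMap (α : ℂ) (p : ℂ[X]) :
    expAt α (algebraMap ℂ[X] (RatFunc ℂ) p) =
      p.eval₂ HahnSeries.C (HahnSeries.single 1 1 + HahnSeries.C α) := by
  rw [expAt, RatFunc.liftRingHom_algebraMap]; rfl

theorem expInf_algebraMap (p : ℂ[X]) :
    expInf (algebraMap ℂ[X] (RatFunc ℂ) p) = p.eval₂ HahnSeries.C (HahnSeries.single (-1) 1) := by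
  rw [expInf, RatFunc.liftRingHom_algebraMap]; rfl

theorem expAt_C (α c : ℂ) : expAt α (RatFunc.C c) = HahnSeries.C c := by
  rw [← RatFunc.algebraMap_C, expAt_algebraMap, Polynomial.eval₂_C]

theorem expInf_C (c : ℂ) : expInf (RatFunc.C c) = HahnSeries.C c := by
  rw [← RatFunc.algebraMap_C, expInf_algebraMap, Polynomial.eval₂_C]

theorem expAt_X (α : ℂ) :
    expAt α RatFunc.X = HahnSeries.single 1 1 + HahnSeries.C α := by
  rw [← RatFunc.algebraMap_X, expAt_algebraMap, Polynomial.eval₂_X]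

theorem expInf_X : expInf RatFunc.X = HahnSeries.single (-1) 1 := by
  rw [← RatFunc.algebraMap_X, expInf_algebraMap, Polynomial.eval₂_X]

theorem coeff_expAt_algebraMap (α : ℂ) (p : ℂ[X]) (n : ℕ) :
    (expAt α (algebraMap ℂ[X] (RatFunc ℂ) p)).coeff n = (Polynomial.taylor α p).coeff n := by
  rw [expAt_algebraMap, eval₂_add_C, ← eval₂_single_coeff one_ne_zero, one_mul]

theorem ordGE_expAt_algebraMap (α : ℂ) (p : ℂ[X]) :
    OrdGE 0 (expAt α (algebraMap ℂ[X] (RatFunc ℂ) p)) := by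
  intro i hi
  rw [expAt_algebraMap, eval₂_add_C, eval₂_single_coeff_of_ne]
  intro j
  omega

theorem coeff_zero_expAt_algebraMap (α : ℂ) (p : ℂ[X]) :
    (expAt α (algebraMap ℂ[X] (RatFunc ℂ) p)).coeff 0 = p.eval α := by
  have := coeff_expAt_algebraMap α p 0
  rwa [Polynomial.taylor_coeff_zero] at this

theorem coeff_expInf_algebraMap (p : ℂ[X]) (n : ℕ) :
    (expInf (algebraMap ℂ[X] (RatFunc ℂ) p)).coeff (-n) = p.coeff n := by
  rw [expInf_algebraMap, ← eval₂_single_coeff (e := -1) (by norm_num), neg_one_mul]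

theorem coeff_expInf_algebraMap_of_pos (p : ℂ[X]) {n : ℤ} (hn : 0 < n) :
    (expInf (algebraMap ℂ[X] (RatFunc ℂ) p)).coeff n = 0 := by
  rw [expInf_algebraMap, eval₂_single_coeff_of_ne]
  intro j
  omega

theorem ordGE_expInf_algebraMap {p : ℂ[X]} {n : ℕ} (hp : p.natDegree ≤ n) :
    OrdGE (-n) (expInf (algebraMap ℂ[X] (RatFunc ℂ) p)) := by
  intro i hi
  obtain ⟨j, rfl⟩ : ∃ j : ℕ, i = -j := ⟨(-i).toNat, by omega⟩
  rw [coeff_expInf_algebraMap, Polynomial.coeff_eq_zero_of_natDegree_lt (by omega)]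

/-- The derivation `d/dz` in the coordinate `t = 1/z`. -/
def infDeriv (f : ℂ⸨X⸩) : ℂ⸨X⸩ := HahnSeries.single 2 (-1) * lderiv f

theorem coeff_infDeriv (f : ℂ⸨X⸩) (n : ℤ) :
    (infDeriv f).coeff (n + 1) = -n * f.coeff n := by
  have := HahnSeries.coeff_single_mul_add (r := (-1 : ℂ)) (x := lderiv f) (a := n - 1) (b := (2 : ℤ))
  rw [coeff_lderiv_sub_one, show n - 1 + 2 = n + 1 by ring] at this
  rw [infDeriv, this]; ring

theorem OrdGE.infDeriv {n : ℤ} {f : ℂ⸨X⸩} (hf : OrdGE n f) : OrdGE (n + 1) (infDeriv f) := by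
  intro i hi
  have := coeff_infDeriv f (i - 1)
  rw [sub_add_cancel] at this
  rw [this, hf _ (by omega), mul_zero]

/-- A derivation is determined on a field of fractions by constants and `X`, through the product
rule applied to `f * denom = num`. One argument covers the expansions at finite points and at
infinity. -/
theorem map_ratDeriv_of_deriv (φ : RatFunc ℂ →+* ℂ⸨X⸩) (δ : ℂ⸨X⸩ → ℂ⸨X⸩)
    (hadd : ∀ f g, δ (f + g) = δ f + δ g) (hmul : ∀ f g, δ (f * g) = δ f * g + f * δ g)
    (hC : ∀ c, δ (φ (RatFunc.C c)) = 0) (hX : δ (φ RatFunc.X) = 1) (f : RatFunc ℂ) :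
    φ (ratDeriv f) = δ (φ f) := by
  have hp : ∀ p : ℂ[X], δ (φ (algebraMap ℂ[X] (RatFunc ℂ) p)) =
      φ (algebraMap ℂ[X] (RatFunc ℂ) (Polynomial.derivative p)) := by
    intro p
    induction p using Polynomial.induction_on with
    | C a => rw [RatFunc.algebraMap_C, hC]; simp
    | add p q hp hq => simp only [map_add, hadd, hp, hq]
    | monomial n a ih =>
      rw [pow_succ, ← mul_assoc, map_mul, map_mul, hmul, ih, RatFunc.algebraMap_X, hX]
      simp only [Polynomial.derivative_mul, Polynomial.derivative_X, map_add, map_mul,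
        RatFunc.algebraMap_X, map_one]
  have hd : algebraMap ℂ[X] (RatFunc ℂ) f.denom ≠ 0 := RatFunc.algebraMap_ne_zero f.denom_ne_zero
  have hd' : φ (algebraMap ℂ[X] (RatFunc ℂ) f.denom) ≠ 0 := (map_ne_zero φ).2 hd
  have e1 : f * algebraMap ℂ[X] (RatFunc ℂ) f.denom = algebraMap ℂ[X] (RatFunc ℂ) f.num := by
    conv_lhs => rw [← RatFunc.num_div_denom f]
    rw [RatFunc.num_div_denom, ← eq_div_iff hd, RatFunc.num_div_denom]
  have e1' : φ f * φ (algebraMap ℂ[X] (RatFunc ℂ) f.denom) =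
      φ (algebraMap ℂ[X] (RatFunc ℂ) f.num) := by rw [← map_mul, e1]
  have e2 := hp f.num
  rw [← e1, map_mul, hmul, hp f.denom] at e2
  rw [ratDeriv, map_div₀, div_eq_iff (by rw [map_pow, map_pow]; exact pow_ne_zero 2 hd')]
  simp only [map_sub, map_mul, map_pow]
  rw [← e1']
  linear_combination (-φ (algebraMap ℂ[X] (RatFunc ℂ) f.denom)) * e2

theorem expAt_ratDeriv (α : ℂ) (f : RatFunc ℂ) : expAt α (ratDeriv f) = lderiv (expAt α f) := by
  refine map_ratDeriv_of_deriv (expAt α) (fun g => lderiv g) (fun f g => map_add _ f g) lderiv_mul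
    (fun c => by rw [expAt_C, lderiv_C]) ?_ f
  rw [expAt_X, map_add, lderiv_C, add_zero, lderiv, LaurentSeries.derivative_apply,
    LaurentSeries.hasseDeriv_single]
  simp

theorem expInf_ratDeriv (f : RatFunc ℂ) : expInf (ratDeriv f) = infDeriv (expInf f) := by
  refine map_ratDeriv_of_deriv expInf infDeriv (fun f g => ?_) (fun f g => ?_) (fun c => ?_) ?_ f
  · simp only [infDeriv, map_add, mul_add]
  · simp only [infDeriv, lderiv_mul]; ring
  · rw [infDeriv, expInf_C, lderiv_C, mul_zero]
  · rw [expInf_X, infDeriv, lderiv, LaurentSeries.derivative_apply,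
      LaurentSeries.hasseDeriv_single, HahnSeries.single_mul_single]
    simp

theorem expAt_injective (α : ℂ) : Function.Injective (expAt α) := (expAt α).injective

/-- The rules for `ratDeriv` are read off from `ℂ((t))`: a homomorphism of fields is injective, so
no manipulation of numerators and denominators is needed. -/
theorem ratDeriv_add (f g : RatFunc ℂ) : ratDeriv (f + g) = ratDeriv f + ratDeriv g :=
  expAt_injective 0 (by simp only [map_add, expAt_ratDeriv])

theorem ratDeriv_mul (f g : RatFunc ℂ) : ratDeriv (f * g) = ratDeriv f * g + f * ratDeriv g :=
  expAt_injective 0 (by simp only [map_add, map_mul, expAt_ratDeriv, lderiv_mul])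

theorem ratDeriv_C (c : ℂ) : ratDeriv (RatFunc.C c) = 0 :=
  expAt_injective 0 (by simp only [expAt_ratDeriv, expAt_C, lderiv_C, map_zero])

theorem ratDeriv_X : ratDeriv RatFunc.X = 1 := by
  simp [ratDeriv]

theorem ratDeriv_C_mul (c : ℂ) (f : RatFunc ℂ) :
    ratDeriv (RatFunc.C c * f) = RatFunc.C c * ratDeriv f := by
  rw [ratDeriv_mul, ratDeriv_C, zero_mul, zero_add]

theorem ratDeriv_zero : ratDeriv 0 = 0 := by simpa using ratDeriv_C 0

theorem ratDeriv_one : ratDeriv 1 = 0 := by simpa using ratDeriv_C 1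

theorem ratDeriv_sub (f g : RatFunc ℂ) : ratDeriv (f - g) = ratDeriv f - ratDeriv g :=
  expAt_injective 0 (by simp only [map_sub, expAt_ratDeriv])

theorem eq_C_of_ratDeriv_eq_zero {f : RatFunc ℂ} (h : ratDeriv f = 0) : ∃ c, f = RatFunc.C c := by
  refine ⟨(expAt 0 f).coeff 0, expAt_injective 0 ?_⟩
  rw [expAt_C]
  have h1 : lderiv (expAt 0 f) = 0 := by rw [← expAt_ratDeriv, h, map_zero]
  ext n
  by_cases hn : n = 0
  · subst hn; simp
  · rw [coeff_eq_zero_of_lderiv_eq_zero h1 hn, HahnSeries.C_apply, HahnSeries.coeff_single_of_ne hn]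

/-- A zero of the denominator of a function regular at `α` would also be a zero of the numerator,
against coprimality. -/
theorem eval_denom_ne_zero_of_ordGE {f : RatFunc ℂ} {α : ℂ} (h : OrdGE 0 (expAt α f)) :
    f.denom.eval α ≠ 0 := by
  intro hα
  have hd : algebraMap ℂ[X] (RatFunc ℂ) f.denom ≠ 0 := RatFunc.algebraMap_ne_zero f.denom_ne_zero
  have e1 : algebraMap ℂ[X] (RatFunc ℂ) f.num = f * algebraMap ℂ[X] (RatFunc ℂ) f.denom := by
    rw [← div_eq_iff hd, RatFunc.num_div_denom]
  have h1 : f.num.eval α = 0 := by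
    rw [← coeff_zero_expAt_algebraMap, e1, map_mul]
    have := h.coeff_mul (ordGE_expAt_algebraMap α f.denom)
    rw [coeff_zero_expAt_algebraMap, hα, mul_zero] at this
    simpa using this
  obtain ⟨a, b, hab⟩ := f.isCoprime_num_denom
  have := congrArg (Polynomial.eval α) hab
  simp [h1, hα] at this

/-- A rational function without poles is a polynomial. -/
theorem exists_polynomial_of_ordGE {f : RatFunc ℂ} (h : ∀ α, OrdGE 0 (expAt α f)) :
    ∃ p : ℂ[X], f = algebraMap ℂ[X] (RatFunc ℂ) p := by
  have h1 : f.denom.natDegree = 0 := by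
    by_contra hne
    obtain ⟨α, hα⟩ := IsAlgClosed.exists_root f.denom (by
      intro hd
      exact hne (Polynomial.natDegree_eq_of_degree_eq_some hd))
    exact eval_denom_ne_zero_of_ordGE (h α) hα
  have h2 : f.denom = 1 := (f.monic_denom).natDegree_eq_zero.1 h1
  refine ⟨f.num, ?_⟩
  conv_lhs => rw [← RatFunc.num_div_denom f, h2, map_one, div_one]

theorem ordGE_expAt_of_eval_denom_ne_zero {f : RatFunc ℂ} {α : ℂ} (h : f.denom.eval α ≠ 0) :
    OrdGE 0 (expAt α f) := by
  by_cases hf0 : f = 0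
  · rw [hf0, map_zero]; exact OrdGE.zero 0
  obtain ⟨n, hn, hn'⟩ := exists_ordGE ((map_ne_zero (expAt α)).2 hf0)
  refine hn.mono ?_
  by_contra hcon
  have hd : algebraMap ℂ[X] (RatFunc ℂ) f.denom ≠ 0 := RatFunc.algebraMap_ne_zero f.denom_ne_zero
  have e1 : algebraMap ℂ[X] (RatFunc ℂ) f.num = f * algebraMap ℂ[X] (RatFunc ℂ) f.denom := by
    rw [← div_eq_iff hd, RatFunc.num_div_denom]
  have h1 := hn.coeff_mul (ordGE_expAt_algebraMap α f.denom)
  rw [← map_mul, ← e1, coeff_zero_expAt_algebraMap,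
    ordGE_expAt_algebraMap α f.num (n + 0) (by omega)] at h1
  exact mul_ne_zero hn' h h1.symm

theorem X_sub_C_ne_zero (ζ : ℂ) : (RatFunc.X - RatFunc.C ζ : RatFunc ℂ) ≠ 0 := by
  rw [← RatFunc.algebraMap_X, ← RatFunc.algebraMap_C, ← map_sub]
  exact RatFunc.algebraMap_ne_zero (Polynomial.X_sub_C_ne_zero ζ)

theorem expAt_X_sub_C (α ζ : ℂ) :
    expAt α (RatFunc.X - RatFunc.C ζ) = HahnSeries.single 1 1 + HahnSeries.C (α - ζ) := by
  rw [map_sub, expAt_X, expAt_C, map_sub]; ring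

theorem expAt_inv_sq_self (ζ : ℂ) :
    expAt ζ (((RatFunc.X - RatFunc.C ζ) ^ 2)⁻¹) = HahnSeries.single (-2) 1 := by
  rw [map_inv₀, map_pow, expAt_X_sub_C, sub_self, map_zero, add_zero, HahnSeries.single_pow]
  refine inv_eq_of_mul_eq_one_right ?_
  rw [HahnSeries.single_mul_single]
  simp

theorem ratDeriv_inv_X_sub_C (ζ : ℂ) :
    ratDeriv ((RatFunc.X - RatFunc.C ζ)⁻¹) = -((RatFunc.X - RatFunc.C ζ) ^ 2)⁻¹ := by
  have h := X_sub_C_ne_zero ζ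
  have h1 : ratDeriv ((RatFunc.X - RatFunc.C ζ)⁻¹ * (RatFunc.X - RatFunc.C ζ)) = 0 := by
    rw [inv_mul_cancel₀ h, ratDeriv_one]
  rw [ratDeriv_mul, ratDeriv_sub, ratDeriv_X, ratDeriv_C, sub_zero, mul_one] at h1
  field_simp at h1 ⊢
  linear_combination h1

/-- The geometric series, obtained coefficientwise from the product of the inverse with `t + (α -
ζ)` being `1`. -/
theorem expAt_inv_of_ne {α ζ : ℂ} (h : α ≠ ζ) :
    OrdGE 0 (expAt α ((RatFunc.X - RatFunc.C ζ)⁻¹)) ∧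
    ∀ n : ℕ, (expAt α ((RatFunc.X - RatFunc.C ζ)⁻¹)).coeff n = (-1) ^ n / (α - ζ) ^ (n + 1) := by
  have ha : α - ζ ≠ 0 := sub_ne_zero.2 h
  have hX := X_sub_C_ne_zero ζ
  set f := expAt α ((RatFunc.X - RatFunc.C ζ)⁻¹) with hf
  have hmul : f * (HahnSeries.single 1 1 + HahnSeries.C (α - ζ)) = 1 := by
    rw [hf, ← expAt_X_sub_C, ← map_mul, inv_mul_cancel₀ hX, map_one]
  have hc : ∀ n : ℤ, f.coeff (n - 1) + (α - ζ) * f.coeff n = (1 : ℂ⸨X⸩).coeff n := by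
    intro n
    rw [← hmul, mul_add, HahnSeries.coeff_add, mul_comm f (HahnSeries.C _), coeff_C_mul']
    congr 1
    have := HahnSeries.coeff_mul_single_add (r := (1 : ℂ)) (x := f) (a := n - 1) (b := (1 : ℤ))
    rw [sub_add_cancel, mul_one] at this
    exact this.symm
  have h0 : OrdGE 0 f := by
    obtain ⟨n, hn, hn'⟩ := exists_ordGE (Y := f) (by
      rw [hf]; exact (map_ne_zero _).2 (inv_ne_zero hX))
    refine hn.mono ?_
    by_contra hcon
    have := hc n
    rw [hn _ (by omega), zero_add, OrdGE.one n (by omega)] at this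
    exact mul_ne_zero ha hn' this
  refine ⟨h0, fun n => ?_⟩
  induction n with
  | zero =>
    have := hc 0
    rw [h0 _ (by omega), zero_add, ← HahnSeries.single_zero_one, HahnSeries.coeff_single_same]
      at this
    simp only [Nat.cast_zero, pow_zero, zero_add, pow_one]
    rw [eq_div_iff ha, mul_comm, this]
  | succ n ih =>
    have := hc ((n + 1 : ℕ) : ℤ)
    rw [show ((n + 1 : ℕ) : ℤ) - 1 = n by push_cast; ring, ih, ← HahnSeries.single_zero_one,
      HahnSeries.coeff_single_of_ne (by omega)] at this
    rw [eq_div_iff (pow_ne_zero _ ha)]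
    have h2 : (-1 : ℂ) ^ n / (α - ζ) ^ (n + 1) * (α - ζ) ^ (n + 1) = (-1) ^ n :=
      div_mul_cancel₀ _ (pow_ne_zero _ ha)
    rw [pow_succ (α - ζ) (n + 1), pow_succ (-1 : ℂ) n]
    linear_combination (α - ζ) ^ (n + 1) * this - h2

theorem expAt_inv_sq_of_ne {α ζ : ℂ} (h : α ≠ ζ) :
    OrdGE 0 (expAt α (((RatFunc.X - RatFunc.C ζ) ^ 2)⁻¹)) ∧
    ∀ n : ℕ, (expAt α (((RatFunc.X - RatFunc.C ζ) ^ 2)⁻¹)).coeff n =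
      (-1) ^ n * (n + 1) / (α - ζ) ^ (n + 2) := by
  obtain ⟨h1, h2⟩ := expAt_inv_of_ne h
  have e : expAt α (((RatFunc.X - RatFunc.C ζ) ^ 2)⁻¹) =
      -lderiv (expAt α ((RatFunc.X - RatFunc.C ζ)⁻¹)) := by
    rw [← expAt_ratDeriv, ratDeriv_inv_X_sub_C, map_neg, neg_neg]
  constructor
  · rw [← inv_pow, map_pow, pow_two]
    exact h1.mul h1
  · intro n
    have := h2 (n + 1)
    push_cast at this
    rw [e, HahnSeries.coeff_neg, coeff_lderiv, this]
    push_cast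
    ring

theorem expInf_inv_sq (ζ : ℂ) :
    OrdGE 2 (expInf (((RatFunc.X - RatFunc.C ζ) ^ 2)⁻¹)) ∧
      (expInf (((RatFunc.X - RatFunc.C ζ) ^ 2)⁻¹)).coeff 2 = 1 := by
  have hX := X_sub_C_ne_zero ζ
  have hY : OrdGE (-1) (expInf (RatFunc.X - RatFunc.C ζ)) ∧
      (expInf (RatFunc.X - RatFunc.C ζ)).coeff (-1) = 1 := by
    rw [map_sub, expInf_X, expInf_C]
    constructor
    · refine OrdGE.sub (fun i hi => HahnSeries.coeff_single_of_ne hi.ne) ((OrdGE.C ζ).mono (by omega))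
    · rw [HahnSeries.coeff_sub, OrdGE.C ζ _ (by omega), HahnSeries.coeff_single_same, sub_zero]
  obtain ⟨n, hn, hn'⟩ := exists_ordGE ((map_ne_zero expInf).2 (inv_ne_zero hX))
  have h1 := hn.coeff_mul hY.1
  rw [hY.2, mul_one, ← map_mul, inv_mul_cancel₀ hX, map_one] at h1
  have hn1 : n = 1 := by
    by_contra hne
    rw [← HahnSeries.single_zero_one, HahnSeries.coeff_single_of_ne (by omega)] at h1
    exact hn' h1.symm
  subst hn1
  have h2 : (expInf (RatFunc.X - RatFunc.C ζ)⁻¹).coeff 1 = 1 := by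
    rw [← h1, ← HahnSeries.single_zero_one]
    simp
  rw [← inv_pow, map_pow, pow_two]
  refine ⟨hn.mul hn, ?_⟩
  have := hn.coeff_mul hn
  rw [h2] at this
  simpa using this

/-! ### The locus conditions in terms of Laurent expansions -/

/-- The rational function `c - ∑ w_ℓ (z - ζ_ℓ)⁻²`. -/
def doublePoles {M : ℕ} (c : ℂ) (w ζ : Fin M → ℂ) : RatFunc ℂ :=
  RatFunc.C c - ∑ l, RatFunc.C (w l) / (RatFunc.X - RatFunc.C (ζ l)) ^ 2

theorem expAt_doublePoles {M : ℕ} (c : ℂ) (w ζ : Fin M → ℂ) (α : ℂ) :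
    expAt α (doublePoles c w ζ) = HahnSeries.C c -
      ∑ l, HahnSeries.C (w l) * expAt α (((RatFunc.X - RatFunc.C (ζ l)) ^ 2)⁻¹) := by
  simp only [doublePoles, map_sub, map_sum, div_eq_mul_inv, map_mul, expAt_C]

theorem ordGE_expAt_doublePoles {M : ℕ} (c : ℂ) (w ζ : Fin M → ℂ) {α : ℂ} (h : ∀ l, ζ l ≠ α) :
    OrdGE 0 (expAt α (doublePoles c w ζ)) := by
  rw [expAt_doublePoles]
  exact (OrdGE.C c).sub (OrdGE.sum _ fun l _ => (expAt_inv_sq_of_ne (h l).symm).1.C_mul _)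

/-- This is the dictionary between locus equations and Laurent coefficients: away from the double
pole at `ζ l`, the coefficient of index `2 k - 1` is `2 k` times the `k`-th locus sum. -/
theorem expAt_doublePoles_self {M : ℕ} (c : ℂ) (w : Fin M → ℂ) {ζ : Fin M → ℂ}
    (hζ : Function.Injective ζ) (l : Fin M) :
    ∃ r, expAt (ζ l) (doublePoles c w ζ) = HahnSeries.single (-2) (-w l) + r ∧ OrdGE 0 r ∧
      ∀ k : ℕ, 1 ≤ k → r.coeff (2 * k - 1) =
        2 * k * ∑ l' ∈ Finset.univ.erase l, w l' / (ζ l - ζ l') ^ (2 * k + 1) := by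
  have hne : ∀ l' ∈ Finset.univ.erase l, ζ l ≠ ζ l' := fun l' hl' h =>
    Finset.ne_of_mem_erase hl' (hζ h).symm
  refine ⟨HahnSeries.C c - ∑ l' ∈ Finset.univ.erase l,
    HahnSeries.C (w l') * expAt (ζ l) (((RatFunc.X - RatFunc.C (ζ l')) ^ 2)⁻¹), ?_, ?_, ?_⟩
  · rw [expAt_doublePoles, ← Finset.add_sum_erase _ _ (Finset.mem_univ l), expAt_inv_sq_self,
      HahnSeries.C_apply, HahnSeries.C_apply, HahnSeries.single_mul_single]
    simp only [zero_add, mul_one, HahnSeries.single_neg]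
    ring
  · exact (OrdGE.C c).sub (OrdGE.sum _ fun l' hl' =>
      (expAt_inv_sq_of_ne (hne l' hl')).1.C_mul _)
  · intro k hk
    obtain ⟨n, rfl⟩ := Nat.exists_eq_add_of_le' hk
    rw [HahnSeries.coeff_sub, HahnSeries.C_apply, HahnSeries.coeff_single_of_ne (by omega),
      HahnSeries.coeff_sum, Finset.mul_sum, zero_sub, ← Finset.sum_neg_distrib]
    refine Finset.sum_congr rfl fun l' hl' => ?_
    have := (expAt_inv_sq_of_ne (hne l' hl')).2 (2 * n + 1)
    rw [coeff_C_mul', show 2 * ((n + 1 : ℕ) : ℤ) - 1 = ((2 * n + 1 : ℕ) : ℤ) by push_cast; ring,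
      this, show 2 * n + 1 + 2 = 2 * (n + 1) + 1 by ring, pow_succ (-1 : ℂ), pow_mul]
    push_cast
    ring

theorem expInf_doublePoles {M : ℕ} (c : ℂ) (w ζ : Fin M → ℂ) :
    OrdGE 2 (expInf (doublePoles c w ζ - RatFunc.C c)) ∧
      (expInf (doublePoles c w ζ - RatFunc.C c)).coeff 2 = -∑ l, w l := by
  have e : expInf (doublePoles c w ζ - RatFunc.C c) =
      -∑ l, HahnSeries.C (w l) * expInf (((RatFunc.X - RatFunc.C (ζ l)) ^ 2)⁻¹) := by
    simp only [doublePoles, map_sub, map_sum, div_eq_mul_inv, map_mul, expInf_C]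
    ring
  rw [e]
  refine ⟨(OrdGE.sum _ fun l _ => (expInf_inv_sq (ζ l)).1.C_mul _).neg, ?_⟩
  rw [HahnSeries.coeff_neg, HahnSeries.coeff_sum]
  simp only [coeff_C_mul', (expInf_inv_sq _).2, mul_one]

section

variable {q : RatFunc ℂ} {qInf : ℂ} {M : ℕ} {s : Fin M → ℕ} {ζ : Fin M → ℂ}

theorem IsLocusData.eq_doublePoles (h : IsLocusData q qInf s ζ) :
    q = doublePoles qInf (fun l => (s l : ℂ) * (s l + 1)) ζ := h.eq

theorem IsLocusData.localCond (h : IsLocusData q qInf s ζ) (l : Fin M) :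
    LocalCond (expAt (ζ l) q) (s l) := by
  rw [h.eq_doublePoles]
  obtain ⟨r, hr, hr0, hc⟩ := expAt_doublePoles_self qInf (fun l => (s l : ℂ) * (s l + 1))
    h.distinct l
  rw [hr]
  refine ⟨OrdGE.add (fun i hi => HahnSeries.coeff_single_of_ne hi.ne) (hr0.mono (by omega)), ?_, ?_⟩
  · rw [HahnSeries.coeff_add, hr0 _ (by omega), HahnSeries.coeff_single_same, add_zero]
  · intro k hk
    rw [HahnSeries.coeff_add, HahnSeries.coeff_single_of_ne (by omega), zero_add]
    rcases Nat.eq_zero_or_pos k with rfl | hk0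
    · exact hr0 _ (by simp)
    · rw [hc k hk0, h.constraint l k (Finset.mem_Icc.2 ⟨hk0, hk⟩), mul_zero]

theorem IsLocusData.ordGE_expAt (h : IsLocusData q qInf s ζ) {α : ℂ} (hα : ∀ l, ζ l ≠ α) :
    OrdGE 0 (expAt α q) := by
  rw [h.eq_doublePoles]
  exact ordGE_expAt_doublePoles _ _ _ hα

theorem IsLocusData.expInf (h : IsLocusData q qInf s ζ) :
    OrdGE 2 (expInf (q - RatFunc.C qInf)) ∧ (expInf (q - RatFunc.C qInf)).coeff 2 =
      -((∑ l, s l * (s l + 1) : ℕ) : ℂ) := by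
  have := expInf_doublePoles qInf (fun l => (s l : ℂ) * (s l + 1)) ζ
  rw [← h.eq_doublePoles] at this
  refine ⟨this.1, this.2.trans ?_⟩
  push_cast
  rfl

/-- Subtracting the prescribed double poles leaves a rational function without poles, hence a
polynomial; being bounded at infinity it is the constant `q∞`. -/
theorem exists_isLocusData_of_localCond (hq : ∀ c : ℂ, q ≠ RatFunc.C c)
    (hloc : ∀ α, ∃ s, LocalCond (HalphenKdV.expAt α q) s) (hinf : OrdGE 0 (HalphenKdV.expInf q)) :
    ∃ (M : ℕ) (s : Fin M → ℕ) (qInf : ℂ) (ζ : Fin M → ℂ), IsLocusData q qInf s ζ := by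
  classical
  choose S hS using hloc
  set P := q.denom.roots.toFinset with hP
  set ζ : Fin P.card → ℂ := fun l => (P.equivFin.symm l : ℂ) with hζ
  have hinj : Function.Injective ζ :=
    Subtype.val_injective.comp P.equivFin.symm.injective
  have hmem : ∀ l, q.denom.eval (ζ l) = 0 := by
    intro l
    have : ζ l ∈ P := (P.equivFin.symm l).2
    rw [hP, Multiset.mem_toFinset] at this
    exact (Polynomial.mem_roots'.1 this).2
  have hsurj : ∀ α, q.denom.eval α = 0 → ∃ l, ζ l = α := by
    intro α hα
    have : α ∈ P := by
      rw [hP, Multiset.mem_toFinset]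
      exact Polynomial.mem_roots'.2 ⟨q.denom_ne_zero, hα⟩
    exact ⟨P.equivFin ⟨α, this⟩, by simp [hζ]⟩
  set w : Fin P.card → ℂ := fun l => (S (ζ l) : ℂ) * (S (ζ l) + 1) with hw
  obtain ⟨p, hp⟩ := exists_polynomial_of_ordGE (f := q - doublePoles 0 w ζ) (by
    intro α
    rw [map_sub]
    by_cases hα : q.denom.eval α = 0
    · obtain ⟨l, rfl⟩ := hsurj α hα
      obtain ⟨r, hr, hr0, -⟩ := expAt_doublePoles_self 0 w hinj l
      rw [hr]
      have h1 := hS (ζ l)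
      have h2 : OrdGE (-2) (HalphenKdV.expAt (ζ l) q - (HahnSeries.single (-2) (-w l) + r)) :=
        h1.ordGE.sub (OrdGE.add (fun i hi => HahnSeries.coeff_single_of_ne hi.ne)
          (hr0.mono (by omega)))
      have h3 := h2.succ (by
        rw [HahnSeries.coeff_sub, HahnSeries.coeff_add, hr0 _ (by omega),
          HahnSeries.coeff_single_same, h1.lead, add_zero, hw, sub_self])
      -- The residue vanishes by the case `k = 0` of the local condition.
      have h4 := h3.succ (by
        have := h1.odd 0 (by omega)
        simp only [Nat.cast_zero, mul_zero, zero_sub] at this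
        rw [HahnSeries.coeff_sub, HahnSeries.coeff_add, hr0 _ (by omega),
          HahnSeries.coeff_single_of_ne (by omega), show (-2 : ℤ) + 1 = -1 by norm_num, this]
        ring)
      exact h4.mono (by omega)
    · exact (ordGE_expAt_of_eval_denom_ne_zero hα).sub (ordGE_expAt_doublePoles _ _ _ (by
        rintro l rfl
        exact hα (hmem l))))
  have hpc : p = Polynomial.C (p.coeff 0) := by
    ext n
    rw [Polynomial.coeff_C]
    split_ifs with h
    · rw [h]
    · have h1 := expInf_doublePoles 0 w ζ
      rw [map_zero, sub_zero] at h1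
      rw [← coeff_expInf_algebraMap, ← hp, map_sub]
      exact (hinf.sub (h1.1.mono (by omega))) _ (by omega)
  have hqe : q = doublePoles (p.coeff 0) w ζ := by
    have h1 : q = algebraMap ℂ[X] (RatFunc ℂ) p + doublePoles 0 w ζ := by
      rw [← hp]; ring
    rw [hpc, RatFunc.algebraMap_C] at h1
    rw [h1]
    simp only [doublePoles, map_zero]
    ring
  refine ⟨P.card, fun l => S (ζ l), p.coeff 0, ζ, ?_, ?_, hinj, hqe, ?_⟩
  · rw [Nat.one_le_iff_ne_zero]
    intro h0
    apply hq (p.coeff 0)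
    have : IsEmpty (Fin P.card) := by rw [h0]; infer_instance
    conv_lhs => rw [hqe, doublePoles, Finset.univ_eq_empty, Finset.sum_empty, sub_zero]
  · intro l
    rw [Nat.one_le_iff_ne_zero]
    intro h0
    have h1 := hS (ζ l)
    rw [h0] at h1
    -- For `s = 0` the coefficients of index `-2` and `-1` both vanish, and the root of the
    -- denominator would not be a pole.
    have h2 := h1.ordGE.succ (by rw [h1.lead]; simp)
    have h3 := h2.succ (by simpa using h1.odd 0 le_rfl)
    exact eval_denom_ne_zero_of_ordGE (h3.mono (by omega)) (hmem l)
  · intro l k hk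
    rw [Finset.mem_Icc] at hk
    obtain ⟨r, hr, hr0, hc⟩ := expAt_doublePoles_self (p.coeff 0) w hinj l
    have h1 := (hS (ζ l)).odd k hk.2
    rw [hqe, hr, HahnSeries.coeff_add, HahnSeries.coeff_single_of_ne (by omega), zero_add,
      hc k hk.1] at h1
    refine (mul_eq_zero.1 h1).resolve_left ?_
    exact_mod_cast (by omega : 2 * k ≠ 0)

end

/-! ### KdV sequences of rational functions -/

/-- The operator `f ↦ f''' / 4 + q f' + q' f / 2` on rational functions. -/
def ratKdvOp (q f : RatFunc ℂ) : RatFunc ℂ :=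
  RatFunc.C (1 / 4) * ratDeriv (ratDeriv (ratDeriv f)) + q * ratDeriv f +
    RatFunc.C (1 / 2) * ratDeriv q * f

theorem expAt_ratKdvOp (α : ℂ) (q f : RatFunc ℂ) :
    expAt α (ratKdvOp q f) = kdvOp (expAt α q) (expAt α f) := by
  simp only [ratKdvOp, kdvOp, map_add, map_mul, expAt_C, expAt_ratDeriv]

/-- The KdV operator in the coordinate `1/z` at infinity. -/
def infKdvOp (q f : ℂ⸨X⸩) : ℂ⸨X⸩ :=
  HahnSeries.C (1 / 4) * infDeriv (infDeriv (infDeriv f)) +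
    (q * infDeriv f + HahnSeries.C (1 / 2) * infDeriv q * f)

theorem expInf_ratKdvOp (q f : RatFunc ℂ) :
    expInf (ratKdvOp q f) = infKdvOp (expInf q) (expInf f) := by
  simp only [ratKdvOp, infKdvOp, map_add, map_mul, expInf_C, expInf_ratDeriv]
  ring

theorem ordGE_infKdvOp_cross {m n : ℤ} {q f : ℂ⸨X⸩} (hq : OrdGE m q) (hf : OrdGE n f) :
    OrdGE (m + n + 1) (q * infDeriv f + HahnSeries.C (1 / 2) * infDeriv q * f) := by
  have h1 := hq.mul hf.infDeriv
  have h2 := (hq.infDeriv.C_mul (1 / 2)).mul hf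
  exact (h1.mono (by omega)).add (h2.mono (by omega))

theorem coeff_infKdvOp_cross {m n : ℤ} {q f : ℂ⸨X⸩} (hq : OrdGE m q) (hf : OrdGE n f) :
    (q * infDeriv f + HahnSeries.C (1 / 2) * infDeriv q * f).coeff (m + n + 1) =
      -(n + m / 2) * (q.coeff m * f.coeff n) := by
  have h1 := hq.coeff_mul hf.infDeriv
  have h2 := (hq.infDeriv.C_mul (1 / 2)).coeff_mul hf
  rw [coeff_infDeriv] at h1
  rw [coeff_C_mul', coeff_infDeriv] at h2
  rw [HahnSeries.coeff_add, show m + n + 1 = m + (n + 1) by ring, h1,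
    show m + (n + 1) = m + 1 + n by ring, h2]
  ring

/-- The indicial polynomial at infinity: when `q.coeff 2 = -g (g + 1)`, its roots are `-1`, `2 g`
and `-2 g - 2`. -/
theorem coeff_infKdvOp {n : ℤ} {q f : ℂ⸨X⸩} (hq : OrdGE 2 q) (hf : OrdGE n f) :
    (infKdvOp q f).coeff (n + 3) =
      -((n + 1) * (n * (n + 2) / 4 + q.coeff 2)) * f.coeff n := by
  have h := coeff_infKdvOp_cross hq hf
  rw [infKdvOp, HahnSeries.coeff_add, coeff_C_mul', show n + 3 = n + 1 + 1 + 1 by ring,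
    coeff_infDeriv, coeff_infDeriv, coeff_infDeriv, show n + 1 + 1 + 1 = 2 + n + 1 by ring, h]
  push_cast
  ring

theorem IsKdVSequence.ratDeriv_last {q : RatFunc ℂ} {g : ℕ} {f : ℕ → RatFunc ℂ}
    (h : IsKdVSequence q g f) : ratDeriv (f (g + 1)) = 0 :=
  (mul_eq_zero.1 h.kdv).resolve_left two_ne_zero

theorem IsKdVSequence.step {q : RatFunc ℂ} {g : ℕ} {f : ℕ → RatFunc ℂ}
    (h : IsKdVSequence q g f) {j : ℕ} (hj : j ≤ g) : ratDeriv (f (j + 1)) = ratKdvOp q (f j) :=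
  h.succ j hj

/-- A rational KdV potential is bounded at infinity. -/
theorem IsKdVSequence.ordGE_expInf {q : RatFunc ℂ} {g : ℕ} {f : ℕ → RatFunc ℂ}
    (h : IsKdVSequence q g f) : OrdGE 0 (expInf q) := by
  by_contra hcon
  have hq0 : expInf q ≠ 0 := by
    intro h0
    exact hcon (h0 ▸ OrdGE.zero _)
  obtain ⟨m, hm, hm'⟩ := exists_ordGE hq0
  have hm0 : m < 0 := by
    by_contra h0
    exact hcon (hm.mono (by omega))
  -- If `q` has order `m < 0` at infinity, the terms with `q` dominate and `f_j` has order exactly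
  -- `m j`, as the factor `m j + m / 2` never vanishes.
  have key : ∀ j : ℕ, j ≤ g + 1 →
      OrdGE (m * j) (expInf (f j)) ∧ (expInf (f j)).coeff (m * j) ≠ 0 := by
    intro j
    induction j with
    | zero =>
      intro _
      simp only [Nat.cast_zero, mul_zero, h.zero, map_one]
      exact ⟨OrdGE.one, by simp⟩
    | succ j ih =>
      intro hj
      obtain ⟨h1, h2⟩ := ih (by omega)
      have e := congrArg expInf (h.step (j := j) (by omega))
      rw [expInf_ratDeriv, expInf_ratKdvOp, infKdvOp] at e
      have h3 := (h1.infDeriv.infDeriv.infDeriv.C_mul (1 / 4))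
      have h4 := ordGE_infKdvOp_cross hm h1
      have e1 : m * ((j + 1 : ℕ) : ℤ) = m + m * j := by push_cast; ring
      have h5 : OrdGE (m + m * j + 1) (infDeriv (expInf (f (j + 1)))) := by
        rw [e]
        exact (h3.mono (by omega)).add h4
      have hneg : m * (j : ℤ) ≤ 0 := mul_nonpos_of_nonpos_of_nonneg hm0.le (by positivity)
      rw [e1]
      constructor
      · intro i hi
        have h6 := coeff_infDeriv (expInf (f (j + 1))) i
        rw [h5 _ (by omega)] at h6
        refine (mul_eq_zero.1 h6.symm).resolve_left ?_
        exact_mod_cast (by omega : -i ≠ 0)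
      · intro h7
        have h8 := coeff_infDeriv (expInf (f (j + 1))) (m + m * j)
        rw [h7, mul_zero, e, HahnSeries.coeff_add, h3 _ (by omega), coeff_infKdvOp_cross hm h1,
          zero_add] at h8
        have h9 : -(((m * (j : ℤ) : ℤ) : ℂ) + (m : ℂ) / 2) ≠ 0 := by
          intro h
          have h' : ((2 * (m * (j : ℤ)) + m : ℤ) : ℂ) = 0 := by
            push_cast at h ⊢; linear_combination -2 * h
          have h'' : 2 * (m * (j : ℤ)) + m = 0 := by exact_mod_cast h'
          omega
        exact mul_ne_zero h9 (mul_ne_zero hm' h2) h8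
  obtain ⟨-, h1⟩ := key (g + 1) le_rfl
  have h2 := coeff_infDeriv (expInf (f (g + 1))) (m * ((g + 1 : ℕ) : ℤ))
  rw [← expInf_ratDeriv, h.ratDeriv_last, map_zero, HahnSeries.coeff_zero] at h2
  refine mul_ne_zero ?_ h1 h2.symm
  have : m * ((g + 1 : ℕ) : ℤ) < 0 := mul_neg_of_neg_of_pos hm0 (by positivity)
  exact_mod_cast (by omega : -(m * ((g + 1 : ℕ) : ℤ)) ≠ 0)

theorem IsKdVSequence.localCond {q : RatFunc ℂ} {g : ℕ} {f : ℕ → RatFunc ℂ}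
    (h : IsKdVSequence q g f) (α : ℂ) : ∃ s, LocalCond (expAt α q) s := by
  refine localCond_of_kdv (g := g) (f := fun j => expAt α (f j)) ?_ ?_ ?_
  · simp only [h.zero, map_one]
  · intro j hj
    rw [← expAt_ratDeriv, h.step hj, expAt_ratKdvOp]
  · rw [← expAt_ratDeriv, h.ratDeriv_last, map_zero]

theorem IsKdVPotential.exists_isLocusData {q : RatFunc ℂ} (hq : ∀ c : ℂ, q ≠ RatFunc.C c)
    (h : IsKdVPotential q) :
    ∃ (M : ℕ) (s : Fin M → ℕ) (qInf : ℂ) (ζ : Fin M → ℂ), IsLocusData q qInf s ζ := by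
  obtain ⟨g, f, hf⟩ := h
  exact exists_isLocusData_of_localCond hq hf.localCond hf.ordGE_expInf

/-! ### The homogeneous KdV sequence -/

/-- The coefficients of the formal series `F = 1 + f₁ w + f₂ w² + ⋯` with
`F² = 1 + w (F'' F / 2 - F'² / 4 + q F²)`. -/
def kdvSeq (q : RatFunc ℂ) : ℕ → RatFunc ℂ
  | 0 => 1
  | n + 1 => RatFunc.C (1 / 2) *
      (∑ i : Fin (n + 1),
          (RatFunc.C (1 / 2) * ratDeriv (ratDeriv (kdvSeq q i.1)) * kdvSeq q (n - i.1) -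
            RatFunc.C (1 / 4) * (ratDeriv (kdvSeq q i.1) * ratDeriv (kdvSeq q (n - i.1))) +
            q * (kdvSeq q i.1 * kdvSeq q (n - i.1))) -
        ∑ i : Fin n, kdvSeq q (i.1 + 1) * kdvSeq q (n - i.1))
  termination_by n => n
  decreasing_by all_goals omega

theorem kdvSeq_zero (q : RatFunc ℂ) : kdvSeq q 0 = 1 := by rw [kdvSeq]

theorem kdvSeq_succ (q : RatFunc ℂ) (n : ℕ) :
    kdvSeq q (n + 1) = RatFunc.C (1 / 2) *
      (∑ i ∈ Finset.range (n + 1),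
          (RatFunc.C (1 / 2) * ratDeriv (ratDeriv (kdvSeq q i)) * kdvSeq q (n - i) -
            RatFunc.C (1 / 4) * (ratDeriv (kdvSeq q i) * ratDeriv (kdvSeq q (n - i))) +
            q * (kdvSeq q i * kdvSeq q (n - i))) -
        ∑ i ∈ Finset.range n, kdvSeq q (i + 1) * kdvSeq q (n - i)) := by
  rw [kdvSeq, Finset.sum_range, Finset.sum_range]

/-- Coefficientwise derivative `d/dz` of a power series over the rational functions. -/
def seriesDeriv (F : PowerSeries (RatFunc ℂ)) : PowerSeries (RatFunc ℂ) :=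
  PowerSeries.mk fun n => ratDeriv (PowerSeries.coeff n F)

theorem coeff_seriesDeriv (F : PowerSeries (RatFunc ℂ)) (n : ℕ) :
    PowerSeries.coeff n (seriesDeriv F) = ratDeriv (PowerSeries.coeff n F) := by
  rw [seriesDeriv, PowerSeries.coeff_mk]

theorem ratDeriv_sum {ι : Type*} (S : Finset ι) (f : ι → RatFunc ℂ) :
    ratDeriv (∑ i ∈ S, f i) = ∑ i ∈ S, ratDeriv (f i) := by
  classical
  induction S using Finset.induction_on with
  | empty => simp [ratDeriv_zero]
  | insert a S ha ih => rw [Finset.sum_insert ha, Finset.sum_insert ha, ratDeriv_add, ih]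

theorem seriesDeriv_add (F G : PowerSeries (RatFunc ℂ)) :
    seriesDeriv (F + G) = seriesDeriv F + seriesDeriv G := by
  ext n; simp only [coeff_seriesDeriv, map_add, ratDeriv_add]

theorem seriesDeriv_sub (F G : PowerSeries (RatFunc ℂ)) :
    seriesDeriv (F - G) = seriesDeriv F - seriesDeriv G := by
  ext n; simp only [coeff_seriesDeriv, map_sub, ratDeriv_sub]

theorem seriesDeriv_mul (F G : PowerSeries (RatFunc ℂ)) :
    seriesDeriv (F * G) = seriesDeriv F * G + F * seriesDeriv G := by
  ext n
  simp only [coeff_seriesDeriv, map_add, PowerSeries.coeff_mul, ratDeriv_sum, ratDeriv_mul,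
    Finset.sum_add_distrib]

theorem seriesDeriv_C (f : RatFunc ℂ) :
    seriesDeriv (PowerSeries.C f) = PowerSeries.C (ratDeriv f) := by
  ext n
  rw [coeff_seriesDeriv, PowerSeries.coeff_C, PowerSeries.coeff_C]
  split_ifs
  · rfl
  · exact ratDeriv_zero

theorem seriesDeriv_X : seriesDeriv (PowerSeries.X : PowerSeries (RatFunc ℂ)) = 0 := by
  ext n
  rw [coeff_seriesDeriv, PowerSeries.coeff_X]
  split_ifs
  · simp [ratDeriv_one]
  · simp [ratDeriv_zero]

theorem seriesDeriv_one : seriesDeriv (1 : PowerSeries (RatFunc ℂ)) = 0 := by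
  rw [← map_one PowerSeries.C, seriesDeriv_C, ratDeriv_one, map_zero]

/-- In degree `n + 1` the two end terms of `F * F` add up to `2 f_{n+1}`, and the defining recursion
is solved for it. The constant `1` fixes all integration constants, so no antiderivative has to be
found. -/
theorem kdvSeries_quadratic (q : RatFunc ℂ) {F : PowerSeries (RatFunc ℂ)}
    (hF : F = PowerSeries.mk (kdvSeq q)) :
    F * F = 1 + PowerSeries.X * (PowerSeries.C (RatFunc.C (1 / 2)) *
        (seriesDeriv (seriesDeriv F) * F) -
      PowerSeries.C (RatFunc.C (1 / 4)) * (seriesDeriv F * seriesDeriv F) +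
      PowerSeries.C q * (F * F)) := by
  have hc : ∀ n, PowerSeries.coeff n F = kdvSeq q n := fun n => by rw [hF, PowerSeries.coeff_mk]
  ext n
  rcases n with _ | n
  · simp only [map_add, PowerSeries.coeff_zero_eq_constantCoeff, map_mul, map_one,
      PowerSeries.constantCoeff_X, zero_mul, add_zero]
    rw [← PowerSeries.coeff_zero_eq_constantCoeff_apply, hc, kdvSeq_zero, one_mul]
  · rw [map_add, PowerSeries.coeff_succ_X_mul, PowerSeries.coeff_one, if_neg (by omega), zero_add,
      map_add, map_sub, PowerSeries.coeff_C_mul, PowerSeries.coeff_C_mul, PowerSeries.coeff_C_mul]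
    simp only [PowerSeries.coeff_mul, coeff_seriesDeriv, hc]
    rw [Finset.Nat.sum_antidiagonal_eq_sum_range_succ (fun i j => kdvSeq q i * kdvSeq q j),
      Finset.Nat.sum_antidiagonal_eq_sum_range_succ
        (fun i j => ratDeriv (ratDeriv (kdvSeq q i)) * kdvSeq q j),
      Finset.Nat.sum_antidiagonal_eq_sum_range_succ
        (fun i j => ratDeriv (kdvSeq q i) * ratDeriv (kdvSeq q j)),
      Finset.Nat.sum_antidiagonal_eq_sum_range_succ (fun i j => kdvSeq q i * kdvSeq q j),
      Finset.sum_range_succ, Finset.sum_range_succ']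
    have h2 : (2 : RatFunc ℂ) * RatFunc.C (1 / 2) = 1 := by
      rw [← map_ofNat RatFunc.C 2, ← map_mul]; norm_num
    have h := kdvSeq_succ q n
    simp only [Finset.sum_add_distrib, Finset.sum_sub_distrib] at h
    simp only [mul_assoc, ← Finset.mul_sum] at h
    simp only [Nat.sub_self, Nat.sub_zero, kdvSeq_zero, one_mul, mul_one]
    have h3 : ∑ k ∈ Finset.range n, kdvSeq q (k + 1) * kdvSeq q (n + 1 - (k + 1)) =
        ∑ k ∈ Finset.range n, kdvSeq q (k + 1) * kdvSeq q (n - k) :=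
      Finset.sum_congr rfl fun k _ => by rw [Nat.add_sub_add_right]
    rw [h3]
    linear_combination 2 * h + (RatFunc.C (1 / 2) *
      ∑ i ∈ Finset.range (n + 1), ratDeriv (ratDeriv (kdvSeq q i)) * kdvSeq q (n - i) -
      RatFunc.C (1 / 4) *
        ∑ i ∈ Finset.range (n + 1), ratDeriv (kdvSeq q i) * ratDeriv (kdvSeq q (n - i)) +
      q * ∑ i ∈ Finset.range (n + 1), kdvSeq q i * kdvSeq q (n - i) -
      ∑ k ∈ Finset.range n, kdvSeq q (k + 1) * kdvSeq q (n - k)) * h2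

/-- The sequence satisfies the KdV recursion. -/
theorem ratDeriv_kdvSeq_succ (q : RatFunc ℂ) (n : ℕ) :
    ratDeriv (kdvSeq q (n + 1)) = ratKdvOp q (kdvSeq q n) := by
  set F := PowerSeries.mk (kdvSeq q) with hF
  have hc : ∀ n, PowerSeries.coeff n F = kdvSeq q n := fun n => by rw [hF, PowerSeries.coeff_mk]
  have hF0 : F ≠ 0 := by
    intro h
    have := hc 0
    rw [h, map_zero, kdvSeq_zero] at this
    exact zero_ne_one this
  have h2 : (2 : RatFunc ℂ) * RatFunc.C (1 / 2) = 1 := by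
    rw [← map_ofNat RatFunc.C 2, ← map_mul]; norm_num
  have h4 : (2 : RatFunc ℂ) * RatFunc.C (1 / 4) = RatFunc.C (1 / 2) := by
    rw [← map_ofNat RatFunc.C 2, ← map_mul]; norm_num
  have h4' : (2 : PowerSeries (RatFunc ℂ)) * PowerSeries.C (RatFunc.C (1 / 4)) =
      PowerSeries.C (RatFunc.C (1 / 2)) := by
    rw [← map_ofNat (PowerSeries.C) 2, ← map_mul, h4]
  have h1 := congrArg seriesDeriv (kdvSeries_quadratic q hF)
  simp only [seriesDeriv_add, seriesDeriv_mul, seriesDeriv_sub, seriesDeriv_C, seriesDeriv_X,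
    seriesDeriv_one, ratDeriv_C, map_zero, zero_mul, zero_add] at h1
  have h3 : 2 * seriesDeriv F = PowerSeries.X * (PowerSeries.C (RatFunc.C (1 / 2)) *
      seriesDeriv (seriesDeriv (seriesDeriv F)) + PowerSeries.C (ratDeriv q) * F +
        2 * (PowerSeries.C q * seriesDeriv F)) := by
    -- Differentiating the quadratic identity cancels the products `F' F''`, and every remaining
    -- term is a multiple of `F`.
    apply mul_left_cancel₀ hF0
    linear_combination h1 +
      PowerSeries.X * seriesDeriv F * seriesDeriv (seriesDeriv F) * (-h4')
  have h5 := congrArg (PowerSeries.coeff (n + 1)) h3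
  rw [PowerSeries.coeff_succ_X_mul, ← map_ofNat (PowerSeries.C) 2, map_add, map_add,
    PowerSeries.coeff_C_mul, PowerSeries.coeff_C_mul, PowerSeries.coeff_C_mul,
    PowerSeries.coeff_C_mul, PowerSeries.coeff_C_mul] at h5
  simp only [coeff_seriesDeriv, hc] at h5
  have h5' : RatFunc.C (1 / 2) * RatFunc.C (1 / 2) = (RatFunc.C (1 / 4) : RatFunc ℂ) := by
    rw [← map_mul]; norm_num
  rw [ratKdvOp]
  linear_combination RatFunc.C (1 / 2) * h5 + (ratDeriv (kdvSeq q (n + 1)) -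
    q * ratDeriv (kdvSeq q n)) * (-h2) +
    ratDeriv (ratDeriv (ratDeriv (kdvSeq q n))) * h5'

/-! ### Termination of the homogeneous sequence on the locus -/

/-- The polynomial `∏ (z - ζ_ℓ) ^ s_ℓ`. -/
def locusPoly {M : ℕ} (s : Fin M → ℕ) (ζ : Fin M → ℂ) : ℂ[X] :=
  ∏ l, (Polynomial.X - Polynomial.C (ζ l)) ^ s l

theorem monic_locusPoly {M : ℕ} (s : Fin M → ℕ) (ζ : Fin M → ℂ) : (locusPoly s ζ).Monic :=
  Polynomial.monic_prod_of_monic _ _ fun l _ => (Polynomial.monic_X_sub_C (ζ l)).pow (s l)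

theorem natDegree_locusPoly {M : ℕ} (s : Fin M → ℕ) (ζ : Fin M → ℂ) :
    (locusPoly s ζ).natDegree = ∑ l, s l := by
  rw [locusPoly, Polynomial.natDegree_prod_of_monic _ _
    fun l _ => (Polynomial.monic_X_sub_C (ζ l)).pow (s l)]
  simp

theorem expAt_locusPoly {M : ℕ} (s : Fin M → ℕ) {ζ : Fin M → ℂ} (hζ : Function.Injective ζ)
    (l : Fin M) : OrdGE (s l) (expAt (ζ l) (algebraMap ℂ[X] (RatFunc ℂ) (locusPoly s ζ))) ∧
      (expAt (ζ l) (algebraMap ℂ[X] (RatFunc ℂ) (locusPoly s ζ))).coeff (s l) ≠ 0 := by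
  set T := ∏ l' ∈ Finset.univ.erase l, (Polynomial.X - Polynomial.C (ζ l')) ^ s l' with hT
  have e : locusPoly s ζ = (Polynomial.X - Polynomial.C (ζ l)) ^ s l * T :=
    (Finset.mul_prod_erase _ _ (Finset.mem_univ l)).symm
  have hT0 : T.eval (ζ l) ≠ 0 := by
    rw [hT, Polynomial.eval_prod, Finset.prod_ne_zero_iff]
    intro l' hl'
    rw [Polynomial.eval_pow, Polynomial.eval_sub, Polynomial.eval_X, Polynomial.eval_C]
    exact pow_ne_zero _ (sub_ne_zero.2 fun h => Finset.ne_of_mem_erase hl' (hζ h).symm)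
  have e2 : expAt (ζ l) (algebraMap ℂ[X] (RatFunc ℂ) (locusPoly s ζ)) =
      HahnSeries.single (s l : ℤ) 1 * expAt (ζ l) (algebraMap ℂ[X] (RatFunc ℂ) T) := by
    rw [e, map_mul, map_mul, map_pow, map_pow, map_sub, RatFunc.algebraMap_X,
      RatFunc.algebraMap_C, expAt_X_sub_C, sub_self, map_zero, add_zero, HahnSeries.single_pow]
    simp
  have h1 : OrdGE (s l) (HahnSeries.single (s l : ℤ) (1 : ℂ)) := fun i hi =>
    HahnSeries.coeff_single_of_ne hi.ne
  have h2 := ordGE_expAt_algebraMap (ζ l) T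
  rw [e2]
  refine ⟨(h1.mul h2).mono (by omega), ?_⟩
  have h3 := h1.coeff_mul h2
  rw [add_zero] at h3
  rw [h3, HahnSeries.coeff_single_same, one_mul, coeff_zero_expAt_algebraMap]
  exact hT0

theorem IsLocusData.sub_C {q : RatFunc ℂ} {qInf : ℂ} {M : ℕ} {s : Fin M → ℕ} {ζ : Fin M → ℂ}
    (h : IsLocusData q qInf s ζ) : IsLocusData (q - RatFunc.C qInf) 0 s ζ where
  pos := h.pos
  s_pos := h.s_pos
  distinct := h.distinct
  eq := by rw [h.eq, map_zero]; ring
  constraint := h.constraint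

theorem mul_self_succ_injective : Function.Injective fun n : ℕ => n * (n + 1) := by
  intro a b h
  simp only at h
  rcases lt_trichotomy a b with h1 | h1 | h1
  · nlinarith
  · exact h1
  · nlinarith

section

variable {q : RatFunc ℂ}

/-- A weight count: `q` vanishes to order two at infinity, each derivative raises the order by one,
and the recursion is homogeneous of weight `2 n`. -/
theorem ordGE_expInf_kdvSeq (hq : OrdGE 2 (expInf q)) (n : ℕ) :
    OrdGE (2 * n) (expInf (kdvSeq q n)) := by
  induction n using Nat.strong_induction_on with
  | _ n ih =>
    rcases n with _ | n
    · rw [kdvSeq_zero, map_one]; simpa using OrdGE.one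
    · rw [kdvSeq_succ, map_mul, expInf_C, map_sub, map_sum, map_sum]
      refine OrdGE.C_mul _ (OrdGE.sub (OrdGE.sum _ fun i hi => ?_) (OrdGE.sum _ fun i hi => ?_))
      · rw [Finset.mem_range] at hi
        have h1 := ih i (by omega)
        have h2 := ih (n - i) (by omega)
        simp only [map_add, map_sub, map_mul, expInf_C, expInf_ratDeriv]
        exact (((h1.infDeriv.infDeriv.C_mul _).mul h2).mono (by push_cast; omega)).sub
          (((h1.infDeriv.mul h2.infDeriv).C_mul _).mono (by push_cast; omega)) |>.add
          ((hq.mul (h1.mul h2)).mono (by push_cast; omega))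
      · rw [Finset.mem_range] at hi
        have h1 := ih (i + 1) (by omega)
        have h2 := ih (n - i) (by omega)
        rw [map_mul]
        exact (h1.mul h2).mono (by push_cast; omega)

theorem kdvSeq_lead (hq : OrdGE 2 (expInf q)) (n : ℕ) :
    (2 * (n : ℂ) + 2) * (expInf (kdvSeq q (n + 1))).coeff (2 * ((n + 1 : ℕ) : ℤ)) =
      (2 * n + 1) * (n * (n + 1) + (expInf q).coeff 2) * (expInf (kdvSeq q n)).coeff (2 * n) := by
  have h1 := coeff_infKdvOp hq (ordGE_expInf_kdvSeq hq n)
  have h2 := coeff_infDeriv (expInf (kdvSeq q (n + 1))) (2 * ((n + 1 : ℕ) : ℤ))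
  rw [← expInf_ratKdvOp, ← ratDeriv_kdvSeq_succ, expInf_ratDeriv,
    show 2 * (n : ℤ) + 3 = 2 * ((n + 1 : ℕ) : ℤ) + 1 by push_cast; ring, h2] at h1
  push_cast at h1 ⊢
  linear_combination -h1

/-- If `f_{n+1}` vanished, the order `k` of `f_n` at infinity would be an indicial root `-1`, `2 g`
or `-2 g - 2`; but `k ≥ 2 n > 2 g`. -/
theorem kdvSeq_succ_ne_zero (hq : OrdGE 2 (expInf q)) {g n : ℕ}
    (hlead : (expInf q).coeff 2 = -((g * (g + 1) : ℕ) : ℂ)) (hgn : g < n)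
    (hn : kdvSeq q n ≠ 0) : kdvSeq q (n + 1) ≠ 0 := by
  intro h0
  obtain ⟨k, hk, hk'⟩ := exists_ordGE ((map_ne_zero expInf).2 hn)
  have hnk : 2 * (n : ℤ) ≤ k := by
    by_contra h
    exact hk' (ordGE_expInf_kdvSeq hq n k (by omega))
  have h1 := coeff_infKdvOp hq hk
  rw [← expInf_ratKdvOp, ← ratDeriv_kdvSeq_succ, h0, ratDeriv_zero, map_zero,
    HahnSeries.coeff_zero, hlead] at h1
  have h2 : (((k + 1) * (k - 2 * g) * (k + 2 * g + 2) : ℤ) : ℂ) * (expInf (kdvSeq q n)).coeff k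
      = 0 := by
    push_cast at h1 ⊢
    linear_combination 4 * h1
  rcases mul_eq_zero.1 h2 with h3 | h3
  · have h4 : (k + 1) * (k - 2 * g) * (k + 2 * g + 2) = 0 := by exact_mod_cast h3
    have h5 : 0 < k + 1 := by omega
    have h6 : 0 < k - 2 * g := by omega
    have h7 : 0 < k + 2 * g + 2 := by omega
    exact absurd h4 (by positivity)
  · exact hk' h3

variable {M : ℕ} {s : Fin M → ℕ} {ζ : Fin M → ℂ}

theorem IsLocusData.evenPole_kdvSeq {qInf : ℂ} (h : IsLocusData q qInf s ζ) (l : Fin M) (n : ℕ) :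
    EvenPole (s l) (expAt (ζ l) (kdvSeq q n)) := by
  induction n with
  | zero =>
    rw [kdvSeq_zero, map_one]
    refine ⟨OrdGE.one.mono (by omega), fun i hi _ => OrdGE.one i hi⟩
  | succ n ih =>
    refine (h.localCond l).evenPole ih ?_
    rw [← expAt_ratDeriv, ratDeriv_kdvSeq_succ, expAt_ratKdvOp]

theorem IsLocusData.ordGE_kdvSeq {qInf : ℂ} (h : IsLocusData q qInf s ζ) {α : ℂ}
    (hα : ∀ l, ζ l ≠ α) (n : ℕ) : OrdGE 0 (HalphenKdV.expAt α (kdvSeq q n)) := by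
  have hq := h.ordGE_expAt hα
  have hd : ∀ f : ℂ⸨X⸩, OrdGE 0 f → OrdGE 0 (lderiv f) := by
    intro f hf i hi
    rw [coeff_lderiv]
    rcases (show i + 1 < 0 ∨ i = -1 by omega) with h1 | rfl
    · rw [hf _ h1, mul_zero]
    · push_cast; ring
  induction n with
  | zero => rw [kdvSeq_zero, map_one]; exact OrdGE.one
  | succ n ih =>
    have h1 : OrdGE 0 (lderiv (HalphenKdV.expAt α (kdvSeq q (n + 1)))) := by
      rw [← expAt_ratDeriv, ratDeriv_kdvSeq_succ, expAt_ratKdvOp, kdvOp]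
      exact (((hd _ (hd _ (hd _ ih))).C_mul _).add (hq.mul (hd _ ih))).add
        (((hd _ hq).C_mul _).mul ih)
    intro i hi
    exact coeff_eq_zero_of_coeff_lderiv hi.ne (h1 _ (by omega))

/-- The poles of `f_n` have order at most `2 s_ℓ` whatever `n` is. Clearing them leaves a polynomial
whose degree would be at most `2 ∑ s_ℓ - 2 n < 0`. -/
theorem IsLocusData.kdvSeq_eq_zero_of_lt (h : IsLocusData q 0 s ζ) {n : ℕ} (hn : ∑ l, s l < n) :
    kdvSeq q n = 0 := by
  set Q := algebraMap ℂ[X] (RatFunc ℂ) (locusPoly s ζ) with hQ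
  have hQ0 : Q ≠ 0 := RatFunc.algebraMap_ne_zero (monic_locusPoly s ζ).ne_zero
  obtain ⟨p, hp⟩ := exists_polynomial_of_ordGE (f := Q * Q * kdvSeq q n) (by
    intro α
    rw [map_mul, map_mul]
    by_cases hα : ∃ l, ζ l = α
    · obtain ⟨l, rfl⟩ := hα
      have h1 := (expAt_locusPoly s h.distinct l).1
      exact ((h1.mul h1).mul (h.evenPole_kdvSeq l n).1).mono (by omega)
    · push Not at hα
      have h1 := ordGE_expAt_algebraMap α (locusPoly s ζ)
      exact (h1.mul h1).mul (h.ordGE_kdvSeq hα n))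
  have hinf : OrdGE 2 (HalphenKdV.expInf q) := by simpa using h.expInf.1
  have h1 := ordGE_expInf_algebraMap (natDegree_locusPoly s ζ).le
  have h2 := (h1.mul h1).mul (ordGE_expInf_kdvSeq hinf n)
  rw [← hQ, ← map_mul, ← map_mul, hp] at h2
  have hp0 : p = 0 := by
    ext k
    rw [← coeff_expInf_algebraMap, h2 _ (by omega), Polynomial.coeff_zero]
  rw [hp0, map_zero] at hp
  exact (mul_eq_zero.1 hp).resolve_left (mul_ne_zero hQ0 hQ0)

/-- The weight of a point of the locus is `g (g + 1)`, and the homogeneous KdV sequence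
terminates exactly at `g`. -/
theorem IsLocusData.exists_genus (h : IsLocusData q 0 s ζ) :
    ∃ g : ℕ, 1 ≤ g ∧ ∑ l, s l * (s l + 1) = g * (g + 1) ∧ (∀ n, g < n → kdvSeq q n = 0) ∧
      ∀ n ≤ g, (HalphenKdV.expInf (kdvSeq q n)).coeff (2 * n) ≠ 0 := by
  have hinf : OrdGE 2 (HalphenKdV.expInf q) := by simpa using h.expInf.1
  have hlead : (HalphenKdV.expInf q).coeff 2 = -((∑ l, s l * (s l + 1) : ℕ) : ℂ) := by
    simpa using h.expInf.2
  have hstep : ∀ n : ℕ, n * (n + 1) ≠ ∑ l, s l * (s l + 1) →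
      (HalphenKdV.expInf (kdvSeq q n)).coeff (2 * n) ≠ 0 →
      (HalphenKdV.expInf (kdvSeq q (n + 1))).coeff (2 * ((n + 1 : ℕ) : ℤ)) ≠ 0 := by
    intro n hne hn h0
    have h1 := kdvSeq_lead hinf n
    rw [h0, mul_zero, hlead] at h1
    refine mul_ne_zero (mul_ne_zero ?_ ?_) hn h1.symm
    · exact_mod_cast (by omega : 2 * n + 1 ≠ 0)
    · intro h2
      apply hne
      have h3 : ((n * (n + 1) : ℕ) : ℂ) = ((∑ l, s l * (s l + 1) : ℕ) : ℂ) := by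
        rw [← sub_eq_zero, sub_eq_add_neg, ← h2, Nat.cast_mul, Nat.cast_add, Nat.cast_one]
      exact_mod_cast h3
  have hbase : (HalphenKdV.expInf (kdvSeq q 0)).coeff (2 * ((0 : ℕ) : ℤ)) ≠ 0 := by
    simp [kdvSeq_zero]
  -- Were the sum not of this form, no leading coefficient at infinity would ever vanish, against
  -- termination.
  obtain ⟨g, hg⟩ : ∃ g : ℕ, g * (g + 1) = ∑ l, s l * (s l + 1) := by
    by_contra! hcon
    have : ∀ n : ℕ, (HalphenKdV.expInf (kdvSeq q n)).coeff (2 * n) ≠ 0 := by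
      intro n
      induction n with
      | zero => exact hbase
      | succ n ih => exact hstep n (hcon n) ih
    apply this (∑ l, s l + 1)
    rw [h.kdvSeq_eq_zero_of_lt (by omega), map_zero, HahnSeries.coeff_zero]
  refine ⟨g, ?_, hg.symm, ?_, ?_⟩
  · rw [Nat.one_le_iff_ne_zero]
    rintro rfl
    simp only [zero_mul] at hg
    have h1 := Finset.sum_eq_zero_iff.1 hg.symm ⟨0, h.pos⟩ (Finset.mem_univ _)
    have := h.s_pos ⟨0, h.pos⟩
    rcases Nat.mul_eq_zero.1 h1 with h2 | h2 <;> omega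
  · intro n hn
    by_contra hne
    -- Past `g` a nonzero member has a nonzero successor, so a single one would prevent termination.
    have : ∀ k, kdvSeq q (n + k) ≠ 0 := by
      intro k
      induction k with
      | zero => exact hne
      | succ k ih =>
        exact kdvSeq_succ_ne_zero hinf (n := n + k) (by rw [hlead, hg]) (by omega) ih
    exact this (∑ l, s l + 1) (h.kdvSeq_eq_zero_of_lt (by omega))
  · intro n
    induction n with
    | zero => intro _; exact hbase
    | succ n ih =>
      intro hn
      refine hstep n ?_ (ih (by omega))
      rw [← hg]
      exact fun h' => by have := mul_self_succ_injective h'; omega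

end

/-! ### Polynomials in the spectral parameter -/

/-- Coefficientwise derivative `d/dz` of a polynomial in the spectral parameter. -/
def polyDeriv (F : (RatFunc ℂ)[X]) : (RatFunc ℂ)[X] :=
  F.sum fun n a => Polynomial.monomial n (ratDeriv a)

theorem coeff_polyDeriv (F : (RatFunc ℂ)[X]) (n : ℕ) :
    (polyDeriv F).coeff n = ratDeriv (F.coeff n) := by
  rw [polyDeriv, Polynomial.sum_def, Polynomial.finsetSum_coeff]
  simp only [Polynomial.coeff_monomial]
  rw [Finset.sum_ite_eq']
  split_ifs with h
  · rfl
  · rw [Polynomial.notMem_support_iff.1 h, ratDeriv_zero]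

theorem polyDeriv_add (F G : (RatFunc ℂ)[X]) : polyDeriv (F + G) = polyDeriv F + polyDeriv G := by
  ext n; simp only [coeff_polyDeriv, Polynomial.coeff_add, ratDeriv_add]

theorem polyDeriv_mul (F G : (RatFunc ℂ)[X]) :
    polyDeriv (F * G) = polyDeriv F * G + F * polyDeriv G := by
  ext n
  simp only [coeff_polyDeriv, Polynomial.coeff_add, Polynomial.coeff_mul, ratDeriv_sum,
    ratDeriv_mul, Finset.sum_add_distrib]

theorem polyDeriv_C (a : RatFunc ℂ) : polyDeriv (Polynomial.C a) = Polynomial.C (ratDeriv a) := by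
  ext n
  rw [coeff_polyDeriv, Polynomial.coeff_C, Polynomial.coeff_C]
  split_ifs
  · rfl
  · exact ratDeriv_zero

theorem polyDeriv_pow_eq_zero {F : (RatFunc ℂ)[X]} (h : polyDeriv F = 0) (n : ℕ) :
    polyDeriv (F ^ n) = 0 := by
  induction n with
  | zero => rw [pow_zero, ← Polynomial.C_1, polyDeriv_C, ratDeriv_one, map_zero]
  | succ n ih => rw [pow_succ, polyDeriv_mul, ih, h, zero_mul, mul_zero, add_zero]

theorem polyDeriv_comp {G : (RatFunc ℂ)[X]} (h : polyDeriv G = 0) (F : (RatFunc ℂ)[X]) :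
    polyDeriv (F.comp G) = (polyDeriv F).comp G := by
  induction F using Polynomial.induction_on' with
  | add p q hp hq => rw [Polynomial.add_comp, polyDeriv_add, hp, hq, polyDeriv_add,
      Polynomial.add_comp]
  | monomial n a =>
    have e : polyDeriv (Polynomial.monomial n a) = Polynomial.monomial n (ratDeriv a) := by
      ext k
      rw [coeff_polyDeriv, Polynomial.coeff_monomial, Polynomial.coeff_monomial]
      split_ifs
      · rfl
      · exact ratDeriv_zero
    rw [e, Polynomial.monomial_comp, Polynomial.monomial_comp, polyDeriv_mul, polyDeriv_C,
      polyDeriv_pow_eq_zero h, mul_zero, add_zero]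

theorem polyDeriv_X_sub_C (c : ℂ) :
    polyDeriv (Polynomial.X - Polynomial.C (RatFunc.C c)) = 0 := by
  ext n
  rw [coeff_polyDeriv, Polynomial.coeff_sub, Polynomial.coeff_X, Polynomial.coeff_C,
    Polynomial.coeff_zero, ratDeriv_sub]
  split_ifs <;> simp [ratDeriv_one, ratDeriv_zero, ratDeriv_C]

/-- The KdV operator applied coefficientwise. -/
def polyKdvOp (q : RatFunc ℂ) (F : (RatFunc ℂ)[X]) : (RatFunc ℂ)[X] :=
  Polynomial.C (RatFunc.C (1 / 4)) * polyDeriv (polyDeriv (polyDeriv F)) +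
    Polynomial.C q * polyDeriv F + Polynomial.C (RatFunc.C (1 / 2) * ratDeriv q) * F

theorem coeff_polyKdvOp (q : RatFunc ℂ) (F : (RatFunc ℂ)[X]) (n : ℕ) :
    (polyKdvOp q F).coeff n = ratKdvOp q (F.coeff n) := by
  simp only [polyKdvOp, ratKdvOp, Polynomial.coeff_add, Polynomial.coeff_C_mul, coeff_polyDeriv]

/-- `F` solves `F''' / 4 + (q - E) F' + q' F / 2 = 0`. -/
def IsKdVPoly (q : RatFunc ℂ) (F : (RatFunc ℂ)[X]) : Prop :=
  polyKdvOp q F = Polynomial.X * polyDeriv F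

theorem isKdVPoly_iff {q : RatFunc ℂ} {F : (RatFunc ℂ)[X]} :
    IsKdVPoly q F ↔ ratKdvOp q (F.coeff 0) = 0 ∧
      ∀ n, ratKdvOp q (F.coeff (n + 1)) = ratDeriv (F.coeff n) := by
  constructor
  · intro h
    refine ⟨?_, fun n => ?_⟩
    · rw [← coeff_polyKdvOp, h, Polynomial.coeff_X_mul_zero]
    · rw [← coeff_polyKdvOp, h, Polynomial.coeff_X_mul, coeff_polyDeriv]
  · rintro ⟨h0, h1⟩
    unfold IsKdVPoly
    ext n
    rcases n with _ | n
    · rw [coeff_polyKdvOp, h0, Polynomial.coeff_X_mul_zero]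
    · rw [coeff_polyKdvOp, h1, Polynomial.coeff_X_mul, coeff_polyDeriv]

/-- The expression `-F'' F / 2 + F'² / 4 + (E - q) F²`. -/
def polyCurve (q : RatFunc ℂ) (F : (RatFunc ℂ)[X]) : (RatFunc ℂ)[X] :=
  -(Polynomial.C (RatFunc.C (1 / 2)) * polyDeriv (polyDeriv F) * F) +
    Polynomial.C (RatFunc.C (1 / 4)) * polyDeriv F ^ 2 +
    (Polynomial.X - Polynomial.C q) * F ^ 2

theorem coeff_polyF (f : ℕ → RatFunc ℂ) (g i : ℕ) :
    (polyF f g).coeff i = if i ≤ g then f (g - i) else 0 := by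
  simp only [polyF, Polynomial.finsetSum_coeff, Polynomial.coeff_C_mul, Polynomial.coeff_X_pow,
    mul_ite, mul_one, mul_zero]
  rw [Finset.sum_ite_eq]
  simp only [Finset.mem_range, Nat.lt_succ_iff]

theorem polyF_ratDeriv (f : ℕ → RatFunc ℂ) (g : ℕ) :
    polyF (fun j => ratDeriv (f j)) g = polyDeriv (polyF f g) := by
  ext i
  rw [coeff_polyDeriv, coeff_polyF, coeff_polyF]
  split_ifs
  · rfl
  · rw [ratDeriv_zero]

theorem polyR_eq (q : RatFunc ℂ) (f : ℕ → RatFunc ℂ) (g : ℕ) :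
    polyR q f g = polyCurve q (polyF f g) := by
  rw [polyR, polyCurve, polyF_ratDeriv, polyF_ratDeriv f]

theorem natDegree_polyF_le (f : ℕ → RatFunc ℂ) (g : ℕ) : (polyF f g).natDegree ≤ g := by
  rw [Polynomial.natDegree_le_iff_coeff_eq_zero]
  intro i hi
  rw [coeff_polyF, if_neg (by omega)]

theorem IsKdVSequence.monic_polyF {q : RatFunc ℂ} {g : ℕ} {f : ℕ → RatFunc ℂ}
    (h : IsKdVSequence q g f) : (polyF f g).Monic := by
  refine Polynomial.monic_of_natDegree_le_of_coeff_eq_one g (natDegree_polyF_le f g) ?_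
  rw [coeff_polyF, if_pos le_rfl, Nat.sub_self, h.zero]

theorem IsKdVSequence.natDegree_polyF {q : RatFunc ℂ} {g : ℕ} {f : ℕ → RatFunc ℂ}
    (h : IsKdVSequence q g f) : (polyF f g).natDegree = g := by
  refine Polynomial.natDegree_eq_of_le_of_coeff_ne_zero (natDegree_polyF_le f g) ?_
  rw [coeff_polyF, if_pos le_rfl, Nat.sub_self, h.zero]
  exact one_ne_zero

theorem ratKdvOp_zero (q : RatFunc ℂ) : ratKdvOp q 0 = 0 := by
  simp [ratKdvOp, ratDeriv_zero]

theorem ratKdvOp_add (q f g : RatFunc ℂ) : ratKdvOp q (f + g) = ratKdvOp q f + ratKdvOp q g := by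
  simp only [ratKdvOp, ratDeriv_add]; ring

theorem ratKdvOp_sub (q f g : RatFunc ℂ) : ratKdvOp q (f - g) = ratKdvOp q f - ratKdvOp q g := by
  simp only [ratKdvOp, ratDeriv_sub]; ring

theorem ratKdvOp_C_mul (q : RatFunc ℂ) (c : ℂ) (f : RatFunc ℂ) :
    ratKdvOp q (RatFunc.C c * f) = RatFunc.C c * ratKdvOp q f := by
  simp only [ratKdvOp, ratDeriv_C_mul]; ring

theorem IsKdVSequence.isKdVPoly {q : RatFunc ℂ} {g : ℕ} {f : ℕ → RatFunc ℂ}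
    (h : IsKdVSequence q g f) : IsKdVPoly q (polyF f g) := by
  refine isKdVPoly_iff.2 ⟨?_, fun n => ?_⟩
  · rw [coeff_polyF, if_pos (Nat.zero_le g), Nat.sub_zero, ← h.step le_rfl, h.ratDeriv_last]
  · rw [coeff_polyF, coeff_polyF]
    by_cases hn : n + 1 ≤ g
    · rw [if_pos hn, if_pos (by omega), ← h.step (by omega)]
      congr 2
      omega
    · rw [if_neg hn, ratKdvOp_zero]
      split_ifs with h1
      · rw [show g - n = 0 by omega, h.zero, ratDeriv_one]
      · rw [ratDeriv_zero]

/-- KdV sequences are traded for monic polynomials in `E` solving one linear equation, on which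
translations and differences are easy to carry out. -/
theorem IsKdVPoly.exists_sequence {q : RatFunc ℂ} {F : (RatFunc ℂ)[X]} (h : IsKdVPoly q F)
    (hF : F.Monic) : ∃ f, IsKdVSequence q F.natDegree f ∧ polyF f F.natDegree = F := by
  obtain ⟨h0, h1⟩ := isKdVPoly_iff.1 h
  -- The value `0` beyond the degree is a legitimate `f_{g+1}`, since only its derivative enters.
  refine ⟨fun j => if j ≤ F.natDegree then F.coeff (F.natDegree - j) else 0,
    ⟨?_, fun j hj => ?_, ?_⟩, ?_⟩
  · simp only [Nat.zero_le, if_true, Nat.sub_zero]; exact hF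
  · change _ = ratKdvOp q _
    simp only [if_pos hj]
    split_ifs with h2
    · rw [show F.natDegree - j = F.natDegree - (j + 1) + 1 by omega, h1]
    · rw [show F.natDegree - j = 0 by omega, h0, ratDeriv_zero]
  · simp [ratDeriv_zero]
  · ext i
    rw [coeff_polyF]
    split_ifs with h2 h3
    · rw [Nat.sub_sub_self h2]
    · omega
    · rw [Polynomial.coeff_eq_zero_of_natDegree_lt (by omega)]

/-- The equation depends on `q` and `E` only through `q - E` and `q'`, so a constant added to `q` is
absorbed by translating `E`. -/
theorem IsKdVPoly.comp_X_sub_C {q : RatFunc ℂ} {F : (RatFunc ℂ)[X]} (c : ℂ) (h : IsKdVPoly q F) :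
    IsKdVPoly (q + RatFunc.C c) (F.comp (Polynomial.X - Polynomial.C (RatFunc.C c))) := by
  have hd := polyDeriv_X_sub_C c
  have h1 := congrArg (fun G => G.comp (Polynomial.X - Polynomial.C (RatFunc.C c))) h
  simp only [polyKdvOp, Polynomial.add_comp, Polynomial.mul_comp, Polynomial.C_comp,
    Polynomial.X_comp, ← polyDeriv_comp hd] at h1
  unfold IsKdVPoly
  simp only [polyKdvOp, ratDeriv_add, ratDeriv_C, add_zero, map_add]
  linear_combination h1

theorem polyCurve_comp_X_sub_C (q : RatFunc ℂ) (F : (RatFunc ℂ)[X]) (c : ℂ) :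
    polyCurve (q + RatFunc.C c) (F.comp (Polynomial.X - Polynomial.C (RatFunc.C c))) =
      (polyCurve q F).comp (Polynomial.X - Polynomial.C (RatFunc.C c)) := by
  have hd := polyDeriv_X_sub_C c
  simp only [polyCurve, Polynomial.add_comp, Polynomial.neg_comp, Polynomial.mul_comp,
    Polynomial.C_comp, Polynomial.X_comp, Polynomial.sub_comp, Polynomial.pow_comp,
    ← polyDeriv_comp hd, map_add]
  ring

/-- At minimal degree the monic solution of the KdV equation in the spectral parameter is
unique. -/
theorem IsKdVPoly.eq_of_minimal {q : RatFunc ℂ} {g : ℕ} {F G : (RatFunc ℂ)[X]}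
    (hF : IsKdVPoly q F) (hG : IsKdVPoly q G) (mF : F.Monic) (mG : G.Monic)
    (dF : F.natDegree = g) (dG : G.natDegree = g)
    (hmin : ∀ g' < g, ¬ SolvesStationaryKdV q g') : F = G := by
  by_contra hne
  have hD0 : F - G ≠ 0 := sub_ne_zero.2 hne
  have hdeg : (F - G).natDegree < g := by
    rw [Polynomial.natDegree_lt_iff_degree_lt hD0, ← dF, ← Polynomial.degree_eq_natDegree mF.ne_zero]
    refine Polynomial.degree_sub_lt_left ?_ mF.ne_zero (by rw [mF, mG])
    rw [Polynomial.degree_eq_natDegree mF.ne_zero, Polynomial.degree_eq_natDegree mG.ne_zero,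
      dF, dG]
  obtain ⟨hF0, hF1⟩ := isKdVPoly_iff.1 hF
  obtain ⟨hG0, hG1⟩ := isKdVPoly_iff.1 hG
  have hD1 : ∀ n, ratKdvOp q ((F - G).coeff (n + 1)) = ratDeriv ((F - G).coeff n) := by
    intro n
    rw [Polynomial.coeff_sub, Polynomial.coeff_sub, ratKdvOp_sub, ratDeriv_sub, hF1, hG1]
  -- Comparing the coefficients one above the degree shows that the leading coefficient is constant.
  -- The difference can then be made monic, and it solves the equation in lower degree.
  have hlead : ratDeriv ((F - G).leadingCoeff) = 0 := by
    rw [Polynomial.leadingCoeff, ← hD1,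
      Polynomial.coeff_eq_zero_of_natDegree_lt (Nat.lt_succ_self _), ratKdvOp_zero]
  obtain ⟨c, hc⟩ := eq_C_of_ratDeriv_eq_zero hlead
  have hc0 : c ≠ 0 := by
    rintro rfl
    rw [map_zero, Polynomial.leadingCoeff_eq_zero] at hc
    exact hD0 hc
  have hcC : (RatFunc.C c⁻¹ : RatFunc ℂ) ≠ 0 := (map_ne_zero _).2 (inv_ne_zero hc0)
  set H := Polynomial.C (RatFunc.C c⁻¹) * (F - G) with hH
  have hHdeg : H.natDegree = (F - G).natDegree := Polynomial.natDegree_C_mul hcC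
  have hHm : H.Monic := by
    rw [Polynomial.Monic, hH, Polynomial.leadingCoeff_mul, Polynomial.leadingCoeff_C, hc,
      ← map_mul, inv_mul_cancel₀ hc0, map_one]
  have hHk : IsKdVPoly q H := by
    refine isKdVPoly_iff.2 ⟨?_, fun n => ?_⟩
    · rw [hH, Polynomial.coeff_C_mul, ratKdvOp_C_mul, Polynomial.coeff_sub, ratKdvOp_sub, hF0,
        hG0, sub_zero, mul_zero]
    · rw [hH, Polynomial.coeff_C_mul, Polynomial.coeff_C_mul, ratKdvOp_C_mul, hD1, ratDeriv_C_mul]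
  obtain ⟨f, hf, -⟩ := hHk.exists_sequence hHm
  exact hmin _ (by omega) ⟨f, hf⟩

theorem SolvesStationaryKdV.add_C {q : RatFunc ℂ} {g : ℕ} (h : SolvesStationaryKdV q g) (c : ℂ) :
    SolvesStationaryKdV (q + RatFunc.C c) g := by
  obtain ⟨f, hf⟩ := h
  have h1 := hf.isKdVPoly.comp_X_sub_C c
  have h2 : ((polyF f g).comp (Polynomial.X - Polynomial.C (RatFunc.C c))).Monic :=
    hf.monic_polyF.comp (Polynomial.monic_X_sub_C _) (by rw [Polynomial.natDegree_X_sub_C]; simp)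
  obtain ⟨f', hf', -⟩ := h1.exists_sequence h2
  rw [Polynomial.natDegree_comp, Polynomial.natDegree_X_sub_C, mul_one, hf.natDegree_polyF] at hf'
  exact ⟨f', hf'⟩

/-- Adding a constant to the potential translates the spectral curve. -/
theorem HasSpectralCurve.add_C {q : RatFunc ℂ} {g : ℕ} {R : ℂ[X]} (h : HasSpectralCurve q g R)
    (c : ℂ) :
    HasSpectralCurve (q + RatFunc.C c) g (R.comp (Polynomial.X - Polynomial.C c)) := by
  obtain ⟨⟨f, hf, hR⟩, hmin⟩ := h
  constructor
  · have h1 := hf.isKdVPoly.comp_X_sub_C c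
    have h2 : ((polyF f g).comp (Polynomial.X - Polynomial.C (RatFunc.C c))).Monic :=
      hf.monic_polyF.comp (Polynomial.monic_X_sub_C _) (by rw [Polynomial.natDegree_X_sub_C]; simp)
    obtain ⟨f', hf', hF'⟩ := h1.exists_sequence h2
    rw [Polynomial.natDegree_comp, Polynomial.natDegree_X_sub_C, mul_one,
      hf.natDegree_polyF] at hf' hF'
    refine ⟨f', hf', ?_⟩
    rw [polyR_eq, hF', polyCurve_comp_X_sub_C, ← polyR_eq, hR, Polynomial.map_comp]
    simp
  · intro g' hg' h'
    apply hmin g' hg'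
    have := h'.add_C (-c)
    rwa [map_neg, add_neg_cancel_right] at this

/-! ### The spectral curve of a locus potential -/

section

variable {q : RatFunc ℂ} {M : ℕ} {s : Fin M → ℕ} {ζ : Fin M → ℂ}

theorem isKdVSequence_kdvSeq {g : ℕ} (h : kdvSeq q (g + 1) = 0) :
    IsKdVSequence q g (kdvSeq q) where
  zero := kdvSeq_zero q
  succ j _ := ratDeriv_kdvSeq_succ q j
  kdv := by rw [h, ratDeriv_zero, mul_zero]

/-- When the sequence terminates, its generating series is a polynomial in `w`. Substituting `w = 1
/ E` and multiplying by `E ^ (2 g + 1)`, which is what `reflect` does, turns the quadratic identity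
into the equation of the curve, the constant `1` becoming `E ^ (2 g + 1)`. -/
theorem polyR_kdvSeq {g : ℕ} (h : ∀ n, g < n → kdvSeq q n = 0) :
    polyR q (kdvSeq q) g = Polynomial.X ^ (2 * g + 1) := by
  set F := PowerSeries.mk (kdvSeq q) with hF
  set P := PowerSeries.trunc (g + 1) F with hP
  have hPc : ∀ n, P.coeff n = kdvSeq q n := by
    intro n
    rw [hP, PowerSeries.coeff_trunc]
    split_ifs with hn
    · rw [hF, PowerSeries.coeff_mk]
    · rw [h n (by omega)]
  have hPF : (P : PowerSeries (RatFunc ℂ)) = F := by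
    ext n
    rw [Polynomial.coeff_coe, hPc, hF, PowerSeries.coeff_mk]
  have hcoe : ∀ G : (RatFunc ℂ)[X], seriesDeriv (G : PowerSeries (RatFunc ℂ)) =
      (polyDeriv G : (RatFunc ℂ)[X]) := by
    intro G
    ext n
    rw [coeff_seriesDeriv, Polynomial.coeff_coe, Polynomial.coeff_coe, coeff_polyDeriv]
  have hquad : P * P = 1 + Polynomial.X * (Polynomial.C (RatFunc.C (1 / 2)) *
      (polyDeriv (polyDeriv P) * P) - Polynomial.C (RatFunc.C (1 / 4)) *
        (polyDeriv P * polyDeriv P) + Polynomial.C q * (P * P)) := by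
    apply Polynomial.coe_injective
    have := kdvSeries_quadratic q hF
    rw [← hPF, hcoe, hcoe] at this
    push_cast
    exact this
  have hdP : ∀ G : (RatFunc ℂ)[X], G.natDegree ≤ g → (polyDeriv G).natDegree ≤ g := by
    intro G hG
    rw [Polynomial.natDegree_le_iff_coeff_eq_zero]
    intro n hn
    rw [coeff_polyDeriv, Polynomial.coeff_eq_zero_of_natDegree_lt (by omega), ratDeriv_zero]
  have d0 : P.natDegree ≤ g := by
    rw [Polynomial.natDegree_le_iff_coeff_eq_zero]
    intro n hn
    rw [hPc, h n hn]
  have d1 := hdP P d0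
  have d2 := hdP _ d1
  have hrD : ∀ G : (RatFunc ℂ)[X], (polyDeriv G).reflect g = polyDeriv (G.reflect g) := by
    intro G
    ext n
    rw [Polynomial.coeff_reflect, coeff_polyDeriv, coeff_polyDeriv, Polynomial.coeff_reflect]
  have hrP : P.reflect g = polyF (kdvSeq q) g := by
    ext i
    rw [Polynomial.coeff_reflect, hPc, coeff_polyF]
    split_ifs with hi
    · rw [Polynomial.revAt_le hi]
    · rw [Polynomial.revAt_eq_self_of_lt (by omega), h i (by omega)]
  set B := Polynomial.C (RatFunc.C (1 / 2)) *
      (polyDeriv (polyDeriv P) * P) - Polynomial.C (RatFunc.C (1 / 4)) *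
        (polyDeriv P * polyDeriv P) + Polynomial.C q * (P * P) with hB
  have hmulle : ∀ G H : (RatFunc ℂ)[X], G.natDegree ≤ g → H.natDegree ≤ g →
      (G * H).natDegree ≤ g + g := fun G H hG hH =>
    Polynomial.natDegree_mul_le.trans (by omega)
  have dB : B.natDegree ≤ g + g := by
    rw [hB]
    have b1 := (Polynomial.natDegree_C_mul_le (RatFunc.C (1 / 2)) _).trans (hmulle _ _ d2 d0)
    have b2 := (Polynomial.natDegree_C_mul_le (RatFunc.C (1 / 4)) _).trans (hmulle _ _ d1 d1)
    have b3 := (Polynomial.natDegree_C_mul_le q _).trans (hmulle _ _ d0 d0)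
    have b4 := (Polynomial.natDegree_sub_le_of_le b1 b2).trans (max_self _).le
    exact Polynomial.natDegree_add_le_of_degree_le b4 b3
  have hsub : ∀ (G H : (RatFunc ℂ)[X]) (N : ℕ),
      (G - H).reflect N = G.reflect N - H.reflect N := by
    intro G H N
    ext i
    simp only [Polynomial.coeff_reflect, Polynomial.coeff_sub]
  have rB : B.reflect (g + g) = Polynomial.C (RatFunc.C (1 / 2)) *
      (polyDeriv (polyDeriv (polyF (kdvSeq q) g)) * polyF (kdvSeq q) g) -
        Polynomial.C (RatFunc.C (1 / 4)) *
        (polyDeriv (polyF (kdvSeq q) g) * polyDeriv (polyF (kdvSeq q) g)) +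
        Polynomial.C q * (polyF (kdvSeq q) g * polyF (kdvSeq q) g) := by
    rw [hB, Polynomial.reflect_add, hsub, Polynomial.reflect_C_mul, Polynomial.reflect_C_mul,
      Polynomial.reflect_C_mul, Polynomial.reflect_mul _ _ d2 d0, Polynomial.reflect_mul _ _ d1 d1,
      Polynomial.reflect_mul _ _ d0 d0, hrD, hrD, hrP]
  have hfin := congrArg (Polynomial.reflect (1 + (g + g))) hquad
  rw [Polynomial.reflect_add, Polynomial.reflect_mul _ _ Polynomial.natDegree_X_le dB,
    Polynomial.reflect_one_X, one_mul, Polynomial.reflect_one, rB, ← one_mul (P * P),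
    Polynomial.reflect_mul (F := 1) _ _ (by simp) (hmulle _ _ d0 d0),
    Polynomial.reflect_mul _ _ d0 d0, hrP, Polynomial.reflect_one, pow_one] at hfin
  rw [polyR_eq, polyCurve, show 2 * g + 1 = 1 + (g + g) by ring]
  linear_combination hfin

/-- Each integration contributes one free constant, and the recursion, being linear, shifts the
earlier ones along the homogeneous sequence. -/
theorem eq_kdvSeq_add_sum {g : ℕ} {f : ℕ → RatFunc ℂ} (hf : IsKdVSequence q g f) :
    ∀ j ≤ g + 1, ∃ c : ℕ → ℂ,
      f j = kdvSeq q j + ∑ i ∈ Finset.range j, RatFunc.C (c i) * kdvSeq q i := by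
  intro j
  induction j with
  | zero => intro _; exact ⟨0, by simp [hf.zero, kdvSeq_zero]⟩
  | succ j ih =>
    intro hj
    obtain ⟨c, hc⟩ := ih (by omega)
    have hsum : ∀ S : Finset ℕ, ratKdvOp q (∑ i ∈ S, RatFunc.C (c i) * kdvSeq q i) =
        ∑ i ∈ S, RatFunc.C (c i) * ratDeriv (kdvSeq q (i + 1)) := by
      intro S
      induction S using Finset.induction_on with
      | empty => simp [ratKdvOp_zero]
      | insert a S ha ih =>
        rw [Finset.sum_insert ha, Finset.sum_insert ha, ratKdvOp_add, ih, ratKdvOp_C_mul,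
          ratDeriv_kdvSeq_succ]
    have h1 : ratDeriv (f (j + 1) - kdvSeq q (j + 1) -
        ∑ i ∈ Finset.range j, RatFunc.C (c i) * kdvSeq q (i + 1)) = 0 := by
      rw [ratDeriv_sub, ratDeriv_sub, hf.step (by omega), hc, ratKdvOp_add, hsum,
        ratDeriv_kdvSeq_succ, ratDeriv_sum]
      simp only [ratDeriv_C_mul]
      ring
    obtain ⟨d, hd⟩ := eq_C_of_ratDeriv_eq_zero h1
    -- The new integration constant `d` multiplies `kdvSeq q 0 = 1`; the old constants move up by
    -- one index.
    refine ⟨fun i => if i = 0 then d else c (i - 1), ?_⟩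
    rw [Finset.sum_range_succ']
    simp only [kdvSeq_zero, mul_one, if_true, Nat.succ_ne_zero, if_false, Nat.add_sub_cancel]
    rw [← hd]
    ring

/-- For `i ≤ g` the members have distinct orders `2 i` at infinity, so a combination of the first
`n` of them vanishing to order `2 n` is trivial. -/
theorem sum_kdvSeq_eq_zero {g : ℕ} (hq : OrdGE 2 (expInf q))
    (hne : ∀ n ≤ g, (expInf (kdvSeq q n)).coeff (2 * n) ≠ 0) (c : ℕ → ℂ) :
    ∀ n ≤ g + 1, OrdGE (2 * n) (expInf (∑ i ∈ Finset.range n, RatFunc.C (c i) * kdvSeq q i)) →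
      ∑ i ∈ Finset.range n, RatFunc.C (c i) * kdvSeq q i = 0 := by
  intro n
  induction n with
  | zero => intro _ _; simp
  | succ n ih =>
    intro hn h
    have hn1 := ordGE_expInf_kdvSeq hq n
    have h1 : OrdGE (2 * n) (expInf (∑ i ∈ Finset.range n, RatFunc.C (c i) * kdvSeq q i)) := by
      have e : ∑ i ∈ Finset.range n, RatFunc.C (c i) * kdvSeq q i =
          ∑ i ∈ Finset.range (n + 1), RatFunc.C (c i) * kdvSeq q i -
            RatFunc.C (c n) * kdvSeq q n := by
        rw [Finset.sum_range_succ]; ring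
      rw [e, map_sub, map_mul, expInf_C]
      exact (h.mono (by push_cast; omega)).sub (hn1.C_mul _)
    have h2 := ih (by omega) h1
    rw [Finset.sum_range_succ, h2, zero_add] at h ⊢
    have h3 := h (2 * n) (by push_cast; omega)
    rw [map_mul, expInf_C, coeff_C_mul'] at h3
    have h4 := (mul_eq_zero.1 h3).resolve_right (hne n (by omega))
    rw [h4, map_zero, zero_mul]

/-- A solution at `g'` would make `kdvSeq q (g' + 1)` a combination of earlier members. Its order at
infinity forces the combination, and hence the member itself, to vanish. -/
theorem not_solvesStationaryKdV_of_lt {g g' : ℕ} (hq : OrdGE 2 (expInf q))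
    (hne : ∀ n ≤ g, (expInf (kdvSeq q n)).coeff (2 * n) ≠ 0) (hg : g' < g) :
    ¬ SolvesStationaryKdV q g' := by
  rintro ⟨f, hf⟩
  obtain ⟨c, hc⟩ := eq_kdvSeq_add_sum hf (g' + 1) le_rfl
  obtain ⟨e, he⟩ := eq_C_of_ratDeriv_eq_zero hf.ratDeriv_last
  -- The constant value `e` of `f_{g'+1}` is absorbed into the coefficient of `kdvSeq q 0 = 1`.
  set c' : ℕ → ℂ := fun i => if i = 0 then c 0 - e else c i with hc'
  have h1 : ∑ i ∈ Finset.range (g' + 1), RatFunc.C (c' i) * kdvSeq q i = -kdvSeq q (g' + 1) := by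
    rw [Finset.sum_range_succ'] at hc ⊢
    simp only [hc', kdvSeq_zero, mul_one, if_true, Nat.succ_ne_zero, if_false, map_sub] at hc ⊢
    rw [he] at hc
    linear_combination -hc
  have h2 := sum_kdvSeq_eq_zero hq hne c' (g' + 1) (by omega) (by
    rw [h1, map_neg]
    exact (ordGE_expInf_kdvSeq hq (g' + 1)).neg)
  rw [h1, neg_eq_zero] at h2
  apply hne (g' + 1) hg
  rw [h2, map_zero, HahnSeries.coeff_zero]

theorem IsLocusData.exists_hasSpectralCurve {qInf : ℂ} (h : IsLocusData q qInf s ζ) :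
    ∃ g : ℕ, 1 ≤ g ∧ ∑ l, s l * (s l + 1) = g * (g + 1) ∧
      HasSpectralCurve q g ((Polynomial.X - Polynomial.C qInf) ^ (2 * g + 1)) := by
  obtain ⟨g, hg1, hg, hzero, hne⟩ := h.sub_C.exists_genus
  refine ⟨g, hg1, hg, ?_⟩
  have h1 : HasSpectralCurve (q - RatFunc.C qInf) g (Polynomial.X ^ (2 * g + 1)) := by
    refine ⟨⟨_, isKdVSequence_kdvSeq (hzero (g + 1) (by omega)), ?_⟩, fun g' hg' => ?_⟩
    · rw [polyR_kdvSeq hzero]; simp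
    · exact not_solvesStationaryKdV_of_lt h.expInf.1 hne hg'
  have h2 := h1.add_C qInf
  rwa [sub_add_cancel, Polynomial.X_pow_comp] at h2

theorem HasSpectralCurve.unique {g g' : ℕ} {R R' : ℂ[X]} (h : HasSpectralCurve q g R)
    (h' : HasSpectralCurve q g' R') : g = g' ∧ R = R' := by
  obtain ⟨⟨f, hf, hR⟩, hmin⟩ := h
  obtain ⟨⟨f', hf', hR'⟩, hmin'⟩ := h'
  have hgg : g = g' := by
    rcases lt_trichotomy g g' with h1 | h1 | h1
    · exact (hmin' g h1 ⟨f, hf⟩).elim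
    · exact h1
    · exact (hmin g' h1 ⟨f', hf'⟩).elim
  subst hgg
  refine ⟨rfl, Polynomial.map_injective RatFunc.C RatFunc.C_injective ?_⟩
  rw [← hR, ← hR', polyR_eq, polyR_eq, hf.isKdVPoly.eq_of_minimal hf'.isKdVPoly hf.monic_polyF
    hf'.monic_polyF hf.natDegree_polyF hf'.natDegree_polyF hmin]

end

/-- Being a KdV potential already gives locus data with some genus and some value at infinity. The
curve computed from these data must be the given one, and this identifies both. -/
theorem hasSpectralCurve_iff {q : RatFunc ℂ} (hq : ∀ c : ℂ, q ≠ RatFunc.C c) (g : ℕ) (qInf : ℂ) :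
    HasSpectralCurve q g ((Polynomial.X - Polynomial.C qInf) ^ (2 * g + 1)) ↔
      ∃ (M : ℕ) (s : Fin M → ℕ) (ζ : Fin M → ℂ),
        IsLocusData q qInf s ζ ∧ ∑ l, s l * (s l + 1) = g * (g + 1) := by
  constructor
  · intro h
    obtain ⟨⟨f, hf, -⟩, -⟩ := id h
    obtain ⟨M, s, c, ζ, hl⟩ := IsKdVPotential.exists_isLocusData hq ⟨g, f, hf⟩
    obtain ⟨g', -, hs, hc⟩ := hl.exists_hasSpectralCurve
    obtain ⟨rfl, hR⟩ := h.unique hc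
    have hcq : qInf = c := by
      have := congrArg (Polynomial.eval qInf) hR
      simp only [Polynomial.eval_pow, Polynomial.eval_sub, Polynomial.eval_X, Polynomial.eval_C,
        sub_self] at this
      rw [zero_pow (by omega), eq_comm, pow_eq_zero_iff (by omega), sub_eq_zero] at this
      exact this
    subst hcq
    exact ⟨M, s, ζ, hl, hs⟩
  · rintro ⟨M, s, ζ, hl, hs⟩
    obtain ⟨g', -, hs', hc⟩ := hl.exists_hasSpectralCurve
    rwa [mul_self_succ_injective (hs.symm.trans hs')]

/-! ### Taylor series of analytic germs -/

section Taylor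

open Filter Topology

/-- The Taylor series of `f` at `α`, as a formal Laurent series. -/
def taylorSeries (α : ℂ) (f : ℂ → ℂ) : ℂ⸨X⸩ :=
  HahnSeries.ofPowerSeries ℤ ℂ (PowerSeries.mk fun n => iteratedDeriv n f α / n.factorial)

variable {α : ℂ} {f g : ℂ → ℂ}

theorem coeff_taylorSeries (α : ℂ) (f : ℂ → ℂ) (n : ℕ) :
    (taylorSeries α f).coeff n = iteratedDeriv n f α / n.factorial := by
  rw [taylorSeries, HahnSeries.ofPowerSeries_apply_coeff, PowerSeries.coeff_mk]

theorem ordGE_taylorSeries (α : ℂ) (f : ℂ → ℂ) : OrdGE 0 (taylorSeries α f) := by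
  intro i hi
  rw [taylorSeries, PowerSeries.coeff_coe, if_pos hi]

theorem eq_of_coeff_nat {F G : ℂ⸨X⸩} (hF : OrdGE 0 F) (hG : OrdGE 0 G)
    (h : ∀ n : ℕ, F.coeff n = G.coeff n) : F = G := by
  ext i
  rcases lt_or_ge i 0 with hi | hi
  · rw [hF i hi, hG i hi]
  · obtain ⟨n, rfl⟩ := Int.eq_ofNat_of_zero_le hi
    exact h n

theorem taylorSeries_congr (h : f =ᶠ[𝓝 α] g) : taylorSeries α f = taylorSeries α g :=
  eq_of_coeff_nat (ordGE_taylorSeries α f) (ordGE_taylorSeries α g) fun n => by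
    rw [coeff_taylorSeries, coeff_taylorSeries, h.iteratedDeriv_eq n]

theorem taylorSeries_add (hf : AnalyticAt ℂ f α) (hg : AnalyticAt ℂ g α) :
    taylorSeries α (fun z => f z + g z) = taylorSeries α f + taylorSeries α g :=
  eq_of_coeff_nat (ordGE_taylorSeries α _) ((ordGE_taylorSeries α f).add (ordGE_taylorSeries α g))
    fun n => by
      rw [HahnSeries.coeff_add, coeff_taylorSeries, coeff_taylorSeries, coeff_taylorSeries,
        iteratedDeriv_fun_add hf.contDiffAt hg.contDiffAt, add_div]

theorem taylorSeries_mul (hf : AnalyticAt ℂ f α) (hg : AnalyticAt ℂ g α) :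
    taylorSeries α (fun z => f z * g z) = taylorSeries α f * taylorSeries α g := by
  rw [taylorSeries, taylorSeries, taylorSeries, ← map_mul]
  congr 1
  ext n
  rw [PowerSeries.coeff_mul, PowerSeries.coeff_mk,
    iteratedDeriv_fun_mul hf.contDiffAt hg.contDiffAt,
    Finset.Nat.sum_antidiagonal_eq_sum_range_succ_mk, Finset.sum_div]
  refine Finset.sum_congr rfl fun i hi => ?_
  rw [Finset.mem_range] at hi
  rw [PowerSeries.coeff_mk, PowerSeries.coeff_mk]
  have h1 : ((n.choose i : ℕ) : ℂ) * i.factorial * (n - i).factorial = n.factorial := by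
    exact_mod_cast Nat.choose_mul_factorial_mul_factorial (by omega : i ≤ n)
  have h2 : (i.factorial : ℂ) ≠ 0 := by exact_mod_cast i.factorial_ne_zero
  have h3 : ((n - i).factorial : ℂ) ≠ 0 := by exact_mod_cast (n - i).factorial_ne_zero
  have h4 : (n.factorial : ℂ) ≠ 0 := by exact_mod_cast n.factorial_ne_zero
  field_simp
  rw [← h1]
  ring

theorem taylorSeries_const (α c : ℂ) : taylorSeries α (fun _ => c) = HahnSeries.C c :=
  eq_of_coeff_nat (ordGE_taylorSeries α _) (OrdGE.C c) fun n => by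
    rw [coeff_taylorSeries, iteratedDeriv_const]
    rcases n with _ | n
    · simp
    · rw [if_neg (by omega), zero_div, HahnSeries.C_apply, HahnSeries.coeff_single_of_ne (by omega)]

theorem taylorSeries_deriv (α : ℂ) (f : ℂ → ℂ) :
    taylorSeries α (deriv f) = lderiv (taylorSeries α f) := by
  refine eq_of_coeff_nat (ordGE_taylorSeries α _) ?_ fun n => ?_
  · exact (ordGE_taylorSeries α f).lderiv_of_zero
  · have h := coeff_taylorSeries α f (n + 1)
    push_cast at h
    rw [coeff_taylorSeries, coeff_lderiv, h, iteratedDeriv_succ', Nat.factorial_succ]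
    have h1 : ((n : ℂ) + 1) ≠ 0 := by exact_mod_cast n.succ_ne_zero
    push_cast
    field_simp

theorem taylorSeries_id (α : ℂ) :
    taylorSeries α (fun z => z) = HahnSeries.single 1 1 + HahnSeries.C α := by
  have h1 : lderiv (taylorSeries α (fun z => z)) =
      lderiv (HahnSeries.single 1 1 + HahnSeries.C α) := by
    rw [← taylorSeries_deriv, deriv_id'', taylorSeries_const, map_add, lderiv_C, add_zero, lderiv,
      LaurentSeries.derivative_apply, LaurentSeries.hasseDeriv_single]
    simp
  have h2 : lderiv (taylorSeries α (fun z => z) -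
      (HahnSeries.single 1 1 + HahnSeries.C α)) = 0 := by rw [map_sub, h1, sub_self]
  rw [← sub_eq_zero]
  ext i
  by_cases hi : i = 0
  · subst hi
    have := coeff_taylorSeries α (fun z => z) 0
    simp only [Nat.cast_zero, iteratedDeriv_zero, Nat.factorial_zero, Nat.cast_one, div_one] at this
    rw [HahnSeries.coeff_sub, this, HahnSeries.coeff_add,
      HahnSeries.coeff_single_of_ne (by omega), HahnSeries.C_apply, HahnSeries.coeff_single_same]
    simp
  · rw [coeff_eq_zero_of_lderiv_eq_zero h2 hi, HahnSeries.coeff_zero]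

theorem analyticAt_polynomial (p : ℂ[X]) (α : ℂ) : AnalyticAt ℂ (fun z => p.eval z) α :=
  AnalyticOnNhd.eval_polynomial p α (Set.mem_univ α)

theorem taylorSeries_polynomial (p : ℂ[X]) (α : ℂ) :
    taylorSeries α (fun z => p.eval z) = expAt α (algebraMap ℂ[X] (RatFunc ℂ) p) := by
  induction p using Polynomial.induction_on with
  | C a => simp only [Polynomial.eval_C, taylorSeries_const, RatFunc.algebraMap_C, expAt_C]
  | add p q hp hq =>
    simp only [Polynomial.eval_add]
    rw [taylorSeries_add (analyticAt_polynomial p α) (analyticAt_polynomial q α), hp, hq, map_add,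
      map_add]
  | monomial n a ih =>
    rw [pow_succ, ← mul_assoc, map_mul, map_mul, ← ih, RatFunc.algebraMap_X, expAt_X]
    have h : (fun z => (Polynomial.C a * Polynomial.X ^ n * Polynomial.X : ℂ[X]).eval z) =
        fun z => (Polynomial.C a * Polynomial.X ^ n : ℂ[X]).eval z * z := by
      funext z
      rw [Polynomial.eval_mul_X]
    have hid : AnalyticAt ℂ (fun z => z) α := analyticAt_id
    rw [h, taylorSeries_mul (analyticAt_polynomial _ α) hid, taylorSeries_id]

theorem eventually_eq_zero_of_taylorSeries (hf : AnalyticAt ℂ f α) (h : taylorSeries α f = 0) :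
    ∀ᶠ z in 𝓝 α, f z = 0 := by
  have h1 := hf.hasFPowerSeriesAt
  have h2 : (fun n : ℕ => iteratedDeriv n f α / (n.factorial : ℂ)) = 0 := by
    funext n
    rw [← coeff_taylorSeries, h]
    rfl
  rw [h2, FormalMultilinearSeries.ofScalars_series_eq_zero_of_scalar_zero] at h1
  exact h1.eventually_eq_zero

end Taylor

/-! ### From meromorphic to formal solutions -/

section MeromorphicToFormal

open Filter Topology

theorem eventually_codiscrete_iff {p : ℂ → Prop} :
    (∀ᶠ z in codiscrete ℂ, p z) ↔ ∀ α, ∀ᶠ z in 𝓝[≠] α, p z := by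
  simp only [Filter.Eventually, mem_codiscrete, disjoint_principal_right, compl_compl]

theorem eventually_eval_ne_zero {p : ℂ[X]} (hp : p ≠ 0) :
    ∀ᶠ z in codiscrete ℂ, p.eval z ≠ 0 := by
  filter_upwards [(Polynomial.finite_setOfPred_isRoot hp).compl_mem_codiscrete] with z hz
  exact hz

theorem val_eq (q : RatFunc ℂ) (z : ℂ) : val q z = q.num.eval z / q.denom.eval z := by
  simp only [val, RatFunc.eval, Polynomial.eval₂_id]

theorem lderiv_natCast_mul (n : ℕ) (G : ℂ⸨X⸩) : lderiv (n * G) = n * lderiv G := by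
  rw [← nsmul_eq_mul, map_nsmul, nsmul_eq_mul]

theorem lderiv_single_one : lderiv (HahnSeries.single 1 1) = 1 := by
  have := expAt_ratDeriv 0 RatFunc.X
  rw [ratDeriv_X, expAt_X, map_one, map_zero, add_zero] at this
  exact this.symm

theorem lderiv_single_pow_mul (n : ℕ) (Y : ℂ⸨X⸩) {T : ℂ⸨X⸩} (hT : T = HahnSeries.single 1 1) :
    T * lderiv (T ^ n * Y) = n * (T ^ n * Y) + T ^ (n + 1) * lderiv Y := by
  have h : T * lderiv (T ^ n) = n * T ^ n := by
    induction n with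
    | zero => simpa using congrArg (T * ·) (lderiv_C 1)
    | succ n ih =>
      rw [pow_succ, lderiv_mul, hT, lderiv_single_one, ← hT, mul_add, ← mul_assoc, ih]
      push_cast
      ring
  rw [lderiv_mul, mul_add, ← mul_assoc, h]
  ring

/-- Expresses `t ^ (n + 2) Y''` through `t ^ n Y` and its derivatives without dividing by `t`. The
analytic twin is `deriv_deriv_pow_mul`; together they carry the equation from a function to its
germ. -/
theorem lderiv_lderiv_single_pow_mul (n : ℕ) (Y : ℂ⸨X⸩) {T : ℂ⸨X⸩}
    (hT : T = HahnSeries.single 1 1) :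
    T ^ 2 * lderiv (lderiv (T ^ n * Y)) = 2 * n * (T * lderiv (T ^ n * Y)) -
      n * (n + 1) * (T ^ n * Y) + T ^ (n + 2) * lderiv (lderiv Y) := by
  have h1 := lderiv_single_pow_mul n Y hT
  have h2 := congrArg lderiv h1
  have h3 := lderiv_single_pow_mul (n + 1) (lderiv Y) hT
  rw [lderiv_mul, hT, lderiv_single_one, ← hT, map_add, lderiv_natCast_mul] at h2
  push_cast at h3
  linear_combination T * h2 + h3 - (n + 1) * h1

theorem deriv_deriv_pow_mul {α z : ℂ} {y : ℂ → ℂ} (n : ℕ) (hy : AnalyticAt ℂ y z) :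
    (z - α) ^ 2 * deriv (deriv fun w => (w - α) ^ n * y w) z =
      2 * n * ((z - α) * deriv (fun w => (w - α) ^ n * y w) z) -
      n * (n + 1) * ((z - α) ^ n * y z) + (z - α) ^ (n + 2) * deriv (deriv y) z := by
  have hd : ∀ m : ℕ, ∀ u : ℂ → ℂ, ∀ w, AnalyticAt ℂ u w →
      (w - α) * deriv (fun v => (v - α) ^ m * u v) w =
        m * ((w - α) ^ m * u w) + (w - α) ^ (m + 1) * deriv u w := by
    intro m u w hu
    have h1 : HasDerivAt (fun v => (v - α) ^ m) (m * (w - α) ^ (m - 1) * 1) w :=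
      ((hasDerivAt_id w).sub_const α).pow m
    rw [(h1.fun_mul hu.differentiableAt.hasDerivAt).deriv]
    rcases m with _ | m
    · simp
    · rw [Nat.add_sub_cancel]
      ring
  have han : ∀ m : ℕ, ∀ u : ℂ → ℂ, AnalyticAt ℂ u z →
      AnalyticAt ℂ (fun v => (v - α) ^ m * u v) z := fun m u hu =>
    ((analyticAt_id.sub analyticAt_const).pow m).mul hu
  have h1 := hd n y z hy
  have h3 := hd (n + 1) (deriv y) z hy.deriv
  have h2 : deriv (fun w => (w - α) * deriv (fun v => (v - α) ^ n * y v) w) z =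
      deriv (fun w => n * ((w - α) ^ n * y w) + (w - α) ^ (n + 1) * deriv y w) z := by
    refine Filter.EventuallyEq.deriv_eq ?_
    filter_upwards [hy.eventually_analyticAt] with w hw using hd n y w hw
  have ha : HasDerivAt (fun w => w - α) 1 z := (hasDerivAt_id z).sub_const α
  have hb : HasDerivAt (deriv (fun v => (v - α) ^ n * y v)) _ z :=
    (han n y hy).deriv.differentiableAt.hasDerivAt
  have hc : HasDerivAt (fun v => (v - α) ^ n * y v) _ z :=
    (han n y hy).differentiableAt.hasDerivAt
  have he : HasDerivAt (fun v => (v - α) ^ (n + 1) * deriv y v) _ z :=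
    (han (n + 1) _ hy.deriv).differentiableAt.hasDerivAt
  have hl := (ha.mul hb).deriv
  have hr := ((hc.const_mul (n : ℂ)).add he).deriv
  have h4 := hl.symm.trans (h2.trans hr)
  push_cast at h3
  linear_combination (z - α) * h4 + h3 - (n + 1) * h1

/-- The Laurent series at `α` of a function `y` for which `(z - α) ^ n * y z` is analytic. -/
def germ (α : ℂ) (n : ℕ) (y : ℂ → ℂ) : ℂ⸨X⸩ :=
  HahnSeries.single (-(n : ℤ)) 1 * taylorSeries α (fun z => (z - α) ^ n * y z)

theorem single_one_ne_zero : (HahnSeries.single 1 1 : ℂ⸨X⸩) ≠ 0 := by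
  simp

theorem single_pow_mul_germ (α : ℂ) (n : ℕ) (y : ℂ → ℂ) :
    HahnSeries.single 1 1 ^ n * germ α n y = taylorSeries α (fun z => (z - α) ^ n * y z) := by
  rw [germ, ← mul_assoc, HahnSeries.single_pow, HahnSeries.single_mul_single]
  simp

/-- Multiplying by the denominator of `q` and by `(z - α) ^ (n + 2)` gives an equation for the
analytic function `g` with polynomial coefficients. Its Taylor series is divided again in the field
`ℂ((t))`. -/
theorem formalSol_germ {q : RatFunc ℂ} {E α : ℂ} {y : ℂ → ℂ} (hy : IsMeromorphicSolution q E y)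
    {n : ℕ} (hn : AnalyticAt ℂ (fun z => (z - α) ^ n * y z) α) :
    FormalSol (expAt α q) E (germ α n y) := by
  set g : ℂ → ℂ := fun z => (z - α) ^ n * y z with hg
  set t : ℂ[X] := Polynomial.X - Polynomial.C α with ht
  set P₁ : ℂ[X] := q.denom * t ^ 2 with hP₁
  set P₂ : ℂ[X] := -(2 * n * q.denom * t) with hP₂
  set P₃ : ℂ[X] := n * (n + 1) * q.denom + (q.num - Polynomial.C E * q.denom) * t ^ 2 with hP₃
  have hana : AnalyticAt ℂ (fun z => P₁.eval z * deriv (deriv g) z +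
      (P₂.eval z * deriv g z + P₃.eval z * g z)) α :=
    ((analyticAt_polynomial P₁ α).fun_mul hn.deriv.deriv).fun_add
      (((analyticAt_polynomial P₂ α).fun_mul hn.deriv).fun_add ((analyticAt_polynomial P₃ α).fun_mul hn))
  have hzero : ∀ᶠ z in 𝓝 α, P₁.eval z * deriv (deriv g) z +
      (P₂.eval z * deriv g z + P₃.eval z * g z) = 0 := by
    -- The equation is known only off a discrete set; analyticity at `α` extends it across.
    rw [← hana.frequently_zero_iff_eventually_zero]
    refine Filter.Eventually.frequently ?_
    filter_upwards [(hy.1 α).eventually_analyticAt, eventually_codiscrete_iff.1 hy.2 α,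
      eventually_codiscrete_iff.1 (eventually_eval_ne_zero q.denom_ne_zero) α] with z h1 h2 h3
    have h4 := deriv_deriv_pow_mul (α := α) n h1
    rw [val_eq] at h2
    have h5 : q.denom.eval z * deriv (deriv y) z + q.num.eval z * y z =
        E * (q.denom.eval z * y z) := by
      field_simp at h2
      linear_combination h2
    simp only [hP₁, hP₂, hP₃, ht, hg, Polynomial.eval_mul, Polynomial.eval_add, Polynomial.eval_pow,
      Polynomial.eval_sub, Polynomial.eval_X, Polynomial.eval_C, Polynomial.eval_neg,
      Polynomial.eval_natCast, Polynomial.eval_one, Polynomial.eval_ofNat]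
    linear_combination q.denom.eval z * h4 + (z - α) ^ (n + 2) * h5
  have hser := taylorSeries_congr (g := fun _ => (0 : ℂ)) hzero
  rw [taylorSeries_const, map_zero,
    taylorSeries_add ((analyticAt_polynomial P₁ α).fun_mul hn.deriv.deriv)
      (((analyticAt_polynomial P₂ α).fun_mul hn.deriv).fun_add ((analyticAt_polynomial P₃ α).fun_mul hn)),
    taylorSeries_add ((analyticAt_polynomial P₂ α).fun_mul hn.deriv)
      ((analyticAt_polynomial P₃ α).fun_mul hn),
    taylorSeries_mul (analyticAt_polynomial P₁ α) hn.deriv.deriv,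
    taylorSeries_mul (analyticAt_polynomial P₂ α) hn.deriv,
    taylorSeries_mul (analyticAt_polynomial P₃ α) hn, taylorSeries_deriv, taylorSeries_deriv,
    taylorSeries_polynomial, taylorSeries_polynomial, taylorSeries_polynomial] at hser
  obtain ⟨T, hT⟩ : ∃ T : ℂ⸨X⸩, T = HahnSeries.single 1 1 := ⟨_, rfl⟩
  have hTt : expAt α (algebraMap ℂ[X] (RatFunc ℂ) t) = T := by
    rw [ht, map_sub, map_sub, RatFunc.algebraMap_X, RatFunc.algebraMap_C, expAt_X, expAt_C, hT,
      add_sub_cancel_right]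
  have hG : taylorSeries α g = T ^ n * germ α n y := by rw [hT, single_pow_mul_germ]
  rw [hG] at hser
  have hY := lderiv_lderiv_single_pow_mul n (germ α n y) hT
  have hD : expAt α (algebraMap ℂ[X] (RatFunc ℂ) q.denom) ≠ 0 :=
    (map_ne_zero _).2 (RatFunc.algebraMap_ne_zero q.denom_ne_zero)
  have hqnum : expAt α q * expAt α (algebraMap ℂ[X] (RatFunc ℂ) q.denom) =
      expAt α (algebraMap ℂ[X] (RatFunc ℂ) q.num) := by
    rw [← map_mul]
    have hd : algebraMap ℂ[X] (RatFunc ℂ) q.denom ≠ 0 := fun h => hD (by rw [h, map_zero])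
    congr 1
    rw [← eq_div_iff hd, RatFunc.num_div_denom]
  simp only [hP₁, hP₂, hP₃, map_mul, map_add, map_sub, map_neg, map_pow, map_natCast, map_one,
    map_ofNat, hTt, RatFunc.algebraMap_C, expAt_C, ← hqnum] at hser
  have hT0 : T ≠ 0 := hT ▸ single_one_ne_zero
  refine mul_left_cancel₀ (mul_ne_zero hD (pow_ne_zero (n + 2) hT0)) ?_
  linear_combination hser - expAt α (algebraMap ℂ[X] (RatFunc ℂ) q.denom) * hY

/-- Vanishing of the germ at one point gives infinite order there, and by connectedness a
meromorphic function on `ℂ` has infinite order either everywhere or nowhere. -/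
theorem eq_zero_of_germ {a b α : ℂ} {y₁ y₂ : ℂ → ℂ} (h₁ : Meromorphic y₁) (h₂ : Meromorphic y₂)
    {n : ℕ} (hn₁ : AnalyticAt ℂ (fun z => (z - α) ^ n * y₁ z) α)
    (hn₂ : AnalyticAt ℂ (fun z => (z - α) ^ n * y₂ z) α)
    (h : HahnSeries.C a * germ α n y₁ + HahnSeries.C b * germ α n y₂ = 0) :
    ∀ᶠ z in codiscrete ℂ, a * y₁ z + b * y₂ z = 0 := by
  have hser : taylorSeries α (fun z => a * ((z - α) ^ n * y₁ z) + b * ((z - α) ^ n * y₂ z)) = 0 := by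
    rw [taylorSeries_add (analyticAt_const.fun_mul hn₁) (analyticAt_const.fun_mul hn₂),
      taylorSeries_mul analyticAt_const hn₁, taylorSeries_mul analyticAt_const hn₂,
      taylorSeries_const, taylorSeries_const, ← single_pow_mul_germ, ← single_pow_mul_germ]
    linear_combination (HahnSeries.single 1 1 : ℂ⸨X⸩) ^ n * h
  have h0 := eventually_eq_zero_of_taylorSeries
    ((analyticAt_const.fun_mul hn₁).fun_add (analyticAt_const.fun_mul hn₂)) hser
  have hm : Meromorphic (fun z => a * y₁ z + b * y₂ z) := fun z =>
    ((MeromorphicAt.const a z).mul (h₁ z)).fun_add ((MeromorphicAt.const b z).mul (h₂ z))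
  have htop : meromorphicOrderAt (fun z => a * y₁ z + b * y₂ z) α = ⊤ := by
    rw [meromorphicOrderAt_eq_top_iff]
    filter_upwards [h0.filter_mono nhdsWithin_le_nhds, self_mem_nhdsWithin] with z hz hzα
    have : (z - α) ^ n * (a * y₁ z + b * y₂ z) = 0 := by linear_combination hz
    exact (mul_eq_zero.1 this).resolve_left (pow_ne_zero n (sub_ne_zero.2 hzα))
  refine eventually_codiscrete_iff.2 fun β => ?_
  rw [← meromorphicOrderAt_eq_top_iff]
  by_contra hβ
  exact hm.exists_meromorphicOrderAt_ne_top_iff_forall.1 ⟨β, hβ⟩ α htop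

theorem exists_localCond_of_fundamentalSystem {q : RatFunc ℂ}
    (h : ∀ E, HasMeromorphicFundamentalSystem q E) (α : ℂ) : ∃ s, LocalCond (expAt α q) s := by
  refine localCond_of_formalSol fun E => ?_
  obtain ⟨y₁, y₂, h₁, h₂, hind⟩ := h E
  obtain ⟨n₁, hn₁⟩ := h₁.1 α
  obtain ⟨n₂, hn₂⟩ := h₂.1 α
  have hpow : ∀ m : ℕ, AnalyticAt ℂ (fun z => (z - α) ^ m) α := fun m =>
    (analyticAt_id.sub analyticAt_const).pow m
  -- A common exponent is needed, and `n₁ + n₂` clears the poles of both solutions.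
  have hn₁' : AnalyticAt ℂ (fun z => (z - α) ^ (n₁ + n₂) * y₁ z) α := by
    refine ((hpow n₂).mul hn₁).congr (Filter.Eventually.of_forall fun z => ?_)
    simp only [Pi.mul_apply, smul_eq_mul]
    ring
  have hn₂' : AnalyticAt ℂ (fun z => (z - α) ^ (n₁ + n₂) * y₂ z) α := by
    refine ((hpow n₁).mul hn₂).congr (Filter.Eventually.of_forall fun z => ?_)
    simp only [Pi.mul_apply, smul_eq_mul]
    ring
  exact ⟨_, _, formalSol_germ h₁ hn₁', formalSol_germ h₂ hn₂', fun a b hab =>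
    hind a b (eq_zero_of_germ h₁.1 h₂.1 hn₁' hn₂' hab)⟩

end MeromorphicToFormal

/-! ### Behaviour at infinity -/

section Infinity

open Filter Topology Bornology

/-- The quotient is the reflected polynomial evaluated at `1 / z`, which tends to its constant term.
-/
theorem tendsto_eval_div_pow {p : ℂ[X]} {n : ℕ} (hp : p.natDegree ≤ n) :
    Tendsto (fun z => p.eval z / z ^ n) (cobounded ℂ) (𝓝 (p.coeff n)) := by
  have h1 : Tendsto (fun z : ℂ => (p.reflect n).eval z⁻¹) (cobounded ℂ) (𝓝 (p.coeff n)) := by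
    have h2 := ((p.reflect n).continuous.tendsto 0).comp (tendsto_inv₀_cobounded (α := ℂ))
    rw [← Polynomial.coeff_zero_eq_eval_zero, Polynomial.coeff_reflect, Polynomial.revAt_zero] at h2
    exact h2
  refine h1.congr' ?_
  filter_upwards [eventually_ne_cobounded (0 : ℂ)] with z hz
  rw [eq_div_iff (pow_ne_zero n hz)]
  have := invertibleOfNonzero hz
  simpa only [Polynomial.eval₂_id, invOf_eq_inv] using
    Polynomial.eval₂_reflect_mul_pow (RingHom.id ℂ) z n p hp

theorem eventually_cobounded_eval_ne_zero {p : ℂ[X]} (hp : p ≠ 0) :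
    ∀ᶠ z in cobounded ℂ, p.eval z ≠ 0 := by
  filter_upwards [isBounded_def.1 (Polynomial.finite_setOfPred_isRoot hp).isBounded] with z hz
  exact hz

theorem boundedNearInfinity_iff {q : RatFunc ℂ} :
    BoundedNearInfinity q ↔ q.num.natDegree ≤ q.denom.natDegree := by
  constructor
  · rintro ⟨R, B, hB⟩
    by_contra! hlt
    set n := q.num.natDegree with hn
    have h1 := tendsto_eval_div_pow (p := q.num) (n := n) le_rfl
    have h2 := tendsto_eval_div_pow (p := q.denom) (n := n) hlt.le
    rw [Polynomial.coeff_eq_zero_of_natDegree_lt hlt] at h2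
    have h3 : Tendsto (fun z => q.denom.eval z / z ^ n * val q z) (cobounded ℂ) (𝓝 0) := by
      refine h2.zero_mul_isBoundedUnder_le ⟨B, ?_⟩
      rw [eventually_map]
      filter_upwards [tendsto_norm_cobounded_atTop.eventually_ge_atTop R] with z hz using hB z hz
    have h4 : Tendsto (fun z => q.denom.eval z / z ^ n * val q z) (cobounded ℂ)
        (𝓝 (q.num.coeff n)) := by
      refine h1.congr' ?_
      filter_upwards [eventually_cobounded_eval_ne_zero q.denom_ne_zero] with z hz
      rw [val_eq]
      field_simp
    have h5 : q.num.leadingCoeff = 0 := tendsto_nhds_unique h4 h3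
    rw [Polynomial.leadingCoeff_eq_zero] at h5
    rw [hn, h5, Polynomial.natDegree_zero] at hlt
    omega
  · intro hle
    set n := q.denom.natDegree with hn
    have h1 := tendsto_eval_div_pow hle
    have h2 := tendsto_eval_div_pow (p := q.denom) (n := n) le_rfl
    have h0 : q.denom.coeff n ≠ 0 := Polynomial.leadingCoeff_ne_zero.2 q.denom_ne_zero
    have h3 := (h1.div h2 h0).norm
    have h4 := h3.eventually_le_const (lt_add_one _)
    rw [Filter.atTop_basis.cobounded_of_norm.eventually_iff] at h4
    obtain ⟨R, -, hR⟩ := h4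
    -- The maximum with `1` keeps `z` away from `0`, so that `z ^ n` can be cancelled.
    refine ⟨max R 1, _, fun z hz => le_trans (le_of_eq ?_) (hR (le_trans (le_max_left R 1) hz))⟩
    have hz0 : z ≠ 0 := norm_pos_iff.1 (by linarith [le_max_right R 1])
    rw [val_eq, Pi.div_apply, div_div_div_cancel_right₀ (pow_ne_zero n hz0)]

theorem ordGE_zero_expInf_iff {q : RatFunc ℂ} :
    OrdGE 0 (expInf q) ↔ q.num.natDegree ≤ q.denom.natDegree := by
  have hd : algebraMap ℂ[X] (RatFunc ℂ) q.denom ≠ 0 := RatFunc.algebraMap_ne_zero q.denom_ne_zero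
  have hmul : expInf q * expInf (algebraMap ℂ[X] (RatFunc ℂ) q.denom) =
      expInf (algebraMap ℂ[X] (RatFunc ℂ) q.num) := by
    rw [← map_mul]
    congr 1
    rw [← eq_div_iff hd, RatFunc.num_div_denom]
  have hD : OrdGE (-(q.denom.natDegree : ℤ)) (expInf (algebraMap ℂ[X] (RatFunc ℂ) q.denom)) :=
    ordGE_expInf_algebraMap le_rfl
  have hD0 : (expInf (algebraMap ℂ[X] (RatFunc ℂ) q.denom)).coeff (-(q.denom.natDegree : ℤ)) ≠ 0 :=
    by rw [coeff_expInf_algebraMap]; exact Polynomial.leadingCoeff_ne_zero.2 q.denom_ne_zero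
  constructor
  · intro h
    by_contra! hlt
    have h1 := (h.mul hD) (-(q.num.natDegree : ℤ)) (by omega)
    rw [hmul, coeff_expInf_algebraMap] at h1
    have h5 : q.num.leadingCoeff = 0 := h1
    rw [Polynomial.leadingCoeff_eq_zero] at h5
    rw [h5, Polynomial.natDegree_zero] at hlt
    omega
  · intro hle
    refine hD.of_mul hD0 ?_
    rw [mul_comm, hmul, add_zero]
    exact ordGE_expInf_algebraMap hle

end Infinity

theorem IsHalphenPotential.exists_isLocusData {q : RatFunc ℂ} (hq : ∀ c : ℂ, q ≠ RatFunc.C c)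
    (h : IsHalphenPotential q) :
    ∃ (M : ℕ) (s : Fin M → ℕ) (qInf : ℂ) (ζ : Fin M → ℂ), IsLocusData q qInf s ζ :=
  exists_isLocusData_of_localCond hq (exists_localCond_of_fundamentalSystem h.2)
    (ordGE_zero_expInf_iff.2 (boundedNearInfinity_iff.1 h.1))

theorem IsLocusData.boundedNearInfinity {q : RatFunc ℂ} {qInf : ℂ} {M : ℕ} {s : Fin M → ℕ}
    {ζ : Fin M → ℂ} (h : IsLocusData q qInf s ζ) : BoundedNearInfinity q := by
  rw [boundedNearInfinity_iff, ← ordGE_zero_expInf_iff]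
  have h1 := (h.expInf.1.mono (by norm_num : (0 : ℤ) ≤ 2)).add (OrdGE.C qInf)
  rwa [← expInf_C, ← map_add, sub_add_cancel] at h1

/-! ### Kernels of degree-lowering operators -/

section DegreeLowering

open Module

theorem finrank_map_add_finrank_inf_ker {V W : Type*} [AddCommGroup V] [Module ℂ V]
    [AddCommGroup W] [Module ℂ W] (f : V →ₗ[ℂ] W) (F : Submodule ℂ V) [FiniteDimensional ℂ F] :
    finrank ℂ (F.map f) + finrank ℂ (F ⊓ LinearMap.ker f : Submodule ℂ V) = finrank ℂ F := by
  have h := (f.domRestrict F).finrank_range_add_finrank_ker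
  rw [LinearMap.range_domRestrict, LinearMap.ker_domRestrict] at h
  rw [← h, ← Submodule.map_comap_subtype, Submodule.finrank_map_subtype_eq]

theorem finrank_degreeLT (n : ℕ) : finrank ℂ (Polynomial.degreeLT ℂ n) = n := by
  rw [(Polynomial.degreeLTEquiv ℂ n).finrank_eq, finrank_fin_fun]

instance finiteDimensional_degreeLT (n : ℕ) :
    FiniteDimensional ℂ (Polynomial.degreeLT ℂ n) :=
  (Polynomial.degreeLTEquiv ℂ n).symm.finiteDimensional

/-- An operator that preserves a subspace of finite codimension of `ℂ[X]` and lowers degrees by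
`r` has a kernel of dimension at least `r`. -/
theorem exists_ker_of_degree_lowering {V W : Type*} [AddCommGroup V] [Module ℂ V]
    [AddCommGroup W] [Module ℂ W] [FiniteDimensional ℂ W] (c : ℂ[X] →ₗ[ℂ] W) (r : ℕ)
    (S J : ℂ[X] →ₗ[ℂ] V)
    (h : ∀ n, ∀ p ∈ Polynomial.degreeLT ℂ (n + r), c p = 0 →
      ∃ p' ∈ Polynomial.degreeLT ℂ n, c p' = 0 ∧ J p' = S p) :
    ∃ v : Fin r → ℂ[X], LinearIndependent ℂ v ∧ ∀ i, c (v i) = 0 ∧ S (v i) = 0 := by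
  set A : ℕ → Submodule ℂ ℂ[X] := fun n => Polynomial.degreeLT ℂ n ⊓ LinearMap.ker c with hA
  have hfin : ∀ n, FiniteDimensional ℂ (A n) := fun n =>
    Submodule.finiteDimensional_of_le (inf_le_left : A n ≤ Polynomial.degreeLT ℂ n)
  have hlow : ∀ n, n ≤ finrank ℂ (A n) + finrank ℂ W := by
    intro n
    have h1 := finrank_map_add_finrank_inf_ker c (Polynomial.degreeLT ℂ n)
    have h2 := Submodule.finrank_le ((Polynomial.degreeLT ℂ n).map c)
    rw [finrank_degreeLT] at h1
    change n ≤ finrank ℂ (Polynomial.degreeLT ℂ n ⊓ LinearMap.ker c : Submodule ℂ ℂ[X]) + _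
    omega
  -- Rank and nullity on `A (n + r)`, whose image under `S` lies in `J (A n)`.
  have hstep : ∀ n, finrank ℂ (A (n + r)) ≤
      finrank ℂ (A n) + finrank ℂ (A (n + r) ⊓ LinearMap.ker S : Submodule ℂ ℂ[X]) := by
    intro n
    have h1 := finrank_map_add_finrank_inf_ker S (A (n + r))
    have h2 : (A (n + r)).map S ≤ (A n).map J := by
      rintro _ ⟨p, ⟨hp, hc⟩, rfl⟩
      obtain ⟨p', hp', hc', e⟩ := h n p hp hc
      exact ⟨p', ⟨hp', hc'⟩, e⟩
    have h3 := Submodule.finrank_mono h2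
    have h4 := Submodule.finrank_map_le J (A n)
    omega
  obtain ⟨n, hn⟩ : ∃ n, r ≤ finrank ℂ (A n ⊓ LinearMap.ker S : Submodule ℂ ℂ[X]) := by
    by_contra! hlt
    have hr : 0 < r := (Nat.zero_le _).trans_lt (hlt 0)
    have h1 : ∀ m, finrank ℂ (A (m * r)) + m ≤ finrank ℂ (A 0) + m * r := by
      intro m
      induction m with
      | zero => rw [Nat.zero_mul]
      | succ m ih =>
        have h2 := hstep (m * r)
        have h3 := hlt (m * r + r)
        rw [Nat.succ_mul]
        omega
    -- With kernels always smaller than `r`, the dimension of `A (m r)` falls behind `m r` by `m` up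
    -- to a constant, but it can fall behind by at most `finrank ℂ W`. This `m` is large enough for
    -- the contradiction.
    have h2 := h1 (finrank ℂ (A 0) + finrank ℂ W + 1)
    have h3 := hlow ((finrank ℂ (A 0) + finrank ℂ W + 1) * r)
    omega
  obtain ⟨v, hv⟩ := exists_linearIndependent_of_le_finrank hn
  exact ⟨fun i => v i, hv.map' (Submodule.subtype _) (Submodule.ker_subtype _),
    fun i => ⟨(v i).2.1.2, (v i).2.2⟩⟩

end DegreeLowering

/-! ### Exponential-rational solutions -/

/-- The Taylor series at `0` of `exp (k t)`. -/
def expSeries (k : ℂ) : ℂ⸨X⸩ := taylorSeries 0 fun t => Complex.exp (k * t)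

theorem analyticAt_exp_mul (k α : ℂ) : AnalyticAt ℂ (fun t => Complex.exp (k * t)) α := by
  fun_prop

theorem hasDerivAt_exp_mul (k z : ℂ) :
    HasDerivAt (fun t => Complex.exp (k * t)) (k * Complex.exp (k * z)) z := by
  simpa [mul_comm] using ((hasDerivAt_id z).const_mul k).cexp

theorem lderiv_expSeries (k : ℂ) : lderiv (expSeries k) = HahnSeries.C k * expSeries k := by
  have h : deriv (fun t => Complex.exp (k * t)) = fun t => k * Complex.exp (k * t) :=
    funext fun t => (hasDerivAt_exp_mul k t).deriv
  rw [expSeries, ← taylorSeries_deriv, h, taylorSeries_mul analyticAt_const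
    (analyticAt_exp_mul k 0), taylorSeries_const]

theorem expSeries_neg_mul (k : ℂ) : expSeries (-k) * expSeries k = 1 := by
  rw [expSeries, expSeries, ← taylorSeries_mul (analyticAt_exp_mul _ _) (analyticAt_exp_mul _ _)]
  simp only [neg_mul, ← Complex.exp_add, neg_add_cancel, Complex.exp_zero, taylorSeries_const,
    map_one]

theorem ordGE_expSeries (k : ℂ) : OrdGE 0 (expSeries k) := ordGE_taylorSeries 0 _

/-- The operator `R'' + 2 k R' + u R`, conjugate by `exp (k z)` to `y'' + u y - k ^ 2 y`. -/
def conjOp (u : RatFunc ℂ) (k : ℂ) (R : RatFunc ℂ) : RatFunc ℂ :=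
  ratDeriv (ratDeriv R) + RatFunc.C (2 * k) * ratDeriv R + u * R

theorem expSeries_mul_expAt_conjOp (u : RatFunc ℂ) (k α : ℂ) (R : RatFunc ℂ) :
    expSeries k * expAt α (conjOp u k R) =
      lderiv (lderiv (expSeries k * expAt α R)) + expAt α u * (expSeries k * expAt α R) -
        HahnSeries.C (k ^ 2) * (expSeries k * expAt α R) := by
  simp only [conjOp, map_add, map_mul, expAt_ratDeriv, expAt_C, lderiv_mul, lderiv_expSeries,
    lderiv_C, map_ofNat, map_pow]
  ring

/-- The terms `R''` and `u R` gain two orders at infinity; only `2 k R'` gains just one, and it is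
absent for `k = 0`. -/
theorem ordGE_expInf_conjOp {u R : RatFunc ℂ} {k : ℂ} {m : ℤ} {r : ℕ} (hu : OrdGE 2 (expInf u))
    (hR : OrdGE m (expInf R)) (hr : r = 1 ∨ r = 2 ∧ k = 0) :
    OrdGE (m + r) (expInf (conjOp u k R)) := by
  have h1 : OrdGE (m + r) (HahnSeries.C (2 * k) * infDeriv (expInf R)) := by
    rcases hr with hr | ⟨-, hk⟩
    · exact (hR.infDeriv.C_mul _).mono (by omega)
    · rw [hk, mul_zero, map_zero, zero_mul]
      exact OrdGE.zero _
  have h2 : OrdGE (m + r) (infDeriv (infDeriv (expInf R))) := hR.infDeriv.infDeriv.mono (by omega)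
  have h3 : OrdGE (m + r) (expInf u * expInf R) := (hu.mul hR).mono (by omega)
  simp only [conjOp, map_add, map_mul (expInf), expInf_ratDeriv, expInf_C]
  exact (h2.add h1).add h3

theorem ordGE_expAt_conjOp {u R : RatFunc ℂ} {α : ℂ} (hu : OrdGE 0 (expAt α u))
    (hR : OrdGE 0 (expAt α R)) (k : ℂ) : OrdGE 0 (expAt α (conjOp u k R)) := by
  simp only [conjOp, map_add, map_mul (expAt α), expAt_ratDeriv, expAt_C]
  exact (hR.lderiv_of_zero.lderiv_of_zero.add (hR.lderiv_of_zero.C_mul _)).add (hu.mul hR)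

theorem QuasiInv.sub_C_mul {s : ℕ} {Y Z : ℂ⸨X⸩} (hY : QuasiInv s Y) (hZ : QuasiInv s Z) (c : ℂ) :
    QuasiInv s (Y - HahnSeries.C c * Z) :=
  ⟨hY.1.sub (hZ.1.C_mul c), fun i hi => by
    rw [HahnSeries.coeff_sub, coeff_C_mul', hY.2 i hi, hZ.2 i hi, mul_zero, sub_zero]⟩

theorem smul_eq_C_mul (c : ℂ) (f : RatFunc ℂ) : c • f = RatFunc.C c * f := by
  rw [Algebra.smul_def, RatFunc.algebraMap_eq_C]

section ExpRational

variable {u : RatFunc ℂ} {M : ℕ} {s : Fin M → ℕ} {ζ : Fin M → ℂ}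

/-- Division by the locus polynomial. -/
def divLocusPoly (s : Fin M → ℕ) (ζ : Fin M → ℂ) : ℂ[X] →ₗ[ℂ] RatFunc ℂ where
  toFun p := algebraMap ℂ[X] (RatFunc ℂ) p / algebraMap ℂ[X] (RatFunc ℂ) (locusPoly s ζ)
  map_add' p p' := by rw [map_add, add_div]
  map_smul' c p := by
    rw [smul_eq_C_mul, Polynomial.smul_eq_C_mul, map_mul, RatFunc.algebraMap_C, mul_div_assoc,
      RingHom.id_apply]

theorem algebraMap_locusPoly_ne_zero (s : Fin M → ℕ) (ζ : Fin M → ℂ) :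
    algebraMap ℂ[X] (RatFunc ℂ) (locusPoly s ζ) ≠ 0 :=
  RatFunc.algebraMap_ne_zero (monic_locusPoly s ζ).ne_zero

theorem locusPoly_mul_divLocusPoly (s : Fin M → ℕ) (ζ : Fin M → ℂ) (p : ℂ[X]) :
    algebraMap ℂ[X] (RatFunc ℂ) (locusPoly s ζ) * divLocusPoly s ζ p =
      algebraMap ℂ[X] (RatFunc ℂ) p :=
  mul_div_cancel₀ _ (algebraMap_locusPoly_ne_zero s ζ)

theorem divLocusPoly_injective (s : Fin M → ℕ) (ζ : Fin M → ℂ) :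
    Function.Injective (divLocusPoly s ζ) := fun p p' h => by
  have := congrArg (algebraMap ℂ[X] (RatFunc ℂ) (locusPoly s ζ) * ·) h
  simp only [locusPoly_mul_divLocusPoly] at this
  exact RatFunc.algebraMap_injective ℂ this

theorem ordGE_divLocusPoly (hζ : Function.Injective ζ) (l : Fin M) (p : ℂ[X]) :
    OrdGE (-(s l : ℤ)) (expAt (ζ l) (divLocusPoly s ζ p)) := by
  obtain ⟨h1, h2⟩ := expAt_locusPoly s hζ l
  refine h1.of_mul h2 ?_
  rw [← map_mul, locusPoly_mul_divLocusPoly, add_neg_cancel]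
  exact ordGE_expAt_algebraMap _ p

theorem ordGE_divLocusPoly_of_ne {α : ℂ} (hα : ∀ l, ζ l ≠ α) (p : ℂ[X]) :
    OrdGE 0 (expAt α (divLocusPoly s ζ p)) := by
  refine (ordGE_expAt_algebraMap α (locusPoly s ζ)).of_mul ?_ ?_
  · rw [coeff_zero_expAt_algebraMap, locusPoly, Polynomial.eval_prod, Finset.prod_ne_zero_iff]
    intro l _
    rw [Polynomial.eval_pow, Polynomial.eval_sub, Polynomial.eval_X, Polynomial.eval_C]
    exact pow_ne_zero _ (sub_ne_zero.2 (hα l).symm)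
  · rw [← map_mul, locusPoly_mul_divLocusPoly, add_zero]
    exact ordGE_expAt_algebraMap _ p

/-- The coefficients whose vanishing makes `exp (k z) * p z / ∏ (z - ζ l) ^ s l`
quasi-invariant at every `ζ l`. -/
def quasiInvCoeffs (s : Fin M → ℕ) (ζ : Fin M → ℂ) (k : ℂ) :
    ℂ[X] →ₗ[ℂ] ((Σ l, Fin (s l)) → ℂ) where
  -- The factor at `ζ l` represents `exp (k (z - ζ l))`, which differs from `exp (k z)` by a nonzero
  -- constant, so the series at `0` serves at every point.
  toFun p i := (expSeries k * expAt (ζ i.1) (divLocusPoly s ζ p)).coeff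
    (-(s i.1 : ℤ) + 1 + 2 * (i.2 : ℕ))
  map_add' p p' := by
    funext i
    rw [map_add, map_add, mul_add, HahnSeries.coeff_add, Pi.add_apply]
  map_smul' c p := by
    funext i
    rw [map_smul, smul_eq_C_mul, map_mul, expAt_C, mul_left_comm, coeff_C_mul', RingHom.id_apply,
      Pi.smul_apply, smul_eq_mul]

theorem quasiInvCoeffs_eq_zero_iff (hζ : Function.Injective ζ) (k : ℂ) (p : ℂ[X]) :
    quasiInvCoeffs s ζ k p = 0 ↔
      ∀ l, QuasiInv (s l) (expSeries k * expAt (ζ l) (divLocusPoly s ζ p)) := by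
  constructor
  · intro h l
    refine ⟨((ordGE_expSeries k).mul (ordGE_divLocusPoly hζ l p)).mono (by omega), fun i hi => ?_⟩
    exact congrFun h ⟨l, ⟨i, hi⟩⟩
  · intro h
    funext ⟨l, i⟩
    exact (h l).2 i i.2

/-- `conjOp` as a linear map on numerators. -/
def conjOpDiv (u : RatFunc ℂ) (s : Fin M → ℕ) (ζ : Fin M → ℂ) (k : ℂ) : ℂ[X] →ₗ[ℂ] RatFunc ℂ where
  toFun p := conjOp u k (divLocusPoly s ζ p)
  map_add' p p' := by
    rw [map_add, conjOp, conjOp, conjOp, ratDeriv_add, ratDeriv_add]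
    ring
  map_smul' c p := by
    rw [map_smul, smul_eq_C_mul, smul_eq_C_mul, conjOp, conjOp, ratDeriv_C_mul, ratDeriv_C_mul,
      RingHom.id_apply]
    ring

/-- Since quasi-invariance is preserved, the pole order at `ζ l` stays at most `s l` instead of
growing by two. The image therefore has the same denominator, and its order at infinity bounds the
degree of the new numerator. -/
theorem IsLocusData.exists_conjOp_eq (h : IsLocusData u 0 s ζ) {k : ℂ} {r : ℕ}
    (hr : r = 1 ∨ r = 2 ∧ k = 0) {n : ℕ} {p : ℂ[X]} (hp : p ∈ Polynomial.degreeLT ℂ (n + r))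
    (hc : quasiInvCoeffs s ζ k p = 0) :
    ∃ p' ∈ Polynomial.degreeLT ℂ n, quasiInvCoeffs s ζ k p' = 0 ∧
      divLocusPoly s ζ p' = conjOpDiv u s ζ k p := by
  set R := divLocusPoly s ζ p with hR
  rw [quasiInvCoeffs_eq_zero_iff h.distinct] at hc
  have hquasi : ∀ l, QuasiInv (s l) (expSeries k * HalphenKdV.expAt (ζ l) (conjOp u k R)) := by
    intro l
    rw [expSeries_mul_expAt_conjOp]
    exact ((h.localCond l).quasiInv (hc l)).sub_C_mul (hc l) _
  have hpole : ∀ α, OrdGE 0 (HalphenKdV.expAt α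
      (algebraMap ℂ[X] (RatFunc ℂ) (locusPoly s ζ) * conjOp u k R)) := by
    intro α
    rw [map_mul]
    by_cases hα : ∃ l, ζ l = α
    · obtain ⟨l, rfl⟩ := hα
      -- Multiplying by the inverse exponential, a series of order at least `0`, recovers the pole
      -- bound for the rational function itself.
      have h1 := (ordGE_expSeries (-k)).mul (hquasi l).1
      rw [← mul_assoc, expSeries_neg_mul, one_mul] at h1
      exact ((expAt_locusPoly s h.distinct l).1.mul h1).mono (by omega)
    · push Not at hα
      exact (ordGE_expAt_algebraMap α _).mul
        (ordGE_expAt_conjOp (h.ordGE_expAt hα) (ordGE_divLocusPoly_of_ne hα p) k)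
  obtain ⟨p', hp'⟩ := exists_polynomial_of_ordGE hpole
  have hdiv : divLocusPoly s ζ p' = conjOp u k R :=
    mul_left_cancel₀ (algebraMap_locusPoly_ne_zero s ζ)
      ((locusPoly_mul_divLocusPoly s ζ p').trans hp'.symm)
  refine ⟨p', ?_, (quasiInvCoeffs_eq_zero_iff h.distinct k p').2 fun l => hdiv ▸ hquasi l, hdiv⟩
  obtain ⟨N, hN⟩ : ∃ N : ℕ, (locusPoly s ζ).natDegree = N := ⟨_, rfl⟩
  have hQ := ordGE_expInf_algebraMap hN.le
  have hQ0 :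
      (HalphenKdV.expInf (algebraMap ℂ[X] (RatFunc ℂ) (locusPoly s ζ))).coeff (-(N : ℤ)) ≠ 0 := by
    rw [coeff_expInf_algebraMap, ← hN]
    exact Polynomial.leadingCoeff_ne_zero.2 (monic_locusPoly s ζ).ne_zero
  have hRinf : OrdGE ((N : ℤ) - (n + r) + 1) (HalphenKdV.expInf R) := by
    refine hQ.of_mul hQ0 ?_
    rw [← map_mul, locusPoly_mul_divLocusPoly]
    intro i hi
    rcases lt_or_ge 0 i with h0 | h0
    · exact coeff_expInf_algebraMap_of_pos p h0
    · obtain ⟨j, hj⟩ := Int.eq_ofNat_of_zero_le (neg_nonneg.2 h0)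
      rw [show i = -(j : ℤ) by omega, coeff_expInf_algebraMap]
      exact Polynomial.coeff_eq_zero_of_degree_lt
        (lt_of_lt_of_le (Polynomial.mem_degreeLT.1 hp) (by norm_cast; omega))
  have hu : OrdGE 2 (HalphenKdV.expInf u) := by simpa using h.expInf.1
  have hT := ordGE_expInf_conjOp hu hRinf hr
  have hp'inf := hQ.mul hT
  rw [← map_mul, hp'] at hp'inf
  rw [Polynomial.mem_degreeLT, Polynomial.degree_lt_iff_coeff_zero]
  intro j hj
  rw [← coeff_expInf_algebraMap]
  exact hp'inf _ (by omega)

/-- Rational `R` with `exp (k z) R` a solution of `y'' + u y = k ^ 2 y`: one for every `k`, and two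
independent ones for `k = 0`. -/
theorem IsLocusData.exists_conjOp_eq_zero (h : IsLocusData u 0 s ζ) {k : ℂ} {r : ℕ}
    (hr : r = 1 ∨ r = 2 ∧ k = 0) :
    ∃ R : Fin r → RatFunc ℂ, LinearIndependent ℂ R ∧ ∀ i, conjOp u k (R i) = 0 := by
  obtain ⟨v, hv, h0⟩ := exists_ker_of_degree_lowering (quasiInvCoeffs s ζ k) r
    (conjOpDiv u s ζ k) (divLocusPoly s ζ) fun n p hp hc => h.exists_conjOp_eq hr hp hc
  exact ⟨fun i => divLocusPoly s ζ (v i),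
    hv.map' (divLocusPoly s ζ) (LinearMap.ker_eq_bot.2 (divLocusPoly_injective s ζ)),
    fun i => (h0 i).2⟩

end ExpRational

/-! ### Meromorphic solutions of a locus potential -/

section FormalToMeromorphic

open Filter Topology

/-- Codiscrete sets are open, so an identity valid off a discrete set may be differentiated. -/
theorem eventually_codiscrete_eventually_nhds {p : ℂ → Prop} (h : ∀ᶠ z in codiscrete ℂ, p z) :
    ∀ᶠ z in codiscrete ℂ, ∀ᶠ w in 𝓝 z, p w := by
  filter_upwards [h] with z hz
  exact (mem_codiscrete'.1 h).1.mem_nhds hz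

instance codiscrete_neBot : (codiscrete ℂ).NeBot := by
  refine neBot_iff.2 fun h => ?_
  have h1 : ∀ᶠ _ in codiscrete ℂ, False := by rw [h]; exact eventually_bot
  exact (eventually_codiscrete_iff.1 h1 0).exists.elim fun _ => id

theorem eventually_denom_ne_zero (f : RatFunc ℂ) : ∀ᶠ z in codiscrete ℂ, f.denom.eval z ≠ 0 :=
  eventually_eval_ne_zero f.denom_ne_zero

theorem val_C (c z : ℂ) : val (RatFunc.C c) z = c := by
  rw [val, RatFunc.eval_C, RingHom.id_apply]

theorem eventually_val_add (f g : RatFunc ℂ) :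
    ∀ᶠ z in codiscrete ℂ, val (f + g) z = val f z + val g z := by
  filter_upwards [eventually_denom_ne_zero f, eventually_denom_ne_zero g] with z hf hg
  rw [← Polynomial.eval₂_id] at hf hg
  exact RatFunc.eval_add _ _ hf hg

theorem eventually_val_mul (f g : RatFunc ℂ) :
    ∀ᶠ z in codiscrete ℂ, val (f * g) z = val f z * val g z := by
  filter_upwards [eventually_denom_ne_zero f, eventually_denom_ne_zero g] with z hf hg
  rw [← Polynomial.eval₂_id] at hf hg
  exact RatFunc.eval_mul _ _ hf hg

theorem val_algebraMap (p : ℂ[X]) (z : ℂ) : val (algebraMap ℂ[X] (RatFunc ℂ) p) z = p.eval z := by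
  rw [val_eq, RatFunc.num_algebraMap, RatFunc.denom_algebraMap, Polynomial.eval_one, div_one]

theorem eventually_hasDerivAt_val (f : RatFunc ℂ) :
    ∀ᶠ z in codiscrete ℂ, HasDerivAt (val f) (val (ratDeriv f) z) z := by
  have hd : algebraMap ℂ[X] (RatFunc ℂ) (f.denom ^ 2) ≠ 0 :=
    RatFunc.algebraMap_ne_zero (pow_ne_zero 2 f.denom_ne_zero)
  have hmul : ratDeriv f * algebraMap ℂ[X] (RatFunc ℂ) (f.denom ^ 2) =
      algebraMap ℂ[X] (RatFunc ℂ)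
        (Polynomial.derivative f.num * f.denom - f.num * Polynomial.derivative f.denom) := by
    rw [ratDeriv, div_mul_cancel₀ _ hd]
  filter_upwards [eventually_denom_ne_zero f,
    eventually_val_mul (ratDeriv f) (algebraMap ℂ[X] (RatFunc ℂ) (f.denom ^ 2))] with z hz hm
  have h1 := (f.num.hasDerivAt z).fun_div (f.denom.hasDerivAt z) hz
  rw [hmul, val_algebraMap, val_algebraMap, Polynomial.eval_pow, ← div_eq_iff (pow_ne_zero 2 hz),
    Polynomial.eval_sub, Polynomial.eval_mul, Polynomial.eval_mul] at hm
  rw [hm] at h1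
  exact h1.congr_of_eventuallyEq (Eventually.of_forall fun w => val_eq f w)

theorem eq_zero_of_eventually_val {f : RatFunc ℂ} (h : ∀ᶠ z in codiscrete ℂ, val f z = 0) :
    f = 0 := by
  by_contra hf
  obtain ⟨z, h1, h2, h3⟩ := (h.and ((eventually_denom_ne_zero f).and
    (eventually_eval_ne_zero (RatFunc.num_ne_zero hf)))).exists
  rw [val_eq, div_eq_zero_iff] at h1
  exact h1.elim h3 h2

theorem eq_of_eventually_val_eq {f g : RatFunc ℂ} (h : ∀ᶠ z in codiscrete ℂ, val f z = val g z) :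
    f = g := by
  have h0 : f + RatFunc.C (-1) * g = 0 := by
    refine eq_zero_of_eventually_val ?_
    filter_upwards [h, eventually_val_add f (RatFunc.C (-1) * g),
      eventually_val_mul (RatFunc.C (-1)) g] with z h1 h2 h3
    rw [h2, h3, val_C, h1]
    ring
  rw [map_neg, map_one] at h0
  linear_combination h0

theorem meromorphic_val (f : RatFunc ℂ) : Meromorphic (val f) := by
  rw [show val f = fun z => f.num.eval z / f.denom.eval z from funext (val_eq f)]
  exact fun α => (analyticAt_polynomial _ α).meromorphicAt.div
    (analyticAt_polynomial _ α).meromorphicAt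

theorem eventually_hasDerivAt_exp_mul_val (k : ℂ) (f : RatFunc ℂ) :
    ∀ᶠ z in codiscrete ℂ, HasDerivAt (fun t => Complex.exp (k * t) * val f t)
      (Complex.exp (k * z) * val (RatFunc.C k * f + ratDeriv f) z) z := by
  filter_upwards [eventually_hasDerivAt_val f, eventually_val_mul (RatFunc.C k) f,
    eventually_val_add (RatFunc.C k * f) (ratDeriv f)] with z h1 h2 h3
  rw [h3, h2, val_C]
  exact ((hasDerivAt_exp_mul k z).fun_mul h1).congr_deriv (by ring)

theorem eventually_deriv_exp_mul_val (k : ℂ) (f : RatFunc ℂ) :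
    ∀ᶠ z in codiscrete ℂ, deriv (fun t => Complex.exp (k * t) * val f t) z =
      Complex.exp (k * z) * val (RatFunc.C k * f + ratDeriv f) z :=
  (eventually_hasDerivAt_exp_mul_val k f).mono fun _ h => h.deriv

theorem isMeromorphicSolution_exp_mul_val {q R : RatFunc ℂ} {qInf k E : ℂ}
    (hk : k ^ 2 = E - qInf) (hR : conjOp (q - RatFunc.C qInf) k R = 0) :
    IsMeromorphicSolution q E (fun z => Complex.exp (k * z) * val R z) := by
  refine ⟨fun z => (analyticAt_exp_mul k z).meromorphicAt.mul (meromorphic_val R z), ?_⟩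
  have halg : RatFunc.C k * (RatFunc.C k * R + ratDeriv R) +
      ratDeriv (RatFunc.C k * R + ratDeriv R) + q * R = RatFunc.C E * R := by
    have hE : E = k ^ 2 + qInf := by rw [hk]; ring
    rw [conjOp] at hR
    rw [ratDeriv_add, ratDeriv_C_mul, hE]
    simp only [map_add, map_pow, map_mul, map_ofNat] at hR ⊢
    linear_combination hR
  set R₁ := RatFunc.C k * R + ratDeriv R with hR₁
  filter_upwards [eventually_codiscrete_eventually_nhds (eventually_deriv_exp_mul_val k R),
    eventually_deriv_exp_mul_val k R₁, eventually_val_mul q R, eventually_val_mul (RatFunc.C E) R,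
    eventually_val_add (RatFunc.C k * R₁ + ratDeriv R₁) (q * R)] with z h1 h2 h3 h4 h5
  rw [Filter.EventuallyEq.deriv_eq h1, h2]
  rw [halg, h4, val_C, h3] at h5
  linear_combination -Complex.exp (k * z) * h5

/-- Logarithmic derivatives would give `κ + f' / f = g' / g`. Those of rational functions vanish at
infinity, which forces `κ = 0`. -/
theorem not_eventually_exp_mul_val_eq {κ : ℂ} (hκ : κ ≠ 0) {f : RatFunc ℂ} (hf : f ≠ 0)
    (g : RatFunc ℂ) : ¬ ∀ᶠ z in codiscrete ℂ, Complex.exp (κ * z) * val f z = val g z := by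
  intro h
  have hg : g ≠ 0 := by
    rintro rfl
    refine hf (eq_zero_of_eventually_val ?_)
    filter_upwards [h] with z hz
    rw [← map_zero (RatFunc.C (K := ℂ)), val_C] at hz
    exact (mul_eq_zero.1 hz).resolve_left (Complex.exp_ne_zero _)
  have halg : (RatFunc.C κ * f + ratDeriv f) * g = f * ratDeriv g := by
    refine eq_of_eventually_val_eq ?_
    filter_upwards [h, eventually_codiscrete_eventually_nhds h, eventually_deriv_exp_mul_val κ f,
      eventually_hasDerivAt_val g, eventually_val_mul (RatFunc.C κ * f + ratDeriv f) g,
      eventually_val_mul f (ratDeriv g)] with z h0 h1 h2 h3 h4 h5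
    rw [Filter.EventuallyEq.deriv_eq h1, h3.deriv] at h2
    rw [h4, h5]
    refine mul_left_cancel₀ (Complex.exp_ne_zero (κ * z)) ?_
    linear_combination -val g z * h2 - val (ratDeriv g) z * h0
  obtain ⟨m, hm, hm0⟩ := exists_ordGE ((map_ne_zero expInf).2 hf)
  obtain ⟨n, hn, hn0⟩ := exists_ordGE ((map_ne_zero expInf).2 hg)
  have h1 := congrArg expInf halg
  rw [map_mul, map_mul, map_add, map_mul, expInf_C, expInf_ratDeriv, expInf_ratDeriv] at h1
  have h2 := ((hm.C_mul κ).add (hm.infDeriv.mono (by omega))).coeff_mul hn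
  rw [h1, (hm.mul hn.infDeriv) _ (by omega), HahnSeries.coeff_add, coeff_C_mul',
    hm.infDeriv m (by omega), add_zero] at h2
  exact mul_ne_zero (mul_ne_zero hκ hm0) hn0 h2.symm

theorem eq_zero_of_eventually_exp {k : ℂ} (hk : k ≠ 0) {f : RatFunc ℂ} (hf : f ≠ 0) (g : RatFunc ℂ)
    {a b : ℂ} (h : ∀ᶠ z in codiscrete ℂ,
      a * (Complex.exp (k * z) * val f z) + b * (Complex.exp (-k * z) * val g z) = 0) : a = 0 := by
  by_contra ha
  have haf : RatFunc.C a * f ≠ 0 := mul_ne_zero ((map_ne_zero _).2 ha) hf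
  refine not_eventually_exp_mul_val_eq (mul_ne_zero two_ne_zero hk) haf (RatFunc.C (-b) * g) ?_
  filter_upwards [h, eventually_val_mul (RatFunc.C a) f, eventually_val_mul (RatFunc.C (-b)) g]
    with z h1 h2 h3
  have h4 : Complex.exp (2 * k * z) * Complex.exp (-k * z) = Complex.exp (k * z) := by
    rw [← Complex.exp_add]
    ring_nf
  rw [h2, h3, val_C, val_C]
  refine mul_left_cancel₀ (Complex.exp_ne_zero (-k * z)) ?_
  linear_combination h1 + a * val f z * h4

/-- For `k ≠ 0` the solutions belonging to `k` and `-k` are independent because their exponential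
ratio is not rational. At `E = q∞` both exponents collapse, and the kernel of dimension two for `k =
0` takes over. -/
theorem IsLocusData.hasMeromorphicFundamentalSystem {q : RatFunc ℂ} {qInf : ℂ} {M : ℕ}
    {s : Fin M → ℕ} {ζ : Fin M → ℂ} (h : IsLocusData q qInf s ζ) (E : ℂ) :
    HasMeromorphicFundamentalSystem q E := by
  obtain ⟨k, hk⟩ := IsAlgClosed.exists_pow_nat_eq (E - qInf) zero_lt_two
  by_cases hk0 : k = 0
  · obtain ⟨R, hR, hR0⟩ := h.sub_C.exists_conjOp_eq_zero (k := k) (r := 2) (Or.inr ⟨rfl, hk0⟩)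
    refine ⟨_, _, isMeromorphicSolution_exp_mul_val hk (hR0 0),
      isMeromorphicSolution_exp_mul_val hk (hR0 1), fun a b hab => ?_⟩
    rw [← show ![R 0, R 1] = R from List.ofFn_inj.1 rfl, LinearIndependent.pair_iff] at hR
    refine hR a b ?_
    rw [smul_eq_C_mul, smul_eq_C_mul]
    refine eq_zero_of_eventually_val ?_
    filter_upwards [hab, eventually_val_add (RatFunc.C a * R 0) (RatFunc.C b * R 1),
      eventually_val_mul (RatFunc.C a) (R 0), eventually_val_mul (RatFunc.C b) (R 1)]
      with z h1 h2 h3 h4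
    rw [hk0, zero_mul, Complex.exp_zero, one_mul, one_mul] at h1
    rw [h2, h3, h4, val_C, val_C, h1]
  · obtain ⟨R₁, hR₁, h₁⟩ := h.sub_C.exists_conjOp_eq_zero (k := k) (r := 1) (Or.inl rfl)
    obtain ⟨R₂, hR₂, h₂⟩ := h.sub_C.exists_conjOp_eq_zero (k := -k) (r := 1) (Or.inl rfl)
    refine ⟨_, _, isMeromorphicSolution_exp_mul_val hk (h₁ 0),
      isMeromorphicSolution_exp_mul_val ((neg_sq k).trans hk) (h₂ 0), fun a b hab => ⟨?_, ?_⟩⟩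
    · exact eq_zero_of_eventually_exp hk0 (hR₁.ne_zero 0) (R₂ 0) hab
    · refine eq_zero_of_eventually_exp (neg_ne_zero.2 hk0) (hR₂.ne_zero 0) (R₁ 0) (b := a) ?_
      filter_upwards [hab] with z hz
      rw [neg_neg, add_comm]
      exact hz

end FormalToMeromorphic

/-! ### The two characterizations of the locus -/

theorem isHalphenPotential_iff {q : RatFunc ℂ} (hq : ∀ c : ℂ, q ≠ RatFunc.C c) :
    IsHalphenPotential q ↔
      ∃ (M : ℕ) (s : Fin M → ℕ) (qInf : ℂ) (ζ : Fin M → ℂ), IsLocusData q qInf s ζ :=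
  ⟨fun h => h.exists_isLocusData hq, fun ⟨_, _, _, _, h⟩ =>
    ⟨h.boundedNearInfinity, h.hasMeromorphicFundamentalSystem⟩⟩

theorem isKdVPotential_iff {q : RatFunc ℂ} (hq : ∀ c : ℂ, q ≠ RatFunc.C c) :
    IsKdVPotential q ↔
      ∃ (M : ℕ) (s : Fin M → ℕ) (qInf : ℂ) (ζ : Fin M → ℂ), IsLocusData q qInf s ζ := by
  refine ⟨fun h => h.exists_isLocusData hq, fun ⟨_, _, _, _, h⟩ => ?_⟩
  obtain ⟨g, -, -, ⟨f, hf, -⟩, -⟩ := h.exists_hasSpectralCurve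
  exact ⟨g, f, hf⟩

end HalphenKdV

end

theorem theorem3p6 (q : RatFunc ℂ) (hq : ∀ c : ℂ, q ≠ RatFunc.C c) :
    -- Halphen potentials
    (HalphenKdV.IsHalphenPotential q ↔
      ∃ (M : ℕ) (s : Fin M → ℕ) (qInf : ℂ) (ζ : Fin M → ℂ),
        HalphenKdV.IsLocusData q qInf s ζ) ∧
    -- rational KdV potentials
    (HalphenKdV.IsKdVPotential q ↔
      ∃ (M : ℕ) (s : Fin M → ℕ) (qInf : ℂ) (ζ : Fin M → ℂ),
        HalphenKdV.IsLocusData q qInf s ζ) ∧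
    -- the isospectral class of the curve `y² = (E - q∞) ^ (2g+1)`
    (∀ (g : ℕ) (qInf : ℂ),
      HalphenKdV.HasSpectralCurve q g ((Polynomial.X - Polynomial.C qInf) ^ (2 * g + 1)) ↔
        ∃ (M : ℕ) (s : Fin M → ℕ) (ζ : Fin M → ℂ),
          HalphenKdV.IsLocusData q qInf s ζ ∧ ∑ l, s l * (s l + 1) = g * (g + 1)) ∧
    -- every choice of data on the locus belongs to one of these classes
    (∀ (M : ℕ) (s : Fin M → ℕ) (qInf : ℂ) (ζ : Fin M → ℂ),
      HalphenKdV.IsLocusData q qInf s ζ →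
        ∃ g : ℕ, 1 ≤ g ∧ ∑ l, s l * (s l + 1) = g * (g + 1)) := by
  refine ⟨HalphenKdV.isHalphenPotential_iff hq, HalphenKdV.isKdVPotential_iff hq,
    HalphenKdV.hasSpectralCurve_iff hq, fun M s qInf ζ h => ?_⟩
  obtain ⟨g, hg, hsum, -⟩ := h.exists_hasSpectralCurve
  exact ⟨g, hg, hsum⟩
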